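/- Let $q_2,q_3\in L_2(0,1)$ be complex-valued and put $\omega_j=\int_0^1 q_j(x)\,dx$, $j=2,3$. For $k=1,2$ let $\mathcal G_k(q_2,q_3)$ be the eigenvalue problem, with delay $1$, on the star graph with three edges of length $1$: $$-y_1''(x)=\lambda y_1(x),\qquad -y_j''(x)+q_j(x)y_1(x)=\lambda y_j(x)\ \ (j=2,3),\qquad 0<x<1,$$ $$y_1(1)=y_2(0)=y_3(0),\qquad y_1'(1)=y_2'(0)+y_3'(0),\qquad y_1(0)=y_2^{(k-1)}(1)=y_3^{(2-k)}(1)=0,$$ where $y_j\in C^1[0,1]$ have absolutely continuous derivatives and the equations hold almost everywhere. Let $\Lambda_k$ be its spectrum, that is, the set of its eigenvalues, each one counted with its algebraic multiplicity (the dimension of the span of the eigenfunctions and associated functions). Put $$F_k(\lambda)=S_k(\sqrt\lambda),\qquad S_k(\rho)=\rho\,\frac{1+3\cos2\rho}{2}\,\sin\rho-\frac{\omega_2+\omega_3}{4}\cos2\rho+(-1)^k\,\frac{\omega_2-\omega_3}{4};$$ the function $F_k$ is entire, since $S_k$ is even. **Theorem 1.** Let $k\in\{1,2\}$. The set of eigenvalues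 of $\mathcal G_k(q_2,q_3)$ is infinite. The zeros of $F_k$, counted with multiplicity, can be written as $\{(z^0_{n,k})^2\}_{n\ge0}$ with $0\le\operatorname{Re}z^0_{n,k}\le\operatorname{Re}z^0_{n+1,k}$ for all $n\ge 0$, and for every such sequence $\{z^0_{n,k}\}_{n\ge0}$ there are complex numbers $z_{n,k}$, $n\ge1$, and a sequence $\{\varkappa_n\}\in l_2$ such that $$z_{n,k}=z^0_{n,k}+\frac{\varkappa_n}{n},\qquad n\ge1,$$ and $\Lambda_k=\{z_{n,k}^2\}_{n\ge1}$ with account of multiplicity. -/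

import Mathlib

open MeasureTheory

noncomputable section

namespace StarGraphDelay

/-- The potentials on the three edges: the first one vanishes identically. The indices `0, 1, 2`
of `Fin 3` stand for the edges `e₁, e₂, e₃`. -/
def potential (q₂ q₃ : ℝ → ℂ) : Fin 3 → ℝ → ℂ := ![0, q₂, q₃]

/-- `Solves q₂ q₃ k lam u f`: the function `u = [u₁, u₂, u₃]` on the graph, each `u_j` being `C¹`
on `[0, 1]` with an absolutely continuous derivative `p_j`, satisfies a.e. on `(0, 1)`
`-u_j'' + q_j u₁ - lam u_j = f_j` (with `q₁ = 0`), the matching conditions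
`u₁(1) = u₂(0) = u₃(0)`, `u₁'(1) = u₂'(0) + u₃'(0)` and the boundary conditions
`u₁(0) = u₂^{(k-1)}(1) = u₃^{(2-k)}(1) = 0`.
Only the values of `u` and `f` on `[0, 1]` matter. -/
def Solves (q₂ q₃ : ℝ → ℂ) (k : ℕ) (lam : ℂ) (u f : Fin 3 → ℝ → ℂ) : Prop :=
  ∃ p : Fin 3 → ℝ → ℂ,
    (∀ j, ∀ x ∈ Set.Icc (0 : ℝ) 1, HasDerivWithinAt (u j) (p j x) (Set.Icc 0 1) x) ∧
    (∀ j, AbsolutelyContinuousOnInterval (p j) 0 1) ∧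
    (∀ j, ∀ᵐ x ∂(volume.restrict (Set.Ioo (0 : ℝ) 1)), ∃ w : ℂ, HasDerivAt (p j) w x ∧
      -w + potential q₂ q₃ j x * u 0 x - lam * u j x = f j x) ∧
    (u 0 1 = u 1 0 ∧ u 0 1 = u 2 0 ∧ p 0 1 = p 1 0 + p 2 0) ∧
    u 0 0 = 0 ∧
    (k = 1 → u 1 1 = 0 ∧ p 2 1 = 0) ∧
    (k = 2 → p 1 1 = 0 ∧ u 2 1 = 0)

/-- `lam` is an eigenvalue: the homogeneous problem has a solution that is nonzero on the graph. -/
def IsEigenvalue (q₂ q₃ : ℝ → ℂ) (k : ℕ) (lam : ℂ) : Prop :=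
  ∃ u : Fin 3 → ℝ → ℂ, (∃ j, ∃ x ∈ Set.Icc (0 : ℝ) 1, u j x ≠ 0) ∧ Solves q₂ q₃ k lam u 0

/-- The spectrum of the eigenvalue problem, as a set. -/
def spectrumSet (q₂ q₃ : ℝ → ℂ) (k : ℕ) : Set ℂ := {lam | IsEigenvalue q₂ q₃ k lam}

/-- `u` belongs to the kernel of the `n`-th power of `L - lam`, where `L` is the operator
`u ↦ [-u₁'', -u₂'' + q₂ u₁, -u₃'' + q₃ u₁]` on the functions that satisfy the matching and boundary
conditions: `u` ends a chain `0 = u⁰, u¹, …, uⁿ = u` with `(L - lam) uⁱ⁺¹ = uⁱ`. -/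
def IsRootFunction (q₂ q₃ : ℝ → ℂ) (k : ℕ) (lam : ℂ) : ℕ → (Fin 3 → ℝ → ℂ) → Prop
  | 0, u => ∀ j, ∀ x ∈ Set.Icc (0 : ℝ) 1, u j x = 0
  | n + 1, u => ∃ f, IsRootFunction q₂ q₃ k lam n f ∧ Solves q₂ q₃ k lam u f

/-- The root subspace of `lam`: the linear span of all eigenfunctions and associated functions,
regarded as functions on the graph, i.e. on three copies of `[0, 1]`. -/
def rootSubspace (q₂ q₃ : ℝ → ℂ) (k : ℕ) (lam : ℂ) :
    Submodule ℂ (Fin 3 → Set.Icc (0 : ℝ) 1 → ℂ) :=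
  Submodule.span ℂ {y | ∃ (n : ℕ) (u : Fin 3 → ℝ → ℂ),
    IsRootFunction q₂ q₃ k lam n u ∧ y = fun (j : Fin 3) (x : Set.Icc (0 : ℝ) 1) => u j x}

/-- The (algebraic) multiplicity of `lam`, the dimension of its root subspace; it is `0` if `lam`
is not an eigenvalue and `⊤` if the root subspace is infinite-dimensional. -/
def multiplicity (q₂ q₃ : ℝ → ℂ) (k : ℕ) (lam : ℂ) : ℕ∞ :=
  Cardinal.toENat (Module.rank ℂ (rootSubspace q₂ q₃ k lam))

/-- The even entire function `S_k`. -/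
def modelS (ω₂ ω₃ : ℂ) (k : ℕ) (ρ : ℂ) : ℂ :=
  ρ * ((1 + 3 * Complex.cos (2 * ρ)) / 2) * Complex.sin ρ
    - (ω₂ + ω₃) / 4 * Complex.cos (2 * ρ) + (-1) ^ k * ((ω₂ - ω₃) / 4)

/-- The model function `F_k(lam) = S_k(√lam)`, which is entire because `S_k` is even. -/
def modelF (ω₂ ω₃ : ℂ) (k : ℕ) (lam : ℂ) : ℂ := modelS ω₂ ω₃ k (lam ^ (1 / 2 : ℂ))

/-- `(z⁰_n)²`, `n ≥ 0`, are all zeros of `F_k` with account of multiplicity, and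
`0 ≤ Re z⁰_n ≤ Re z⁰_{n+1}`. -/
def IsModelSequence (ω₂ ω₃ : ℂ) (k : ℕ) (z₀ : ℕ → ℂ) : Prop :=
  (∀ lam : ℂ, {n : ℕ | z₀ n ^ 2 = lam}.encard = analyticOrderAt (modelF ω₂ ω₃ k) lam) ∧
    (∀ n, 0 ≤ (z₀ n).re ∧ (z₀ n).re ≤ (z₀ (n + 1)).re)

end StarGraphDelay

end

noncomputable section

namespace StarGraphDelay
open Complex Topology Filter Metric Set
open scoped Real

/-! ### Even entire functions as functions of the square -/

/-! Write `lam = ρ ^ 2` and take `k = 1`. Only `y₁` enters the delayed terms, and on the first edge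
`y₁` is a multiple of `sin (ρ x) / ρ`. The other two equations therefore have a known forcing term
and are solved explicitly by variation of constants. Once the condition at the origin and the
matching conditions are used, two free parameters remain, and the two end conditions form a linear
system in them whose determinant is the entire function `charDelta`, written `Δ` here. The exact
identity `sq_mul_charDelta_sq` says `ρ² Δ(ρ²) = S₁(ρ) + Q(ρ)`, where `Q = remainder` is built from
trigonometric integrals of `q₂` and `q₃`. The theorem thus compares the zeros of `F` with those of
`lam * Δ(lam)`, which has one surplus zero at the origin; this is why the `z n` are numbered from
`1` and the `z₀ n` from `0`.

Multiplicities. An entire family of solutions is chosen (`familyU`) whose defects in both end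
conditions are multiples of `Δ`. If `Δ` vanishes to order `m` at `lam`, the first `m` Taylor
coefficients of the family at `lam` form a chain of an eigenfunction and associated functions. Every
root function is a combination of them and they are linearly independent, so the algebraic
multiplicity is `m` (`multiplicity_eq_of_factor`).

Zeros. The leading term `ρ * trigFactor ρ` has simple zeros at the nonzero points of `base`, a union
of three arithmetic progressions of step `π`. Away from `base` it dominates any term of size `exp (2
|Im ρ|)`. Rouché's theorem on large discs shows that `F` and `lam * Δ(lam)` have equally many zeros
there, and on discs of radius `1/10` it places exactly one simple zero of each next to every distant
positive point of `base` (`IsLift.exists_isLocalized`). Near `b` in `base` the functions expand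
distances by a factor of at least `b / 2`, so the two zeros belonging to `b` differ by at most `2
|Q| / b`, with `Q` taken at the perturbed zero.

Summability. That zero is within `O(1/b)` of `b`, so `Q` may be evaluated at `b` up to an `O(1/b)`
error, and by Parseval's identity the values of `Q` on each progression are square-summable
(`summable_remainder`). Since `b` grows at least linearly in `n`, the conclusion follows
(`exists_perturbed_sequence`). The case `k = 2` is the case `k = 1` with the last two edges
exchanged. -/

lemma sqrt_sq (z : ℂ) : (z ^ (1 / 2 : ℂ)) ^ 2 = z := by
  simp

lemma apply_sqrt_of_even {f : ℂ → ℂ} (he : ∀ w, f (-w) = f w) {z w : ℂ} (h : w ^ 2 = z) :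
    f (z ^ (1 / 2 : ℂ)) = f w := by
  have h1 : (z ^ (1 / 2 : ℂ)) ^ 2 = w ^ 2 := by rw [sqrt_sq, h]
  rcases sq_eq_sq_iff_eq_or_eq_neg.1 h1 with h2 | h2 <;> rw [h2]
  exact he w

/-- The principal root is holomorphic on the slit plane. On the cut it is replaced by `I * (-z) ^ (1
/ 2)`, which has the same square and hence the same image under an even function. The origin is a
removable singularity because the root is continuous there. -/
lemma differentiable_comp_sqrt {f : ℂ → ℂ} (hf : Differentiable ℂ f) (he : ∀ w, f (-w) = f w) :
    Differentiable ℂ (fun z => f (z ^ (1 / 2 : ℂ))) := by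
  have hne : ∀ z : ℂ, z ≠ 0 → DifferentiableAt ℂ (fun z => f (z ^ (1 / 2 : ℂ))) z := by
    intro z hz
    rcases Complex.mem_slitPlane_or_neg_mem_slitPlane hz with h | h
    · exact (hf _).comp z ((hasDerivAt_id z).cpow_const h).differentiableAt
    · have h1 : (fun z => f (z ^ (1 / 2 : ℂ))) = fun z : ℂ => f (I * (-z) ^ (1 / 2 : ℂ)) := by
        funext z
        exact apply_sqrt_of_even he (by rw [mul_pow, sqrt_sq]; simp)
      rw [h1]
      refine (hf _).comp z (DifferentiableAt.const_mul ?_ I)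
      exact ((hasDerivAt_neg z).cpow_const h).differentiableAt
  intro z
  by_cases hz : z = 0
  · subst hz
    refine (Complex.analyticAt_of_differentiable_on_punctured_nhds_of_continuousAt ?_ ?_).differentiableAt
    · filter_upwards [self_mem_nhdsWithin] with z hz using hne z hz
    · refine ContinuousAt.comp (f := fun z : ℂ => z ^ (1 / 2 : ℂ)) (hf _).continuousAt ?_
      exact (Complex.continuousAt_cpow_zero_of_re_pos (z := 1 / 2) (by norm_num)).comp
        (f := fun z : ℂ => (z, (1 / 2 : ℂ))) (by fun_prop)
  · exact hne z hz

/-- `cos √z`, an entire function. -/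
def cosSqrt (z : ℂ) : ℂ := cos (z ^ (1 / 2 : ℂ))

/-- `sin √z / √z`, an entire function. -/
def sincSqrt (z : ℂ) : ℂ := -2 * deriv cosSqrt z

lemma cosSqrt_sq (w : ℂ) : cosSqrt (w ^ 2) = cos w := apply_sqrt_of_even cos_neg rfl

lemma differentiable_cosSqrt : Differentiable ℂ cosSqrt :=
  differentiable_comp_sqrt differentiable_cos cos_neg

lemma differentiable_sincSqrt : Differentiable ℂ sincSqrt := by
  have : Differentiable ℂ (deriv cosSqrt) := fun z =>
    (differentiable_cosSqrt.analyticAt z).deriv.differentiableAt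
  exact this.const_mul _

lemma hasDerivAt_cosSqrt (z : ℂ) : HasDerivAt cosSqrt (-(sincSqrt z) / 2) z := by
  have h : -(sincSqrt z) / 2 = deriv cosSqrt z := by unfold sincSqrt; ring
  rw [h]
  exact (differentiable_cosSqrt z).hasDerivAt

/-- Differentiating `cosSqrt (w ^ 2) = cos w` gives this identity. Defining `sincSqrt` by a
derivative makes it entire without a separate value at the origin. -/
lemma mul_sincSqrt_sq (w : ℂ) : w * sincSqrt (w ^ 2) = sin w := by
  have h1 : HasDerivAt (fun w : ℂ => cosSqrt (w ^ 2)) (-(sincSqrt (w ^ 2)) / 2 * (2 * w)) w := by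
    simpa [Function.comp_def] using (hasDerivAt_cosSqrt (w ^ 2)).comp w (hasDerivAt_pow 2 w)
  have h2 : (fun w : ℂ => cosSqrt (w ^ 2)) = cos := funext cosSqrt_sq
  rw [h2] at h1
  have := h1.unique (Complex.hasDerivAt_cos w)
  linear_combination -this

lemma cosSqrt_sq_add (z : ℂ) : cosSqrt z ^ 2 + z * sincSqrt z ^ 2 = 1 := by
  obtain ⟨w, rfl⟩ : ∃ w : ℂ, w ^ 2 = z := ⟨_, sqrt_sq z⟩
  have := mul_sincSqrt_sq w
  rw [cosSqrt_sq, ← cos_sq_add_sin_sq w, ← this]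
  ring

lemma sincSqrt_add_deriv (z : ℂ) : sincSqrt z + 2 * z * deriv sincSqrt z = cosSqrt z := by
  obtain ⟨w, rfl⟩ : ∃ w : ℂ, w ^ 2 = z := ⟨_, sqrt_sq z⟩
  have h1 : HasDerivAt (fun w : ℂ => w * sincSqrt (w ^ 2))
      (1 * sincSqrt (w ^ 2) + w * (deriv sincSqrt (w ^ 2) * (2 * w))) w := by
    refine (hasDerivAt_id w).mul ?_
    simpa [Function.comp_def] using (differentiable_sincSqrt (w ^ 2)).hasDerivAt.comp w (hasDerivAt_pow 2 w)
  have h2 : (fun w : ℂ => w * sincSqrt (w ^ 2)) = sin := funext mul_sincSqrt_sq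
  rw [h2] at h1
  have := h1.unique (Complex.hasDerivAt_sin w)
  rw [cosSqrt_sq, ← this]
  ring

/-! ### Zeros of entire functions and Rouché's theorem -/

/-- The local cofactor supplied by the analytic order agrees near `a` with the quotient `f z / (z -
a) ^ m`, so the two patch to a single entire function. A global cofactor is needed because it is
later integrated over circles of radius one. -/
lemma exists_eq_sub_pow_mul {f : ℂ → ℂ} (hf : Differentiable ℂ f) {a : ℂ} {m : ℕ}
    (hm : analyticOrderAt f a = m) :
    ∃ g : ℂ → ℂ, Differentiable ℂ g ∧ g a ≠ 0 ∧ ∀ z, f z = (z - a) ^ m * g z := by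
  obtain ⟨g, hg, hga, hfg⟩ := (hf.analyticAt a).analyticOrderAt_eq_natCast.1 hm
  classical
  let G : ℂ → ℂ := fun z => if z = a then g a else f z / (z - a) ^ m
  have hGg : G =ᶠ[𝓝 a] g := by
    filter_upwards [hfg] with z hz
    by_cases h : z = a
    · simp [G, h]
    · have : (z - a) ^ m ≠ 0 := pow_ne_zero _ (sub_ne_zero.2 h)
      simp only [G, h, if_false, hz, smul_eq_mul]
      field_simp
  refine ⟨G, fun z => ?_, by simpa [G] using hga, fun z => ?_⟩
  · by_cases h : z = a
    · rw [h]
      exact hGg.differentiableAt_iff.2 hg.differentiableAt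
    · have h1 : G =ᶠ[𝓝 z] fun z => f z / (z - a) ^ m := by
        filter_upwards [isOpen_ne.mem_nhds h] with y hy
        simp [G, show y ≠ a from hy]
      refine h1.differentiableAt_iff.2 ((hf z).div (by fun_prop) ?_)
      exact pow_ne_zero _ (sub_ne_zero.2 h)
  · by_cases h : z = a
    · have := hfg.self_of_nhds
      simpa [G, h] using this
    · have : (z - a) ^ m ≠ 0 := pow_ne_zero _ (sub_ne_zero.2 h)
      simp only [G, h, if_false]
      field_simp

lemma analyticOrderAt_ne_top_of_entire {f : ℂ → ℂ} (hf : Differentiable ℂ f) {w : ℂ}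
    (hw : f w ≠ 0) (a : ℂ) : analyticOrderAt f a ≠ ⊤ := by
  have h1 : AnalyticOnNhd ℂ f univ := fun z _ => hf.analyticAt z
  refine h1.analyticOrderAt_ne_top_of_isPreconnected isPreconnected_univ (mem_univ w) (mem_univ a) ?_
  rw [(hf.analyticAt w).analyticOrderAt_eq_zero.2 hw]
  simp

lemma natCast_analyticOrderNatAt_of_entire {f : ℂ → ℂ} (hf : Differentiable ℂ f) {w : ℂ}
    (hw : f w ≠ 0) (a : ℂ) : (analyticOrderNatAt f a : ℕ∞) = analyticOrderAt f a :=
  Nat.cast_analyticOrderNatAt (analyticOrderAt_ne_top_of_entire hf hw a)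

lemma analyticOrderNatAt_ne_zero_iff {f : ℂ → ℂ} (hf : Differentiable ℂ f) {w : ℂ}
    (hw : f w ≠ 0) (a : ℂ) : analyticOrderNatAt f a ≠ 0 ↔ f a = 0 := by
  rw [← (hf.analyticAt a).analyticOrderAt_ne_zero, ← natCast_analyticOrderNatAt_of_entire hf hw a]
  simp

/-- The zeros are split off one at a time: the product already removed does not vanish at the next
point, so the current cofactor has there the same order as `f`. -/
lemma exists_eq_prod_mul {f : ℂ → ℂ} (hf : Differentiable ℂ f) {w : ℂ} (hw : f w ≠ 0)
    (Z : Finset ℂ) : ∃ g : ℂ → ℂ, Differentiable ℂ g ∧ (∀ a ∈ Z, g a ≠ 0) ∧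
      ∀ z, f z = (∏ a ∈ Z, (z - a) ^ analyticOrderNatAt f a) * g z := by
  classical
  induction Z using Finset.induction_on with
  | empty => exact ⟨f, hf, by simp, by simp⟩
  | insert b Z hb ih =>
    obtain ⟨g, hg, hgZ, hfg⟩ := ih
    have hgw : g w ≠ 0 := by
      intro h
      exact hw (by rw [hfg, h, mul_zero])
    have hP : Differentiable ℂ (fun z : ℂ => ∏ a ∈ Z, (z - a) ^ analyticOrderNatAt f a) := by
      fun_prop
    have hPb : (∏ a ∈ Z, (b - a) ^ analyticOrderNatAt f a) ≠ 0 := by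
      refine Finset.prod_ne_zero_iff.2 fun a ha => pow_ne_zero _ (sub_ne_zero.2 ?_)
      rintro rfl
      exact hb ha
    have hord : analyticOrderAt g b = analyticOrderNatAt f b := by
      have h1 : f = (fun z : ℂ => ∏ a ∈ Z, (z - a) ^ analyticOrderNatAt f a) * g := by
        funext z; exact hfg z
      rw [natCast_analyticOrderNatAt_of_entire hf hw b]
      conv_rhs => rw [h1]
      rw [analyticOrderAt_mul (hP.analyticAt b) (hg.analyticAt b),
        (hP.analyticAt b).analyticOrderAt_eq_zero.2 hPb, zero_add]
    obtain ⟨G, hG, hGb, hgG⟩ := exists_eq_sub_pow_mul hg hord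
    refine ⟨G, hG, fun a ha => ?_, fun z => ?_⟩
    · rcases Finset.mem_insert.1 ha with rfl | ha
      · exact hGb
      · intro h
        exact hgZ a ha (by rw [hgG, h, mul_zero])
    · rw [Finset.prod_insert hb, hfg, hgG]
      ring

lemma finite_zeros_closedBall {f : ℂ → ℂ} (hf : Differentiable ℂ f) {w : ℂ} (hw : f w ≠ 0)
    (c : ℂ) (R : ℝ) : {z | z ∈ closedBall c R ∧ f z = 0}.Finite := by
  by_contra h
  obtain ⟨x, -, hx⟩ := Set.Infinite.exists_accPt_of_subset_isCompact h (isCompact_closedBall c R)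
    (fun z hz => hz.1)
  have h1 : ∃ᶠ z in 𝓝[≠] x, f z = 0 := by
    rw [accPt_iff_frequently_nhdsNE] at hx
    exact hx.mono fun z hz => hz.2
  have h2 := (show AnalyticOnNhd ℂ f univ from fun z _ => hf.analyticAt z).eqOn_zero_of_preconnected_of_frequently_eq_zero
    isPreconnected_univ (mem_univ x) h1
  exact hw (h2 (mem_univ w))

/-- The argument principle on a disc for an entire function. -/
lemma circleIntegral_logDeriv {f : ℂ → ℂ} (hf : Differentiable ℂ f) {c : ℂ} {R : ℝ} (hR : 0 < R)
    (hs : ∀ z ∈ sphere c R, f z ≠ 0) (Z : Finset ℂ)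
    (hZ : ∀ z, z ∈ Z ↔ z ∈ ball c R ∧ f z = 0) :
    (∮ z in C(c, R), deriv f z / f z) = 2 * π * I * (∑ a ∈ Z, analyticOrderNatAt f a : ℕ) := by
  have hw : f (c + R) ≠ 0 := hs _ (by simp [abs_of_pos hR])
  obtain ⟨g, hg, hgZ, hfg⟩ := exists_eq_prod_mul hf hw Z
  have hg0 : ∀ z ∈ closedBall c R, g z ≠ 0 := by
    intro z hz h0
    have hfz : f z = 0 := by rw [hfg, h0, mul_zero]
    by_cases hzs : z ∈ sphere c R
    · exact hs z hzs hfz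
    · have : z ∈ ball c R := by
        rw [mem_ball]
        exact lt_of_le_of_ne (mem_closedBall.1 hz) (fun h => hzs h)
      exact hgZ z ((hZ z).2 ⟨this, hfz⟩) h0
  have hsub : ∀ z ∈ sphere c R, ∀ a ∈ Z, z - a ≠ 0 := by
    intro z hz a ha h
    have : z = a := sub_eq_zero.1 h
    subst this
    exact hs z hz ((hZ z).1 ha).2
  have hder : ∀ z ∈ sphere c R, deriv f z / f z =
      (∑ a ∈ Z, (analyticOrderNatAt f a : ℂ) * (z - a)⁻¹) + deriv g z / g z := by
    intro z hz
    have h1 : f = fun z => (∏ a ∈ Z, (z - a) ^ analyticOrderNatAt f a) * g z := funext hfg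
    have hgz := hg0 z (sphere_subset_closedBall hz)
    change logDeriv f z = _ + logDeriv g z
    conv_lhs => rw [h1]
    rw [logDeriv_mul z (Finset.prod_ne_zero_iff.2 fun a ha => pow_ne_zero _ (hsub z hz a ha)) hgz
      (by fun_prop) (hg z)]
    congr 1
    have := logDeriv_prod (s := Z) (f := fun a (z : ℂ) => (z - a) ^ analyticOrderNatAt f a) (x := z)
      (fun a ha => pow_ne_zero _ (hsub z hz a ha)) (fun a ha => by fun_prop)
    rw [this]
    refine Finset.sum_congr rfl fun a ha => ?_
    rw [logDeriv_fun_pow (by fun_prop)]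
    congr 1
    simp [logDeriv_apply]
  rw [circleIntegral.integral_congr hR.le hder]
  -- The cofactor has no zero in the closed disc, so its logarithmic derivative is holomorphic there
  -- and Cauchy's theorem applies.
  have hgint : (∮ z in C(c, R), deriv g z / g z) = 0 := by
    refine DiffContOnCl.circleIntegral_eq_zero hR.le (DifferentiableOn.diffContOnCl_ball (U := {z | g z ≠ 0}) ?_ hg0)
    intro z hz
    exact ((hg.analyticAt z).deriv.differentiableAt.div (hg z) hz).differentiableWithinAt
  have hci : ∀ a ∈ Z, CircleIntegrable (fun z => (analyticOrderNatAt f a : ℂ) * (z - a)⁻¹) c R := by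
    intro a ha
    refine ContinuousOn.circleIntegrable hR.le (continuousOn_const.mul ?_)
    exact ContinuousOn.inv₀ (by fun_prop) fun z hz => hsub z hz a ha
  rw [circleIntegral.integral_add (CircleIntegrable.fun_sum Z hci), hgint, add_zero,
    circleIntegral.integral_fun_sum hci]
  · push_cast
    rw [Finset.mul_sum]
    refine Finset.sum_congr rfl fun a ha => ?_
    rw [circleIntegral.integral_const_mul, circleIntegral.integral_sub_inv_of_mem_ball ((hZ a).1 ha).1]
    ring
  · refine ContinuousOn.circleIntegrable hR.le (ContinuousOn.div ?_ hg.continuous.continuousOn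
      fun z hz => hg0 z (sphere_subset_closedBall hz))
    exact fun z _ => (hg.analyticAt z).deriv.continuousAt.continuousWithinAt

/-- Rouché's theorem on a disc for entire functions. -/
theorem sum_analyticOrderNatAt_eq_of_norm_sub_lt {f g : ℂ → ℂ} (hf : Differentiable ℂ f)
    (hg : Differentiable ℂ g) {c : ℂ} {R : ℝ} (hR : 0 < R)
    (hfg : ∀ z ∈ sphere c R, ‖f z - g z‖ < ‖f z‖) (Zf Zg : Finset ℂ)
    (hZf : ∀ z, z ∈ Zf ↔ z ∈ ball c R ∧ f z = 0) (hZg : ∀ z, z ∈ Zg ↔ z ∈ ball c R ∧ g z = 0) :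
    ∑ a ∈ Zf, analyticOrderNatAt f a = ∑ a ∈ Zg, analyticOrderNatAt g a := by
  have hf0 : ∀ z ∈ sphere c R, f z ≠ 0 := fun z hz h => by
    have := hfg z hz
    rw [h, norm_zero] at this
    exact (norm_nonneg _).not_gt this
  have hq : ∀ z ∈ sphere c R, g z / f z ∈ slitPlane := fun z hz => by
    have h1 : ‖g z / f z - 1‖ < 1 := ?_
    · simpa using Complex.mem_slitPlane_of_norm_lt_one h1
    have := hfg z hz
    rw [div_sub_one (hf0 z hz), norm_div, div_lt_one (norm_pos_iff.2 (hf0 z hz)), norm_sub_rev]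
    exact this
  have hg0 : ∀ z ∈ sphere c R, g z ≠ 0 := fun z hz h => by
    have := hq z hz
    simp [h] at this
  -- On the circle `g / f` stays within distance one of `1`, so the principal logarithm of `g / f`
  -- is a single-valued primitive of the difference of the logarithmic derivatives. The integral of
  -- that difference is therefore zero.
  have hder : ∀ z ∈ sphere c R, HasDerivWithinAt (fun z => log (g z / f z))
      (deriv g z / g z - deriv f z / f z) (sphere c R) z := fun z hz => by
    have h1 := (((hg z).hasDerivAt.div (hf z).hasDerivAt (hf0 z hz)).clog (hq z hz))
    refine HasDerivAt.hasDerivWithinAt ?_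
    have h2 := hf0 z hz
    have h3 := hg0 z hz
    have h4 : deriv g z / g z - deriv f z / f z =
        (deriv g z * f z - g z * deriv f z) / f z ^ 2 / (g z / f z) := by field_simp
    rw [h4]
    exact h1
  have hint := circleIntegral.integral_eq_zero_of_hasDerivWithinAt hR.le hder
  have hci : ∀ {h : ℂ → ℂ}, Differentiable ℂ h → (∀ z ∈ sphere c R, h z ≠ 0) →
      CircleIntegrable (fun z => deriv h z / h z) c R := fun {h} hh h0 =>
    ContinuousOn.circleIntegrable hR.le (ContinuousOn.div
      (fun z _ => (hh.analyticAt z).deriv.continuousAt.continuousWithinAt)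
      hh.continuous.continuousOn h0)
  rw [circleIntegral.integral_sub (hci hg hg0) (hci hf hf0),
    circleIntegral_logDeriv hf hR hf0 Zf hZf, circleIntegral_logDeriv hg hR hg0 Zg hZg, ← mul_sub,
    mul_eq_zero] at hint
  rcases hint with h | h
  · exact absurd h two_pi_I_ne_zero
  · exact_mod_cast (sub_eq_zero.1 h).symm

/-! ### The leading trigonometric factor and its zeros -/

/-- `(1 + 3 cos 2z) sin z / 2`, written as a combination of sines. -/
def trigFactor (z : ℂ) : ℂ := (3 * sin (3 * z) - sin z) / 4

/-- The derivative of `trigFactor`. -/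
def trigFactorDeriv (z : ℂ) : ℂ := (9 * cos (3 * z) - cos z) / 4

lemma trigFactor_eq (z : ℂ) : trigFactor z = (1 + 3 * cos (2 * z)) / 2 * sin z := by
  rw [trigFactor, sin_three_mul, cos_two_mul, cos_sq']
  ring

lemma hasDerivAt_trigFactor (z : ℂ) : HasDerivAt trigFactor (trigFactorDeriv z) z := by
  have h1 : HasDerivAt (fun z : ℂ => sin (3 * z)) (cos (3 * z) * 3) z := by
    simpa using ((hasDerivAt_id z).const_mul 3).csin
  refine (((h1.const_mul 3).sub (Complex.hasDerivAt_sin z)).div_const 4).congr_deriv ?_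
  rw [trigFactorDeriv]
  ring

lemma hasDerivAt_trigFactorDeriv (z : ℂ) :
    HasDerivAt trigFactorDeriv ((-27 * sin (3 * z) + sin z) / 4) z := by
  have h1 : HasDerivAt (fun z : ℂ => cos (3 * z)) (-sin (3 * z) * 3) z := by
    simpa using ((hasDerivAt_id z).const_mul 3).ccos
  refine (((h1.const_mul 9).sub (Complex.hasDerivAt_cos z)).div_const 4).congr_deriv ?_
  ring

lemma differentiable_trigFactor : Differentiable ℂ trigFactor :=
  fun z => (hasDerivAt_trigFactor z).differentiableAt

lemma norm_cos_le (z : ℂ) : ‖cos z‖ ≤ Real.exp |z.im| := by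
  have h1 : ‖exp (z * I)‖ ≤ Real.exp |z.im| := by
    rw [norm_exp]
    refine Real.exp_le_exp.2 ?_
    simpa using neg_le_abs z.im
  have h2 : ‖exp (-z * I)‖ ≤ Real.exp |z.im| := by
    rw [norm_exp]
    refine Real.exp_le_exp.2 ?_
    simpa using le_abs_self z.im
  rw [cos, norm_div, Complex.norm_ofNat]
  have := norm_add_le (exp (z * I)) (exp (-z * I))
  linarith

lemma norm_sin_le (z : ℂ) : ‖sin z‖ ≤ Real.exp |z.im| := by
  have h := norm_cos_le (z - π / 2)
  rw [cos_sub_pi_div_two] at h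
  simpa using h

lemma norm_sq_sin (z : ℂ) : ‖sin z‖ ^ 2 = Real.sin z.re ^ 2 + Real.sinh z.im ^ 2 := by
  have h1 : sin z = (Real.sin z.re * Real.cosh z.im : ℝ) + (Real.cos z.re * Real.sinh z.im : ℝ) * I := by
    conv_lhs => rw [← re_add_im z, sin_add_mul_I]
    push_cast
    ring
  rw [h1, ← normSq_eq_norm_sq, normSq_add_mul_I]
  have h2 := Real.cosh_sq z.im
  have h3 := Real.sin_sq_add_cos_sq z.re
  have h4 : Real.cos z.re ^ 2 = 1 - Real.sin z.re ^ 2 := by linarith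
  rw [mul_pow, mul_pow, h2, h4]
  ring

/-- Everything rests on `|sin z|² = sin² (Re z) + sinh² (Im z)`. If `|Im z| ≤ 1`, Jordan's
inequality at the nearest multiple of `π` together with `y ≤ sinh y` gives `|sin z| ≥ 1/20`, while
the exponential is at most `3`. If `|Im z| ≥ 1`, the hyperbolic sine alone suffices. -/
lemma le_norm_sin_of_far {z : ℂ} (hz : ∀ n : ℤ, 1 / 10 ≤ ‖z - (n * π : ℝ)‖) :
    1 / 60 * Real.exp |z.im| ≤ ‖sin z‖ := by
  have hsinh : ∀ y : ℝ, Real.sinh y ^ 2 = Real.sinh |y| ^ 2 := fun y => by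
    rw [← Real.abs_sinh, sq_abs]
  have hpi := Real.pi_pos
  have hsq := norm_sq_sin z
  rcases le_total |z.im| 1 with hy | hy
  · set n := round (z.re / π)
    have h1 := hz n
    set x := z.re - n * π with hx
    have hxle : |x| ≤ π / 2 := by
      have := abs_sub_round (z.re / π)
      have h2 : x = (z.re / π - n) * π := by rw [hx]; field_simp
      rw [h2, abs_mul, abs_of_pos hpi]
      nlinarith
    have hsin : Real.sin z.re ^ 2 = Real.sin |x| ^ 2 := by
      have h2 : z.re = x + n * π := by rw [hx]; ring
      have h3 : Real.sin |x| ^ 2 = Real.sin x ^ 2 := by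
        rcases abs_choice x with h | h <;> rw [h]
        rw [Real.sin_neg, neg_sq]
      rw [h3, h2, Real.sin_add_int_mul_pi, mul_pow]
      have : ((-1 : ℝ) ^ n) ^ 2 = 1 := by
        rw [← sq_abs, abs_zpow, abs_neg, abs_one, one_zpow, one_pow]
      rw [this, one_mul]
    have h3 := Real.mul_le_sin (abs_nonneg x) hxle
    have h4 : |z.im| ≤ Real.sinh |z.im| := Real.self_le_sinh_iff.2 (abs_nonneg _)
    have h5 : ‖z - (n * π : ℝ)‖ ^ 2 = x ^ 2 + z.im ^ 2 := by
      rw [← normSq_eq_norm_sq, normSq_apply]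
      simp [hx]
      ring
    have hp4 : 2 / π ≥ 1 / 2 := by
      rw [ge_iff_le, div_le_div_iff₀ (by norm_num) hpi]
      linarith [Real.pi_le_four]
    have h6 : (1 / 2 * |x|) ^ 2 ≤ Real.sin |x| ^ 2 := by
      refine pow_le_pow_left₀ (by positivity) (le_trans ?_ h3) 2
      exact mul_le_mul_of_nonneg_right hp4 (abs_nonneg x)
    have h7 : |z.im| ^ 2 ≤ Real.sinh |z.im| ^ 2 := pow_le_pow_left₀ (abs_nonneg _) h4 2
    rw [sq_abs] at h7
    rw [mul_pow, sq_abs] at h6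
    have h8 : (1 / 10 : ℝ) ^ 2 ≤ x ^ 2 + z.im ^ 2 := by
      rw [← h5]
      exact pow_le_pow_left₀ (by norm_num) h1 2
    have h9 : (1 / 20 : ℝ) ≤ ‖sin z‖ := by
      refine le_of_sq_le_sq ?_ (norm_nonneg _)
      rw [hsq, hsin, hsinh z.im]
      nlinarith [sq_nonneg z.im]
    have h10 : Real.exp |z.im| ≤ 3 :=
      (Real.exp_le_exp.2 hy).trans (Real.exp_one_lt_d9.le.trans (by norm_num))
    linarith
  · have h1 : Real.sinh |z.im| ≤ ‖sin z‖ := by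
      refine le_of_sq_le_sq ?_ (norm_nonneg _)
      rw [hsq, hsinh z.im]
      nlinarith [sq_nonneg (Real.sin z.re)]
    have h2 : Real.exp (-|z.im|) ≤ 1 := Real.exp_le_one_iff.2 (by simp)
    have h3 : (2 : ℝ) ≤ Real.exp |z.im| := by
      have := Real.add_one_le_exp |z.im|
      linarith
    rw [Real.sinh_eq] at h1
    linarith

/-- Half of `arccos (-1/3)`, the smallest positive zero of `trigFactor`. -/
def baseAngle : ℝ := Real.arccos (-1 / 3) / 2

lemma cos_two_mul_baseAngle : Real.cos (2 * baseAngle) = -1 / 3 := by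
  rw [baseAngle, mul_div_cancel₀ _ two_ne_zero, Real.cos_arccos] <;> norm_num

lemma pi_div_four_lt_baseAngle : π / 4 < baseAngle := by
  have : Real.arccos 0 < Real.arccos (-1 / 3) :=
    Real.strictAntiOn_arccos (by norm_num) (by norm_num) (by norm_num)
  rw [Real.arccos_zero] at this
  rw [baseAngle]
  linarith

lemma baseAngle_lt_pi_div_three : baseAngle < π / 3 := by
  by_contra h
  have h1 : 2 * baseAngle ≤ π := by
    rw [baseAngle]
    linarith [Real.arccos_le_pi (-1 / 3)]
  have h2 : Real.cos (2 * baseAngle) ≤ Real.cos (π - π / 3) :=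
    Real.cos_le_cos_of_nonneg_of_le_pi (by linarith [Real.pi_pos]) h1 (by linarith)
  rw [cos_two_mul_baseAngle, Real.cos_pi_sub, Real.cos_pi_div_three] at h2
  norm_num at h2

/-- As `sin² baseAngle = 2/3`, the last two sines multiply to `sin² z - 2/3`. The factorization
exhibits all zeros and lets the lower bound for one sine be used three times. -/
lemma trigFactor_eq_mul (z : ℂ) :
    trigFactor z = -3 * (sin z * sin (z + baseAngle) * sin (z - baseAngle)) := by
  have h1 : cos (baseAngle : ℂ) ^ 2 = 1 / 3 := by
    have h := cos_two_mul_baseAngle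
    rw [Real.cos_two_mul] at h
    have : Real.cos baseAngle ^ 2 = 1 / 3 := by linarith
    rw [← ofReal_cos, ← ofReal_pow, this]
    norm_num
  have h2 : sin (baseAngle : ℂ) ^ 2 = 2 / 3 := by
    rw [sin_sq, h1]
    norm_num
  have h3 : sin (z + baseAngle) * sin (z - baseAngle) = sin z ^ 2 - 2 / 3 := by
    rw [sin_add, sin_sub]
    linear_combination (sin z ^ 2) * h1 - (cos z ^ 2) * h2 - 2 / 3 * (sin_sq_add_cos_sq z)
  rw [mul_assoc (sin z), h3, trigFactor, sin_three_mul]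
  ring

/-- The zeros of `trigFactor`. -/
def base : Set ℝ := {b | ∃ n : ℤ, b = n * π ∨ b = n * π + baseAngle ∨ b = n * π - baseAngle}

lemma trigFactor_base {b : ℝ} (hb : b ∈ base) : trigFactor b = 0 := by
  rw [trigFactor_eq_mul]
  have hs : ∀ n : ℤ, sin ((n * π : ℝ) : ℂ) = 0 := fun n => by
    rw [← ofReal_sin, Real.sin_int_mul_pi, ofReal_zero]
  obtain ⟨n, rfl | rfl | rfl⟩ := hb
  · rw [hs]; ring
  · have : ((n * π + baseAngle : ℝ) : ℂ) - baseAngle = (n * π : ℝ) := by push_cast; ring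
    rw [this, hs]; ring
  · have : ((n * π - baseAngle : ℝ) : ℂ) + baseAngle = (n * π : ℝ) := by push_cast; ring
    rw [this, hs]; ring

/-- The points at distance at least `1/10` from all zeros of `trigFactor`. -/
def IsFar (z : ℂ) : Prop := ∀ b ∈ base, 1 / 10 ≤ ‖z - (b : ℂ)‖

lemma le_norm_trigFactor {z : ℂ} (hz : IsFar z) :
    3 * (1 / 60) ^ 3 * Real.exp (3 * |z.im|) ≤ ‖trigFactor z‖ := by
  have h0 := le_norm_sin_of_far (z := z) fun n => hz _ ⟨n, Or.inl rfl⟩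
  have h1 := le_norm_sin_of_far (z := z + baseAngle) fun n => by
    refine (hz _ ⟨n, Or.inr (Or.inr rfl)⟩).trans (le_of_eq (congrArg _ ?_))
    push_cast; ring
  have h2 := le_norm_sin_of_far (z := z - baseAngle) fun n => by
    refine (hz _ ⟨n, Or.inr (Or.inl rfl)⟩).trans (le_of_eq (congrArg _ ?_))
    push_cast; ring
  simp only [add_im, sub_im, ofReal_im, add_zero, sub_zero] at h1 h2
  rw [trigFactor_eq_mul, norm_mul, norm_mul, norm_mul, norm_neg, Complex.norm_ofNat]
  have h3 : Real.exp (3 * |z.im|) = Real.exp |z.im| * Real.exp |z.im| * Real.exp |z.im| := by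
    rw [← Real.exp_add, ← Real.exp_add]; ring_nf
  rw [h3]
  calc _ = 3 * ((1 / 60 * Real.exp |z.im|) * (1 / 60 * Real.exp |z.im|) *
        (1 / 60 * Real.exp |z.im|)) := by ring
    _ ≤ _ := by gcongr

lemma neg_mem_base {b : ℝ} (hb : b ∈ base) : -b ∈ base := by
  obtain ⟨n, rfl | rfl | rfl⟩ := hb
  · exact ⟨-n, Or.inl (by push_cast; ring)⟩
  · exact ⟨-n, Or.inr (Or.inr (by push_cast; ring))⟩
  · exact ⟨-n, Or.inr (Or.inl (by push_cast; ring))⟩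

/-- Consecutive points of `base` are `baseAngle` or `π - 2 * baseAngle` apart. Since `π/4 <
baseAngle < π/3`, both gaps exceed `3/4`, so discs of radius `1/10` about points of `base` are
disjoint. -/
lemma eq_of_mem_base {b c : ℝ} (hb : b ∈ base) (hc : c ∈ base) (h : |b - c| < 3 / 4) : b = c := by
  have h1 := pi_div_four_lt_baseAngle
  have h2 := baseAngle_lt_pi_div_three
  have hpi := Real.pi_gt_three
  obtain ⟨n, hn⟩ := hb
  obtain ⟨m, hm⟩ := hc
  obtain ⟨hl, hu⟩ := abs_lt.1 h
  have hk : n = m ∨ (n : ℝ) * π + π ≤ m * π ∨ (m : ℝ) * π + π ≤ n * π := by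
    rcases lt_trichotomy n m with hk | hk | hk
    · right; left
      have : (n : ℝ) + 1 ≤ m := by exact_mod_cast hk
      nlinarith
    · exact Or.inl hk
    · right; right
      have : (m : ℝ) + 1 ≤ n := by exact_mod_cast hk
      nlinarith
  rcases hn with rfl | rfl | rfl <;> rcases hm with rfl | rfl | rfl <;>
    rcases hk with rfl | hk | hk <;> first | rfl | (exfalso; linarith)

/-- The radius `N π + π / 2` is the midpoint of the gap between `N π + baseAngle` and `(N + 1) π -
baseAngle`, whose half-length `π / 2 - baseAngle` exceeds `π / 6`. -/
lemma abs_sub_radius_ge (N : ℤ) {b : ℝ} (hb : b ∈ base) : 1 / 2 ≤ |N * π + π / 2 - b| := by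
  have h1 := pi_div_four_lt_baseAngle
  have h2 := baseAngle_lt_pi_div_three
  have hpi := Real.pi_gt_three
  obtain ⟨n, hn⟩ := hb
  by_contra! h
  obtain ⟨hl, hu⟩ := abs_lt.1 h
  have hk : n = N ∨ (n : ℝ) * π + π ≤ N * π ∨ (N : ℝ) * π + π ≤ n * π := by
    rcases lt_trichotomy n N with hk | hk | hk
    · right; left
      have : (n : ℝ) + 1 ≤ N := by exact_mod_cast hk
      nlinarith
    · exact Or.inl hk
    · right; right
      have : (N : ℝ) + 1 ≤ n := by exact_mod_cast hk
      nlinarith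
  rcases hn with rfl | rfl | rfl <;> rcases hk with rfl | hk | hk <;> linarith

lemma isFar_of_norm_eq (N : ℕ) {z : ℂ} (hz : ‖z‖ = N * π + π / 2) : IsFar z := by
  intro b hb
  have h1 := abs_norm_sub_norm_le z b
  rw [hz, norm_real, Real.norm_eq_abs] at h1
  have h2 : |b| ∈ base := by
    rcases abs_choice b with h | h <;> rw [h]
    exacts [hb, neg_mem_base hb]
  have h3 := abs_sub_radius_ge N h2
  push_cast at h3
  linarith

lemma isFar_of_mem_sphere {b : ℝ} (hb : b ∈ base) {z : ℂ} (hz : ‖z - b‖ = 1 / 10) : IsFar z := by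
  intro c hc
  by_contra! h
  have h1 : |b - c| < 3 / 4 := by
    have h2 : ((b - c : ℝ) : ℂ) = (z - c) - (z - b) := by push_cast; ring
    rw [← Real.norm_eq_abs, ← norm_real, h2]
    refine (norm_sub_le _ _).trans_lt ?_
    linarith
  rw [← eq_of_mem_base hb hc h1, hz] at h
  exact lt_irrefl _ h

lemma norm_trigFactor_le (z : ℂ) : ‖trigFactor z‖ ≤ Real.exp (3 * |z.im|) := by
  have h1 := norm_sin_le (3 * z)
  have h2 := norm_sin_le z
  have h3 : |(3 * z).im| = 3 * |z.im| := by simp [abs_mul]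
  have h4 : Real.exp |z.im| ≤ Real.exp (3 * |z.im|) :=
    Real.exp_le_exp.2 (by linarith [abs_nonneg z.im])
  rw [h3] at h1
  rw [trigFactor, norm_div, Complex.norm_ofNat]
  have := norm_sub_le (3 * sin (3 * z)) (sin z)
  rw [norm_mul, Complex.norm_ofNat] at this
  linarith

lemma norm_trigFactorDeriv_le (z : ℂ) : ‖trigFactorDeriv z‖ ≤ 3 * Real.exp (3 * |z.im|) := by
  have h1 := norm_cos_le (3 * z)
  have h2 := norm_cos_le z
  have h3 : |(3 * z).im| = 3 * |z.im| := by simp [abs_mul]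
  have h4 : Real.exp |z.im| ≤ Real.exp (3 * |z.im|) :=
    Real.exp_le_exp.2 (by linarith [abs_nonneg z.im])
  rw [h3] at h1
  rw [trigFactorDeriv, norm_div, Complex.norm_ofNat]
  have := norm_sub_le (9 * cos (3 * z)) (cos z)
  rw [norm_mul, Complex.norm_ofNat] at this
  linarith [Real.exp_pos (3 * |z.im|)]

/-- The derivative equals `cos b (9 cos² b - 7)`, and at a zero `cos² b` is `1` or `1/3`. Its
modulus is then `2` or `4 / √3`: all zeros are simple, uniformly. -/
lemma two_le_norm_trigFactorDeriv {b : ℝ} (hb : b ∈ base) : 2 ≤ ‖trigFactorDeriv b‖ := by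
  have h0 : Real.sin b * (2 - 3 * Real.sin b ^ 2) = 0 := by
    have h := trigFactor_base hb
    rw [trigFactor, sin_three_mul, ← ofReal_sin] at h
    have : ((Real.sin b * (2 - 3 * Real.sin b ^ 2) : ℝ) : ℂ) = 0 := by
      rw [← h]; push_cast; ring
    exact_mod_cast this
  have h1 : trigFactorDeriv b = (Real.cos b * (9 * Real.cos b ^ 2 - 7) : ℝ) := by
    rw [trigFactorDeriv, cos_three_mul]
    push_cast
    ring
  have h2 := Real.sin_sq_add_cos_sq b
  rw [h1, norm_real, Real.norm_eq_abs]
  refine le_of_sq_le_sq ?_ (abs_nonneg _)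
  rw [sq_abs]
  rcases mul_eq_zero.1 h0 with h | h
  · have : Real.cos b ^ 2 = 1 := by rw [h] at h2; linarith
    rw [mul_pow, this]; norm_num
  · have : Real.cos b ^ 2 = 1 / 3 := by linarith
    rw [mul_pow, this]; norm_num

lemma exp_three_tenths_le : Real.exp (3 / 10) ≤ 10 / 7 := by
  have h1 := Real.add_one_le_exp (-(3 / 10) : ℝ)
  have h2 : Real.exp (3 / 10) * Real.exp (-(3 / 10)) = 1 := by rw [← Real.exp_add]; simp
  nlinarith [Real.exp_pos (3 / 10 : ℝ)]

lemma exp_le_of_mem_closedBall {b : ℝ} {z : ℂ} (hz : z ∈ closedBall (b : ℂ) (1 / 10)) :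
    Real.exp (3 * |z.im|) ≤ 10 / 7 := by
  refine (Real.exp_le_exp.2 ?_).trans exp_three_tenths_le
  have h1 := abs_im_le_norm (z - b)
  rw [mem_closedBall, dist_eq_norm] at hz
  simp only [sub_im, ofReal_im, sub_zero] at h1
  linarith

/-- The second derivative is at most `(27 + 1) / 4 * 10 / 7 = 10` on the disc, whose radius is
`1/10`. -/
lemma norm_trigFactorDeriv_sub_le {b : ℝ} {z : ℂ} (hz : z ∈ closedBall (b : ℂ) (1 / 10)) :
    ‖trigFactorDeriv z - trigFactorDeriv b‖ ≤ 1 := by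
  have h1 : ∀ w ∈ closedBall (b : ℂ) (1 / 10), ‖(-27 * sin (3 * w) + sin w) / 4‖ ≤ 10 := by
    intro w hw
    have h1 := norm_sin_le (3 * w)
    have h2 := norm_sin_le w
    have h3 : |(3 * w).im| = 3 * |w.im| := by simp [abs_mul]
    have h4 : Real.exp |w.im| ≤ Real.exp (3 * |w.im|) :=
      Real.exp_le_exp.2 (by linarith [abs_nonneg w.im])
    have h5 := exp_le_of_mem_closedBall hw
    rw [h3] at h1
    rw [norm_div, Complex.norm_ofNat]
    have := norm_add_le (-27 * sin (3 * w)) (sin w)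
    rw [norm_mul, norm_neg, Complex.norm_ofNat] at this
    linarith
  have h2 := (convex_closedBall (b : ℂ) (1 / 10)).norm_image_sub_le_of_norm_hasDerivWithin_le
    (fun w hw => (hasDerivAt_trigFactorDeriv w).hasDerivWithinAt) h1
    (mem_closedBall_self (by norm_num)) hz
  rw [mem_closedBall, dist_eq_norm] at hz
  linarith

/-! ### Perturbations of `z ↦ z * trigFactor z` -/

/-- `P` is entire and dominated by `exp (2 |Im z|)`. -/
structure IsPerturbation (P : ℂ → ℂ) (M : ℝ) : Prop where
  differentiable : Differentiable ℂ P
  norm_le : ∀ z, ‖P z‖ ≤ M * Real.exp (2 * |z.im|)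

lemma IsPerturbation.nonneg {P : ℂ → ℂ} {M : ℝ} (hP : IsPerturbation P M) : 0 ≤ M := by
  have := (norm_nonneg _).trans (hP.norm_le 0)
  simpa using this

lemma IsPerturbation.norm_deriv_le {P : ℂ → ℂ} {M : ℝ} (hP : IsPerturbation P M) {z : ℂ}
    (hz : |z.im| ≤ 1) : ‖deriv P z‖ ≤ M * Real.exp 4 := by
  have h := Complex.norm_deriv_le_of_forall_mem_sphere_norm_le (c := z) (R := 1)
    (C := M * Real.exp 4) one_pos (hP.differentiable.diffContOnCl) fun w hw => ?_
  · simpa using h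
  · refine (hP.norm_le w).trans (mul_le_mul_of_nonneg_left (Real.exp_le_exp.2 ?_) hP.nonneg)
    have h1 := abs_im_le_norm (w - z)
    rw [mem_sphere, dist_eq_norm] at hw
    rw [hw, sub_im] at h1
    have := abs_sub_abs_le_abs_sub w.im z.im
    linarith

/-- Away from `base`, `trigFactor` is bounded below by a multiple of `exp (3 |Im z|)`, so the factor
`|z|` eventually beats any constant `K`. -/
lemma lt_norm_mul_trigFactor (K : ℝ) : ∃ R₀ : ℝ, ∀ z : ℂ, IsFar z → R₀ ≤ ‖z‖ →
    K * Real.exp (2 * |z.im|) < ‖z * trigFactor z‖ := by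
  refine ⟨(|K| + 1) / (3 * (1 / 60) ^ 3), fun z hz hR => ?_⟩
  rw [div_le_iff₀ (by norm_num)] at hR
  have h1 := le_norm_trigFactor hz
  have h2 : Real.exp (2 * |z.im|) ≤ Real.exp (3 * |z.im|) :=
    Real.exp_le_exp.2 (by linarith [abs_nonneg z.im])
  rw [norm_mul]
  calc K * Real.exp (2 * |z.im|) < (|K| + 1) * Real.exp (2 * |z.im|) := by
        refine mul_lt_mul_of_pos_right ?_ (Real.exp_pos _)
        linarith [le_abs_self K]
    _ ≤ (|K| + 1) * Real.exp (3 * |z.im|) := by gcongr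
    _ ≤ (‖z‖ * (3 * (1 / 60) ^ 3)) * Real.exp (3 * |z.im|) := by gcongr
    _ = ‖z‖ * (3 * (1 / 60) ^ 3 * Real.exp (3 * |z.im|)) := by ring
    _ ≤ _ := by gcongr

/-- Compare with the linear map of slope `d = b * trigFactorDeriv b`, where `|d| ≥ 2 b`. The
derivative of the difference is at most `b`, from the variation of `trigFactorDeriv`, plus the
constant `2 + M * exp 4`. For large `b` the constant is below `b / 2`, which leaves the slope `b /
2`. -/
lemma IsPerturbation.exists_le_norm_sub {P : ℂ → ℂ} {M : ℝ} (hP : IsPerturbation P M) :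
    ∃ R₀ : ℝ, ∀ b ∈ base, R₀ ≤ b → ∀ z ∈ closedBall (b : ℂ) (1 / 10),
      ∀ w ∈ closedBall (b : ℂ) (1 / 10),
      deriv (fun v => v * trigFactor v + P v) z ≠ 0 ∧
      b / 2 * ‖z - w‖ ≤ ‖(z * trigFactor z + P z) - (w * trigFactor w + P w)‖ := by
  refine ⟨2 * (2 + M * Real.exp 4), fun b hb hR z hz w hw => ?_⟩
  have hMe : 0 ≤ M * Real.exp 4 := mul_nonneg hP.nonneg (Real.exp_pos _).le
  have hb0 : 0 ≤ b := by linarith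
  set d := (b : ℂ) * trigFactorDeriv b
  have hder : ∀ v : ℂ, HasDerivAt (fun v => (v * trigFactor v + P v) - d * v)
      ((1 * trigFactor v + v * trigFactorDeriv v + deriv P v) - d) v := fun v => by
    have := (((hasDerivAt_id v).mul (hasDerivAt_trigFactor v)).add
      (hP.differentiable v).hasDerivAt).sub ((hasDerivAt_id v).const_mul d)
    exact this.congr_deriv (by simp)
  have hbd : ∀ v ∈ closedBall (b : ℂ) (1 / 10),
      ‖(1 * trigFactor v + v * trigFactorDeriv v + deriv P v) - d‖ ≤ 2 + M * Real.exp 4 + b := by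
    intro v hv
    have e1 := exp_le_of_mem_closedBall hv
    have e2 := norm_trigFactor_le v
    have e3 := norm_trigFactorDeriv_le v
    have e4 := norm_trigFactorDeriv_sub_le hv
    rw [mem_closedBall, dist_eq_norm] at hv
    have e5 : ‖deriv P v‖ ≤ M * Real.exp 4 := hP.norm_deriv_le (by
      have h1 := abs_im_le_norm (v - b)
      simp only [sub_im, ofReal_im, sub_zero] at h1
      linarith)
    have e6 : (1 * trigFactor v + v * trigFactorDeriv v + deriv P v) - d =
        trigFactor v + (v - b) * trigFactorDeriv v + deriv P v +
          b * (trigFactorDeriv v - trigFactorDeriv b) := by ring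
    rw [e6]
    have e7 : ‖(v - b) * trigFactorDeriv v‖ ≤ 1 / 10 * (30 / 7) := by
      rw [norm_mul]
      exact mul_le_mul hv (by linarith) (norm_nonneg _) (by norm_num)
    have e8 : ‖(b : ℂ) * (trigFactorDeriv v - trigFactorDeriv b)‖ ≤ b := by
      rw [norm_mul, norm_real, Real.norm_eq_abs, abs_of_nonneg hb0]
      nlinarith
    have e9 := norm_add₄_le (a := trigFactor v) (b := (v - b) * trigFactorDeriv v)
      (c := deriv P v) (d := b * (trigFactorDeriv v - trigFactorDeriv b))
    linarith
  have h1 := (convex_closedBall (b : ℂ) (1 / 10)).norm_image_sub_le_of_norm_hasDerivWithin_le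
    (fun v _ => (hder v).hasDerivWithinAt) hbd hw hz
  have h2 : 2 * b ≤ ‖d‖ := by
    rw [norm_mul, norm_real, Real.norm_eq_abs, abs_of_nonneg hb0]
    nlinarith [two_le_norm_trigFactorDeriv hb]
  constructor
  · intro h
    have h3 : deriv (fun v => v * trigFactor v + P v) z =
        1 * trigFactor z + z * trigFactorDeriv z + deriv P z :=
      (((hasDerivAt_id z).mul (hasDerivAt_trigFactor z)).add
        (hP.differentiable z).hasDerivAt).deriv
    have h4 := hbd z hz
    rw [← h3, h, zero_sub, norm_neg] at h4
    linarith
  have h3 : ‖d * (z - w)‖ ≤ ‖(z * trigFactor z + P z) - (w * trigFactor w + P w)‖ +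
      ‖(z * trigFactor z + P z - d * z) - (w * trigFactor w + P w - d * w)‖ := by
    refine le_trans (le_of_eq (congrArg _ ?_)) (norm_sub_le _ _)
    ring
  rw [norm_mul] at h3
  have h4 : 2 * b * ‖z - w‖ ≤ ‖d‖ * ‖z - w‖ := by gcongr
  nlinarith [norm_nonneg (z - w)]

/-- `F` is entire and `F (z ^ 2) = z * trigFactor z + P z`. -/
structure IsLift (F P : ℂ → ℂ) (M : ℝ) : Prop extends IsPerturbation P M where
  differentiable_lift : Differentiable ℂ F
  apply_sq : ∀ z, F (z ^ 2) = z * trigFactor z + P z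

/-- The zeros of `z ↦ F (z ^ 2)` with `0 ≤ Re z` and `R ≤ |z|` are simple and correspond to the
points of `base` to the right of `R`. -/
structure IsLocalized (F : ℂ → ℂ) (R : ℝ) : Prop where
  one_le : 1 ≤ R
  exists_base : ∀ z : ℂ, 0 ≤ z.re → R ≤ ‖z‖ → F (z ^ 2) = 0 →
    ∃ b ∈ base, R + 1 / 2 ≤ b ∧ z ∈ ball (b : ℂ) (1 / 10)
  exists_zero : ∀ b ∈ base, R ≤ b → ∃ z ∈ ball (b : ℂ) (1 / 10), F (z ^ 2) = 0
  order_eq_one : ∀ b ∈ base, R ≤ b → ∀ z ∈ ball (b : ℂ) (1 / 10), F (z ^ 2) = 0 →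
    analyticOrderAt F (z ^ 2) = 1
  le_norm_sub : ∀ b ∈ base, R ≤ b → ∀ z ∈ closedBall (b : ℂ) (1 / 10),
    ∀ w ∈ closedBall (b : ℂ) (1 / 10), b / 2 * ‖z - w‖ ≤ ‖F (z ^ 2) - F (w ^ 2)‖

lemma exists_zero_of_norm_sub_lt {f g : ℂ → ℂ} (hf : Differentiable ℂ f) (hg : Differentiable ℂ g)
    {c : ℂ} {R : ℝ} (hR : 0 < R) (hfg : ∀ z ∈ sphere c R, ‖f z - g z‖ < ‖f z‖)
    (hc : ∃ z ∈ ball c R, f z = 0) : ∃ z ∈ ball c R, g z = 0 := by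
  obtain ⟨a, ha, hfa⟩ := hc
  have hp : c + R ∈ sphere c R := by simp [abs_of_pos hR]
  have hfp : f (c + R) ≠ 0 := fun h => by
    have := hfg _ hp
    rw [h, norm_zero] at this
    exact (norm_nonneg _).not_gt this
  by_contra! h
  have hfin : {z | z ∈ ball c R ∧ f z = 0}.Finite := (finite_zeros_closedBall hf hfp c R).subset
    (fun z hz => ⟨ball_subset_closedBall hz.1, hz.2⟩)
  have := sum_analyticOrderNatAt_eq_of_norm_sub_lt hf hg hR hfg hfin.toFinset ∅
    (by simp)
    (by simpa using h)
  rw [Finset.sum_empty, Finset.sum_eq_zero_iff] at this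
  exact (analyticOrderNatAt_ne_zero_iff hf hfp a).2 hfa (this a (by simpa using ⟨ha, hfa⟩))

lemma re_sqrt_nonneg (z : ℂ) : 0 ≤ (z ^ (1 / 2 : ℂ)).re := by
  by_cases hz : z = 0
  · simp [hz]
  · rw [cpow_def_of_ne_zero hz, exp_re]
    refine mul_nonneg (Real.exp_pos _).le (Real.cos_nonneg_of_mem_Icc ?_)
    have h1 : (log z * (1 / 2)).im = arg z / 2 := by
      have : log z * (1 / 2) = ((1 / 2 : ℝ) : ℂ) * log z := by push_cast; ring
      rw [this, im_ofReal_mul, log_im]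
      ring
    rw [h1]
    have h2 := neg_pi_lt_arg z
    have h3 := arg_le_pi z
    constructor <;> linarith

lemma eq_of_sq_eq {z w : ℂ} (h : z ^ 2 = w ^ 2) (hz : 0 ≤ z.re) (hw : 0 < w.re) : z = w := by
  rcases sq_eq_sq_iff_eq_or_eq_neg.1 h with h | h
  · exact h
  · rw [h, neg_re] at hz
    linarith

lemma re_gt_of_mem_ball {b : ℝ} {z : ℂ} (hz : z ∈ ball (b : ℂ) (1 / 10)) :
    b - 1 / 10 < z.re ∧ z.re < b + 1 / 10 := by
  have h1 := abs_re_le_norm (z - b)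
  rw [mem_ball, dist_eq_norm] at hz
  simp only [sub_re, ofReal_re] at h1
  constructor <;> linarith [abs_lt.1 (h1.trans_lt hz)]

/-- Far from `base` the leading term dominates, so large zeros lie near `base`. Near a large
positive `b` in `base`, Rouché's theorem against the leading term gives a zero, and the expansion
estimate makes it unique and simple. -/
lemma IsLift.exists_isLocalized {F P : ℂ → ℂ} {M : ℝ} (h : IsLift F P M) :
    ∃ R₀ : ℝ, ∀ N : ℕ, R₀ ≤ N * π + π / 2 → IsLocalized F (N * π + π / 2) := by
  obtain ⟨R₁, h₁⟩ := lt_norm_mul_trigFactor M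
  obtain ⟨R₂, h₂⟩ := h.toIsPerturbation.exists_le_norm_sub
  refine ⟨max (max R₁ R₂) 0 + 1, fun N hN => ?_⟩
  set R := N * π + π / 2 with hRdef
  have hR1 : R₁ + 1 ≤ R := by
    linarith [le_max_left (max R₁ R₂) 0, le_max_left R₁ R₂]
  have hR2 : R₂ + 1 ≤ R := by
    linarith [le_max_left (max R₁ R₂) 0, le_max_right R₁ R₂]
  have hR : 1 ≤ R := by linarith [le_max_right (max R₁ R₂) 0]
  have hd : Differentiable ℂ (fun v : ℂ => v * trigFactor v) :=
    differentiable_id.mul differentiable_trigFactor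
  have hlift : (fun z => F (z ^ 2)) = fun v => v * trigFactor v + P v := funext h.apply_sq
  refine ⟨hR, fun z hz hzR hF => ?_, fun b hb hRb => ?_, fun b hb hRb z hz hF => ?_,
    fun b hb hRb z hz w hw => ?_⟩
  · have hfar : ¬ IsFar z := fun hfar => by
      have h3 := h₁ z hfar (by linarith)
      rw [h.apply_sq, add_eq_zero_iff_eq_neg] at hF
      rw [hF, norm_neg] at h3
      exact absurd (h.norm_le z) (not_le.2 h3)
    simp only [IsFar, not_forall, not_le] at hfar
    obtain ⟨b, hb, hzb⟩ := hfar
    have hzb' : z ∈ ball (b : ℂ) (1 / 10) := by rwa [mem_ball, dist_eq_norm]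
    refine ⟨b, hb, ?_, hzb'⟩
    have h3 := norm_sub_norm_le z b
    rw [norm_real, Real.norm_eq_abs] at h3
    have h4 := re_gt_of_mem_ball hzb'
    have h5 : 0 ≤ b := by
      by_contra! hb0
      rw [abs_of_neg hb0] at h3
      linarith
    rw [abs_of_nonneg h5] at h3
    -- So far `b > R - 1/10`. As no point of `base` is closer than `1/2` to `R`, in fact `b ≥ R +
    -- 1/2`; this margin keeps the real parts of zeros beyond `R` above `R`.
    have h6 := abs_sub_radius_ge N hb
    push_cast at h6
    rw [← hRdef] at h6
    rcases abs_choice (R - b) with h7 | h7 <;> rw [h7] at h6 <;> linarith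
  · have hd' : Differentiable ℂ (fun v => v * trigFactor v + P v) := hd.add h.differentiable
    have := exists_zero_of_norm_sub_lt hd hd'
      (c := b) (R := 1 / 10) (by norm_num) (fun z hz => ?_) ⟨b, mem_ball_self (by norm_num), ?_⟩
    · obtain ⟨z, hz, hz0⟩ := this
      exact ⟨z, hz, by rw [h.apply_sq]; exact hz0⟩
    · rw [mem_sphere, dist_eq_norm] at hz
      have h3 := norm_sub_norm_le (b : ℂ) z
      rw [norm_real, Real.norm_eq_abs, norm_sub_rev, hz, abs_of_nonneg (by linarith)] at h3
      have h4 := h₁ z (isFar_of_mem_sphere hb hz) (by linarith)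
      refine lt_of_le_of_lt ?_ h4
      simpa using h.norm_le z
    · simp [trigFactor_base hb]
  · have h3 := (h₂ b hb (by linarith) z (ball_subset_closedBall hz) z (ball_subset_closedBall hz)).1
    have hz0 : z ≠ 0 := by
      rintro rfl
      have := (re_gt_of_mem_ball hz).1
      simp at this
      linarith
    -- Squaring is locally biholomorphic away from the origin, so orders may be computed in the
    -- variable `z`.
    have h4 : analyticOrderAt (F ∘ fun z => z ^ 2) z = analyticOrderAt F (z ^ 2) :=
      analyticOrderAt_comp_of_deriv_ne_zero (g := fun z : ℂ => z ^ 2)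
        (by fun_prop) (by simpa using hz0)
    rw [← h4]
    refine AnalyticAt.analyticOrderAt_eq_one_of_zero_deriv_ne_zero ?_ hF ?_
    · exact (h.differentiable_lift.comp (differentiable_pow 2)).analyticAt z
    · change deriv (fun z => F (z ^ 2)) z ≠ 0
      rwa [hlift]
  · rw [h.apply_sq, h.apply_sq]
    exact (h₂ b hb (by linarith) z hz w hw).2

lemma IsLocalized.eq_of_mem_ball {F : ℂ → ℂ} {R : ℝ} (h : IsLocalized F R) {b : ℝ} (hb : b ∈ base)
    (hRb : R ≤ b) {z w : ℂ} (hz : z ∈ ball (b : ℂ) (1 / 10)) (hw : w ∈ ball (b : ℂ) (1 / 10))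
    (hFz : F (z ^ 2) = 0) (hFw : F (w ^ 2) = 0) : z = w := by
  have h1 := h.le_norm_sub b hb hRb z (ball_subset_closedBall hz) w (ball_subset_closedBall hw)
  rw [hFz, hFw, sub_zero, norm_zero] at h1
  have h2 := h.one_le
  have h3 : ‖z - w‖ = 0 := by nlinarith [norm_nonneg (z - w)]
  exact sub_eq_zero.1 (norm_eq_zero.1 h3)

lemma eq_of_mem_ball_base {b c : ℝ} (hb : b ∈ base) (hc : c ∈ base) {z : ℂ}
    (hz : z ∈ ball (b : ℂ) (1 / 10)) (hw : z ∈ ball (c : ℂ) (1 / 10)) : b = c := by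
  have h1 := re_gt_of_mem_ball hz
  have h2 := re_gt_of_mem_ball hw
  exact eq_of_mem_base hb hc (abs_lt.2 ⟨by linarith, by linarith⟩)

/-- Outside a large disc the lift of a small perturbation dominates any other perturbation. -/
lemma IsLift.exists_norm_lt {F P Q : ℂ → ℂ} {M K : ℝ} (h : IsLift F P M) (hQ : IsPerturbation Q K) :
    ∃ R₀ : ℝ, ∀ N : ℕ, R₀ ≤ N * π + π / 2 → ∀ z : ℂ, ‖z‖ = N * π + π / 2 →
      ‖Q z‖ < ‖F (z ^ 2)‖ := by
  obtain ⟨R₁, h₁⟩ := lt_norm_mul_trigFactor (M + K)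
  refine ⟨R₁, fun N hN z hz => ?_⟩
  have h2 := h₁ z (isFar_of_norm_eq N hz) (by linarith)
  have h3 := h.norm_le z
  have h4 := hQ.norm_le z
  rw [h.apply_sq]
  have h5 := norm_sub_le (z * trigFactor z + P z) (P z)
  rw [add_sub_cancel_right] at h5
  linarith

lemma exists_nat_radius (R₀ : ℝ) : ∃ N : ℕ, R₀ ≤ N * π + π / 2 := by
  obtain ⟨N, hN⟩ := exists_nat_ge R₀
  exact ⟨N, by nlinarith [Real.pi_gt_three, (Nat.cast_nonneg N : (0 : ℝ) ≤ N)]⟩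

/-- This turns an equality of total multiplicities into an actual enumeration, by cutting the index
set into blocks of the prescribed sizes. -/
lemma exists_fiber_card (Z : Finset ℂ) (m : ℂ → ℕ) (J : Finset ℕ) (hJ : J.card = ∑ a ∈ Z, m a) :
    ∃ w : ℕ → ℂ, (∀ j ∈ J, w j ∈ Z) ∧ ∀ a ∈ Z, {j | j ∈ J ∧ w j = a}.encard = m a := by
  classical
  induction Z using Finset.induction_on generalizing J with
  | empty =>
    refine ⟨0, fun j hj => ?_, by simp⟩
    rw [Finset.sum_empty, Finset.card_eq_zero] at hJ
    simp [hJ] at hj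
  | insert b Z hb ih =>
    rw [Finset.sum_insert hb] at hJ
    obtain ⟨J', hJJ, hJ'⟩ := Finset.exists_subset_card_eq (s := J) (n := m b) (by omega)
    obtain ⟨w, hwZ, hw⟩ := ih (J \ J') (by rw [Finset.card_sdiff_of_subset hJJ]; omega)
    refine ⟨fun j => if j ∈ J' then b else w j, fun j hj => ?_, fun a ha => ?_⟩
    · by_cases h : j ∈ J'
      · simp [h]
      · simpa [h] using Or.inr (hwZ j (by simp [h, hj]))
    · rcases Finset.mem_insert.1 ha with rfl | ha
      · rw [← hJ', ← Set.encard_coe_eq_coe_finsetCard]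
        congr 1
        ext j
        constructor
        · rintro ⟨hj, hja⟩
          by_contra h
          have h' : j ∉ J' := h
          simp only [h', if_false] at hja
          exact hb (hja ▸ hwZ j (by simp [h', hj]))
        · intro hj
          have hj' : j ∈ J' := hj
          exact ⟨hJJ hj', by simp [hj']⟩
      · rw [← hw a ha]
        congr 1
        ext j
        have hne : b ≠ a := by rintro rfl; exact hb ha
        by_cases h : j ∈ J' <;> simp [h, hne]

/-! ### Sequences of zeros -/

/-- The squares of `z₀ n` are the zeros of `F`, with account of multiplicity, and
`0 ≤ Re (z₀ n) ≤ Re (z₀ (n + 1))`. -/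
def IsZeroSequence (F : ℂ → ℂ) (z₀ : ℕ → ℂ) : Prop :=
  (∀ lam : ℂ, {n : ℕ | z₀ n ^ 2 = lam}.encard = analyticOrderAt F lam) ∧
    (∀ n, 0 ≤ (z₀ n).re ∧ (z₀ n).re ≤ (z₀ (n + 1)).re)

lemma eq_range_card_of_lower {s : Finset ℕ} (h : ∀ n ∈ s, ∀ k ≤ n, k ∈ s) :
    s = Finset.range s.card := by
  refine Finset.eq_of_subset_of_card_le (fun n hn => ?_) (by simp)
  have h1 : Finset.range (n + 1) ⊆ s := fun k hk => h n hn k (by simpa [Nat.lt_succ_iff] using hk)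
  have := Finset.card_le_card h1
  rw [Finset.card_range] at this
  simpa using this

lemma sq_mem_ball_iff {z : ℂ} {R : ℝ} (hR : 0 ≤ R) : z ^ 2 ∈ ball (0 : ℂ) (R ^ 2) ↔ ‖z‖ < R := by
  rw [mem_ball_zero_iff, norm_pow, pow_lt_pow_iff_left₀ (norm_nonneg _) hR two_ne_zero]

section
variable {F : ℂ → ℂ} {R : ℝ} {z₀ : ℕ → ℂ}

lemma IsZeroSequence.apply_eq_zero (h : IsZeroSequence F z₀) (n : ℕ) : F (z₀ n ^ 2) = 0 := by
  refine apply_eq_zero_of_analyticOrderAt_ne_zero ?_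
  rw [← h.1]
  exact Set.encard_ne_zero.2 ⟨n, rfl⟩

/-- Ordering by real part need not order by modulus. It does separate the zeros inside the disc from
those outside, so the indices of the inner ones form an initial segment whose length is the total
multiplicity. -/
lemma IsZeroSequence.norm_lt_iff (h : IsZeroSequence F z₀) (hF : Differentiable ℂ F) {w : ℂ}
    (hw : F w ≠ 0) (hloc : IsLocalized F R) {Z : Finset ℂ}
    (hZ : ∀ z, z ∈ Z ↔ z ∈ ball 0 (R ^ 2) ∧ F z = 0) (n : ℕ) :
    ‖z₀ n‖ < R ↔ n < ∑ a ∈ Z, analyticOrderNatAt F a := by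
  classical
  have hR : 0 ≤ R := by linarith [hloc.one_le]
  have hfib : ∀ a, {n | z₀ n ^ 2 = a}.Finite := fun a => by
    rw [← Set.encard_ne_top_iff, h.1]
    exact analyticOrderAt_ne_top_of_entire hF hw a
  have hmem : ∀ n, ‖z₀ n‖ < R ↔ z₀ n ^ 2 ∈ Z := fun n => by
    rw [hZ, sq_mem_ball_iff hR]
    exact ⟨fun h' => ⟨h', h.apply_eq_zero n⟩, fun h' => h'.1⟩
  have hfin : {n | ‖z₀ n‖ < R}.Finite := by
    refine (Z.finite_toSet.biUnion fun a _ => hfib a).subset fun n hn => ?_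
    simp only [mem_iUnion]
    exact ⟨z₀ n ^ 2, (hmem n).1 hn, rfl⟩
  have hcard : hfin.toFinset.card = ∑ a ∈ Z, analyticOrderNatAt F a := by
    rw [Finset.card_eq_sum_card_fiberwise (f := fun n => z₀ n ^ 2) (t := Z)
      (fun n hn => (hmem n).1 (by simpa using hn))]
    refine Finset.sum_congr rfl fun a ha => ?_
    have h1 : (hfin.toFinset.filter fun n => z₀ n ^ 2 = a) = (hfib a).toFinset := by
      ext n
      simp only [Finset.mem_filter, Finite.mem_toFinset, mem_ofPred_eq, and_iff_right_iff_imp]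
      rintro rfl
      exact (hmem n).2 ha
    rw [h1, analyticOrderNatAt, ← h.1 a, (hfib a).encard_eq_coe_toFinset_card]
    simp
  -- A zero of modulus at least `R` lies within `1/10` of a point of `base` beyond `R + 1/2`, hence
  -- its real part exceeds `R`.
  have hre : ∀ n, ‖z₀ n‖ < R ↔ (z₀ n).re < R := fun n => by
    refine ⟨fun h' => (re_le_norm _).trans_lt h', fun h' => ?_⟩
    by_contra! h''
    obtain ⟨b, hb, hRb, hzb⟩ := hloc.exists_base _ (h.2 n).1 h'' (h.apply_eq_zero n)
    linarith [(re_gt_of_mem_ball hzb).1]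
  have hmono : Monotone fun n => (z₀ n).re := monotone_nat_of_le_succ fun n => (h.2 n).2
  have h2 := eq_range_card_of_lower (s := hfin.toFinset) fun n hn k hk => by
    simp only [Finite.mem_toFinset, mem_ofPred_eq] at hn ⊢
    rw [hre] at hn ⊢
    exact (hmono hk).trans_lt hn
  rw [hcard] at h2
  have h3 : n ∈ hfin.toFinset ↔ n ∈ Finset.range (∑ a ∈ Z, analyticOrderNatAt F a) := by rw [h2]
  simpa using h3

/-- Far zeros of a zero sequence are matched with points of `base`. -/
lemma IsZeroSequence.exists_base (h : IsZeroSequence F z₀) (hloc : IsLocalized F R) {n₀ : ℕ}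
    (hn₀ : ∀ n, ‖z₀ n‖ < R ↔ n < n₀) :
    ∃ b : ℕ → ℝ, (∀ n, n₀ ≤ n → b n ∈ base ∧ R + 1 / 2 ≤ b n ∧ z₀ n ∈ ball (b n : ℂ) (1 / 10)) ∧
      (∀ n m, n₀ ≤ n → n₀ ≤ m → b n = b m → n = m) ∧
      (∀ c ∈ base, R + 1 / 2 ≤ c → ∃ n, n₀ ≤ n ∧ b n = c) ∧
      ∀ n, n₀ ≤ n → (n : ℝ) ≤ (n₀ + 2) * b n := by
  have hR := hloc.one_le
  have h1 : ∀ n, ∃ b, n₀ ≤ n → b ∈ base ∧ R + 1 / 2 ≤ b ∧ z₀ n ∈ ball (b : ℂ) (1 / 10) := by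
    intro n
    by_cases hn : n₀ ≤ n
    · obtain ⟨b, hb, hRb, hzb⟩ := hloc.exists_base _ (h.2 n).1
        (not_lt.1 fun h' => (not_lt.2 hn) ((hn₀ n).1 h')) (h.apply_eq_zero n)
      exact ⟨b, fun _ => ⟨hb, hRb, hzb⟩⟩
    · exact ⟨0, fun h => absurd h hn⟩
  choose b hb using h1
  have hinj : ∀ n m, n₀ ≤ n → n₀ ≤ m → b n = b m → n = m := by
    intro n m hn hm hnm
    obtain ⟨hb1, hb2, hb3⟩ := hb n hn
    have hb4 := (hb m hm).2.2
    rw [← hnm] at hb4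
    have h2 := hloc.eq_of_mem_ball hb1 (by linarith) hb3 hb4 (h.apply_eq_zero n)
      (h.apply_eq_zero m)
    -- Two indices with the same base point have the same zero; being simple, it occurs only once in
    -- the sequence.
    have h3 := hloc.order_eq_one (b n) hb1 (by linarith) _ hb3 (h.apply_eq_zero n)
    rw [← h.1, Set.encard_eq_one] at h3
    obtain ⟨x, hx⟩ := h3
    have h4 : n ∈ ({x} : Set ℕ) := hx ▸ (rfl : z₀ n ^ 2 = z₀ n ^ 2)
    have h5 : m ∈ ({x} : Set ℕ) := hx ▸ (by rw [mem_ofPred_eq, h2] : m ∈ {k | z₀ k ^ 2 = z₀ n ^ 2})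
    rw [mem_singleton_iff] at h4 h5
    rw [h4, h5]
  refine ⟨b, hb, hinj, fun c hc hRc => ?_, ?_⟩
  · obtain ⟨w, hw, hFw⟩ := hloc.exists_zero c hc (by linarith)
    have h2 := hloc.order_eq_one c hc (by linarith) w hw hFw
    have h3 := (re_gt_of_mem_ball hw).1
    rw [← h.1] at h2
    obtain ⟨n, hn⟩ := Set.encard_ne_zero.1 (by rw [h2]; exact one_ne_zero)
    have hzw : z₀ n = w := eq_of_sq_eq hn (h.2 n).1 (by linarith)
    have hzR : R ≤ ‖z₀ n‖ := by
      rw [hzw]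
      linarith [re_le_norm w]
    have hn' : n₀ ≤ n := not_lt.1 fun h' => (not_lt.2 hzR) ((hn₀ n).2 h')
    exact ⟨n, hn', eq_of_mem_ball_base (hb n hn').1 hc (hb n hn').2.2 (hzw ▸ hw)⟩
  · have hmono : Monotone fun n => (z₀ n).re := monotone_nat_of_le_succ fun n => (h.2 n).2
    -- Real parts are nondecreasing and the base points are distinct and separated, so each step
    -- advances by at least `3/4`. This linear growth converts `1 / b n` into `O(1 / n)`.
    have hstep : ∀ n, n₀ ≤ n → b n + 3 / 4 ≤ b (n + 1) := by
      intro n hn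
      obtain ⟨hb1, hb2, hb3⟩ := hb n hn
      obtain ⟨hc1, hc2, hc3⟩ := hb (n + 1) (by omega)
      have h2 := re_gt_of_mem_ball hb3
      have h3 := re_gt_of_mem_ball hc3
      have h4 := hmono (Nat.le_succ n)
      simp only [Nat.succ_eq_add_one] at h4
      by_contra! hlt
      have h5 := eq_of_mem_base hb1 hc1 (abs_lt.2 ⟨by linarith, by linarith⟩)
      have := hinj n (n + 1) hn (by omega) h5
      omega
    have hlin : ∀ j : ℕ, R + 3 / 4 * j ≤ b (n₀ + j) := by
      intro j
      induction j with
      | zero => simpa using by linarith [(hb n₀ le_rfl).2.1]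
      | succ j ih =>
        have := hstep (n₀ + j) (by omega)
        rw [← add_assoc]
        push_cast
        linarith
    intro n hn
    obtain ⟨j, rfl⟩ := Nat.exists_eq_add_of_le hn
    have h2 := hlin j
    push_cast
    have h3 : (0 : ℝ) ≤ j := Nat.cast_nonneg j
    have h4 : (0 : ℝ) ≤ n₀ := Nat.cast_nonneg n₀
    nlinarith

/-! ### Existence of a zero sequence -/

/-- The points of `base` to the right of `N π + π / 2`, in increasing order. -/
def baseSeq (N : ℕ) (j : ℕ) : ℝ := (N + 1 + (j / 3 : ℕ)) * π + ![-baseAngle, 0, baseAngle] ⟨j % 3, Nat.mod_lt _ (by norm_num)⟩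

lemma baseSeq_three_mul (N q : ℕ) : baseSeq N (3 * q) = (N + 1 + q) * π - baseAngle := by
  have h1 : 3 * q / 3 = q := by omega
  have h2 : (⟨3 * q % 3, Nat.mod_lt _ (by norm_num)⟩ : Fin 3) = 0 := by
    ext; simp
  rw [baseSeq, h1, h2]
  simp [sub_eq_add_neg]

lemma baseSeq_three_mul_add_one (N q : ℕ) : baseSeq N (3 * q + 1) = (N + 1 + q) * π := by
  have h1 : (3 * q + 1) / 3 = q := by omega
  have h2 : (⟨(3 * q + 1) % 3, Nat.mod_lt _ (by norm_num)⟩ : Fin 3) = 1 := by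
    ext; simp
  rw [baseSeq, h1, h2]
  simp

lemma baseSeq_three_mul_add_two (N q : ℕ) :
    baseSeq N (3 * q + 2) = (N + 1 + q) * π + baseAngle := by
  have h1 : (3 * q + 2) / 3 = q := by omega
  have h2 : (⟨(3 * q + 2) % 3, Nat.mod_lt _ (by norm_num)⟩ : Fin 3) = 2 := by
    ext; simp
  rw [baseSeq, h1, h2]
  simp

lemma exists_eq_three_mul_add (j : ℕ) : ∃ q, j = 3 * q ∨ j = 3 * q + 1 ∨ j = 3 * q + 2 :=
  ⟨j / 3, by omega⟩

lemma baseSeq_mem_base (N j : ℕ) : baseSeq N j ∈ base := by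
  obtain ⟨q, rfl | rfl | rfl⟩ := exists_eq_three_mul_add j
  · rw [baseSeq_three_mul]
    exact ⟨N + 1 + q, Or.inr (Or.inr (by push_cast; ring))⟩
  · rw [baseSeq_three_mul_add_one]
    exact ⟨N + 1 + q, Or.inl (by push_cast; ring)⟩
  · rw [baseSeq_three_mul_add_two]
    exact ⟨N + 1 + q, Or.inr (Or.inl (by push_cast; ring))⟩

lemma baseSeq_add_le (N j : ℕ) : baseSeq N j + 3 / 4 ≤ baseSeq N (j + 1) := by
  have h1 := pi_div_four_lt_baseAngle
  have h2 := baseAngle_lt_pi_div_three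
  have hpi := Real.pi_gt_three
  obtain ⟨q, rfl | rfl | rfl⟩ := exists_eq_three_mul_add j
  · rw [baseSeq_three_mul, baseSeq_three_mul_add_one]
    linarith
  · rw [baseSeq_three_mul_add_one, baseSeq_three_mul_add_two]
    linarith
  · rw [show 3 * q + 2 + 1 = 3 * (q + 1) by ring, baseSeq_three_mul_add_two, baseSeq_three_mul]
    push_cast
    linarith

lemma baseSeq_strictMono (N : ℕ) : StrictMono (baseSeq N) :=
  strictMono_nat_of_lt_succ fun j => by linarith [baseSeq_add_le N j]

lemma le_baseSeq (N j : ℕ) : N * π + π / 2 + 1 / 2 ≤ baseSeq N j := by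
  have h1 := (baseSeq_strictMono N).monotone (Nat.zero_le j)
  have h2 := baseAngle_lt_pi_div_three
  have hpi := Real.pi_gt_three
  have h3 := baseSeq_three_mul N 0
  simp only [mul_zero, Nat.cast_zero, add_zero] at h3
  linarith

lemma exists_baseSeq_eq (N : ℕ) {b : ℝ} (hb : b ∈ base) (hNb : N * π + π / 2 ≤ b) :
    ∃ j, baseSeq N j = b := by
  have h1 := pi_div_four_lt_baseAngle
  have h2 := baseAngle_lt_pi_div_three
  have hpi := Real.pi_gt_three
  obtain ⟨n, hn⟩ := hb
  have hnN : (N : ℤ) < n := by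
    by_contra! h
    have h3 : (n : ℝ) ≤ N := by exact_mod_cast h
    have h4 : (n : ℝ) * π ≤ N * π := by gcongr
    rcases hn with rfl | rfl | rfl <;> linarith
  obtain ⟨q, hq⟩ := Int.eq_ofNat_of_zero_le (show 0 ≤ n - (N + 1) by omega)
  have hnq : (n : ℝ) = N + 1 + q := by
    have : n = N + 1 + q := by omega
    rw [this]; push_cast; ring
  rw [hnq] at hn
  rcases hn with rfl | rfl | rfl
  · exact ⟨_, baseSeq_three_mul_add_one N q⟩
  · exact ⟨_, baseSeq_three_mul_add_two N q⟩
  · exact ⟨_, baseSeq_three_mul N q⟩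

/-- The finitely many zeros in the disc are listed with multiplicity and sorted by the real part of
their principal roots. They are followed by the single zeros near the successive points of `baseSeq
N`. The two lists fit together, since the first has moduli below `R` and the second real parts above
`R`. -/
lemma exists_isZeroSequence {N : ℕ} (hF : Differentiable ℂ F) {w : ℂ} (hw : F w ≠ 0)
    (hloc : IsLocalized F (N * π + π / 2)) : ∃ z₀, IsZeroSequence F z₀ := by
  classical
  set R := N * π + π / 2
  have hR := hloc.one_le
  have hfin : {z | z ∈ ball 0 (R ^ 2) ∧ F z = 0}.Finite :=
    (finite_zeros_closedBall hF hw 0 (R ^ 2)).subset fun z hz => ⟨ball_subset_closedBall hz.1, hz.2⟩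
  set Z := hfin.toFinset
  have hZ : ∀ z, z ∈ Z ↔ z ∈ ball 0 (R ^ 2) ∧ F z = 0 := fun z => by simp [Z]
  set n₀ := ∑ a ∈ Z, analyticOrderNatAt F a
  obtain ⟨v, hvZ, hv⟩ := exists_fiber_card Z (analyticOrderNatAt F) (Finset.range n₀) (by simp [n₀])
  have hbase : ∀ j, baseSeq N j ∈ base ∧ R + 1 / 2 ≤ baseSeq N j := fun j =>
    ⟨baseSeq_mem_base N j, le_baseSeq N j⟩
  have hex : ∀ j, ∃ z ∈ ball (baseSeq N j : ℂ) (1 / 10), F (z ^ 2) = 0 := fun j =>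
    hloc.exists_zero _ (hbase j).1 (by linarith [(hbase j).2])
  choose ζ hζ hFζ using hex
  let f : Fin n₀ → ℝ := fun i => (v i ^ (1 / 2 : ℂ)).re
  let σ := Tuple.sort f
  let z₀ : ℕ → ℂ := fun n => if h : n < n₀ then v (σ ⟨n, h⟩) ^ (1 / 2 : ℂ) else ζ (n - n₀)
  have hlt : ∀ n, n < n₀ → ‖z₀ n‖ < R := by
    intro n hn
    have h1 := ((hZ _).1 (hvZ (σ ⟨n, hn⟩) (by simp))).1
    rw [← sqrt_sq (v _), sq_mem_ball_iff (by linarith)] at h1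
    simpa [z₀, hn] using h1
  have hge : ∀ n, n₀ ≤ n → R < (z₀ n).re := by
    intro n hn
    have h1 := (re_gt_of_mem_ball (hζ (n - n₀))).1
    have h2 := (hbase (n - n₀)).2
    simp only [z₀, not_lt.2 hn, dif_neg, not_false_eq_true]
    linarith
  refine ⟨z₀, fun lam => ?_, fun n => ⟨?_, ?_⟩⟩
  · by_cases hlam : lam ∈ ball (0 : ℂ) (R ^ 2)
    · have h1 : {n | z₀ n ^ 2 = lam} =
          (fun i : Fin n₀ => (i : ℕ)) '' (σ.symm '' {i : Fin n₀ | v i = lam}) := by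
        ext n
        simp only [mem_ofPred_eq, mem_image]
        constructor
        · intro h
          by_cases hn : n < n₀
          · refine ⟨⟨n, hn⟩, ⟨σ ⟨n, hn⟩, ?_, by simp⟩, rfl⟩
            simpa only [z₀, hn, dif_pos, sqrt_sq] using h
          · rw [← h, sq_mem_ball_iff (by linarith)] at hlam
            linarith [hge n (not_lt.1 hn), re_le_norm (z₀ n)]
        · rintro ⟨i, ⟨i', h, rfl⟩, rfl⟩
          simp [z₀, h]
      have h2 : ((fun i : Fin n₀ => (i : ℕ)) '' {i : Fin n₀ | v i = lam}) =
          {j | j ∈ Finset.range n₀ ∧ v j = lam} := by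
        ext j
        simp only [mem_image, mem_ofPred_eq, Finset.mem_range]
        exact ⟨by rintro ⟨i, h, rfl⟩; exact ⟨i.2, h⟩, fun h => ⟨⟨j, h.1⟩, h.2, rfl⟩⟩
      rw [h1, Fin.val_injective.encard_image, σ.symm.injective.encard_image,
        ← Fin.val_injective.encard_image, h2]
      by_cases hFl : F lam = 0
      · rw [hv lam ((hZ lam).2 ⟨hlam, hFl⟩), natCast_analyticOrderNatAt_of_entire hF hw]
      · rw [(hF.analyticAt lam).analyticOrderAt_eq_zero.2 hFl, Set.encard_eq_zero]
        refine Set.eq_empty_of_forall_notMem fun j hj => hFl ?_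
        rw [← hj.2]
        exact ((hZ _).1 (hvZ j hj.1)).2
    · have hlamR : ∀ {z : ℂ}, z ^ 2 = lam → R ≤ ‖z‖ := fun {z} h => by
        rw [← h, sq_mem_ball_iff (by linarith)] at hlam
        exact not_lt.1 hlam
      by_cases hFl : F lam = 0
      · obtain ⟨b, hb, hRb, hzb⟩ := hloc.exists_base _ (re_sqrt_nonneg lam) (hlamR (sqrt_sq lam))
          (by rw [sqrt_sq]; exact hFl)
        obtain ⟨j, rfl⟩ := exists_baseSeq_eq N hb (show R ≤ b by linarith)
        set ρ := lam ^ (1 / 2 : ℂ)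
        have h1 := hloc.order_eq_one _ hb (by linarith) ρ hzb (by rw [sqrt_sq]; exact hFl)
        rw [sqrt_sq] at h1
        rw [h1, Set.encard_eq_one]
        refine ⟨n₀ + j, Set.eq_singleton_iff_unique_mem.2 ⟨?_, fun n hn => ?_⟩⟩
        · have h2 : z₀ (n₀ + j) = ζ j := by simp [z₀]
          rw [mem_ofPred_eq, h2, hloc.eq_of_mem_ball hb (by linarith) (hζ j) hzb (hFζ j)
            (by rw [sqrt_sq]; exact hFl), sqrt_sq]
        · have hn₀ : n₀ ≤ n := by
            by_contra! h
            exact absurd (hlt n h) (not_lt.2 (hlamR hn))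
          have h2 := hge n hn₀
          have h3 : ρ = z₀ n := eq_of_sq_eq (by rw [sqrt_sq]; exact hn.symm) (re_sqrt_nonneg lam)
            (by linarith)
          have h4 : z₀ n = ζ (n - n₀) := by simp [z₀, not_lt.2 hn₀]
          have h5 := eq_of_mem_ball_base hb (hbase (n - n₀)).1 hzb (by rw [h3, h4]; exact hζ _)
          have := (baseSeq_strictMono N).injective h5
          omega
      · rw [(hF.analyticAt lam).analyticOrderAt_eq_zero.2 hFl, Set.encard_eq_zero]
        refine Set.eq_empty_of_forall_notMem fun n hn => hFl ?_
        rw [← hn]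
        by_cases hn₀ : n < n₀
        · exact absurd (hlt n hn₀) (not_lt.2 (hlamR hn))
        · simpa [z₀, hn₀] using hFζ (n - n₀)
  · by_cases hn : n < n₀
    · simpa only [z₀, hn, dif_pos] using re_sqrt_nonneg _
    · linarith [hge n (not_lt.1 hn)]
  · by_cases hn : n + 1 < n₀
    · have hn' : n < n₀ := by omega
      simp only [z₀, hn, hn', dif_pos]
      exact Tuple.monotone_sort f (show (⟨n, hn'⟩ : Fin n₀) ≤ ⟨n + 1, hn⟩ by simp)
    · by_cases hn' : n < n₀
      · linarith [hge (n + 1) (by omega), hlt n hn', re_le_norm (z₀ n)]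
      · have h1 := (re_gt_of_mem_ball (hζ (n - n₀))).2
        have h2 := (re_gt_of_mem_ball (hζ (n - n₀ + 1))).1
        have h3 := baseSeq_add_le N (n - n₀)
        have h4 : n + 1 - n₀ = n - n₀ + 1 := by omega
        simp only [z₀, hn, hn', dif_neg, not_false_eq_true, h4]
        linarith

end

/-! ### Comparison of the zeros of two lifts -/

lemma exists_finset_zeros {F : ℂ → ℂ} (hF : Differentiable ℂ F) {w : ℂ} (hw : F w ≠ 0) (R : ℝ) :
    ∃ Z : Finset ℂ, ∀ z, z ∈ Z ↔ z ∈ ball 0 R ∧ F z = 0 := by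
  have hfin : {z | z ∈ ball 0 R ∧ F z = 0}.Finite :=
    (finite_zeros_closedBall hF hw 0 R).subset fun z hz => ⟨ball_subset_closedBall hz.1, hz.2⟩
  exact ⟨hfin.toFinset, fun z => by simp⟩

/-- The summand at the origin is the source of the shift between numbering from `0` and from `1`. -/
lemma analyticOrderNatAt_id_mul {D : ℂ → ℂ} (hD : Differentiable ℂ D) {w : ℂ} (hw : D w ≠ 0)
    (a : ℂ) : analyticOrderNatAt (fun z => z * D z) a =
      analyticOrderNatAt D a + if a = 0 then 1 else 0 := by
  have h1 : analyticOrderAt (fun z => z * D z) a = analyticOrderAt (fun z : ℂ => z) a + analyticOrderAt D a :=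
    analyticOrderAt_mul (f := fun z : ℂ => z) (g := D) analyticAt_id (hD.analyticAt a)
  have h2 : analyticOrderAt (fun z : ℂ => z) a = if a = 0 then 1 else 0 := by
    split_ifs with h
    · subst h
      exact analyticOrderAt_id
    · exact (analyticAt_id.analyticOrderAt_eq_zero).2 h
  rw [analyticOrderNatAt, h1, h2, analyticOrderNatAt, ENat.toNat_add]
  · split_ifs <;> simp [add_comm]
  · split_ifs <;> simp
  · exact analyticOrderAt_ne_top_of_entire hD hw a

lemma summable_norm_sq_of_le {x : ℕ → ℂ} {r y : ℕ → ℝ} {A B : ℝ} (hr : Summable fun n => r n ^ 2)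
    (hy : Summable fun n => y n ^ 2) (h : ∀ n, ‖x n‖ ≤ A * r n + B * y n) :
    Summable fun n => ‖x n‖ ^ 2 := by
  refine Summable.of_nonneg_of_le (fun n => sq_nonneg _) (fun n => ?_)
    ((hr.mul_left (2 * A ^ 2)).add (hy.mul_left (2 * B ^ 2)))
  calc ‖x n‖ ^ 2 ≤ (A * r n + B * y n) ^ 2 := pow_le_pow_left₀ (norm_nonneg _) (h n) 2
    _ ≤ _ := by nlinarith [sq_nonneg (A * r n - B * y n)]

/-- If two lifts differ by a perturbation `Q` that is square summable over `base`, then the zeros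
of the second one (without one zero at the origin) are close to those of the first one. -/
theorem exists_perturbed_sequence {F P D Pd Q : ℂ → ℂ} {M Md K : ℝ} (hF : IsLift F P M)
    (hD : Differentiable ℂ D) (hG : IsLift (fun z => z * D z) Pd Md) (hQ : IsPerturbation Q K)
    (hPQ : ∀ z, Pd z = P z + Q z) (hsum : Summable fun b : base => ‖Q ((b : ℝ) : ℂ)‖ ^ 2)
    {z₀ : ℕ → ℂ} (hz₀ : IsZeroSequence F z₀) :
    ∃ z κ : ℕ → ℂ, Summable (fun n => ‖κ n‖ ^ 2) ∧ (∀ n : ℕ, 1 ≤ n → z n = z₀ n + κ n / n) ∧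
      ∀ lam : ℂ, {n : ℕ | 1 ≤ n ∧ z n ^ 2 = lam}.encard = analyticOrderAt D lam := by
  classical
  obtain ⟨R₁, h₁⟩ := hF.exists_isLocalized
  obtain ⟨R₂, h₂⟩ := hG.exists_isLocalized
  obtain ⟨R₃, h₃⟩ := hF.exists_norm_lt hQ
  obtain ⟨N, hN⟩ := exists_nat_radius (max R₁ (max R₂ R₃))
  have hlF := h₁ N ((le_max_left _ _).trans hN)
  have hlG := h₂ N ((le_max_left _ _).trans ((le_max_right _ _).trans hN))
  have hrou := h₃ N ((le_max_right _ _).trans ((le_max_right _ _).trans hN))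
  set R := N * π + π / 2
  set G : ℂ → ℂ := fun z => z * D z with hGdef
  have hR := hlF.one_le
  have hR0 : 0 ≤ R := by linarith
  have hGF : ∀ z, G (z ^ 2) = F (z ^ 2) + Q z := fun z => by
    rw [hG.apply_sq, hF.apply_sq, hPQ]; ring
  have hRn : ‖(R : ℂ)‖ = R := by rw [norm_real, Real.norm_eq_abs, abs_of_nonneg hR0]
  have hF0 : F ((R : ℂ) ^ 2) ≠ 0 := norm_pos_iff.1 ((norm_nonneg _).trans_lt (hrou R hRn))
  have hG0 : G ((R : ℂ) ^ 2) ≠ 0 := fun h => by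
    rw [hGF, add_eq_zero_iff_eq_neg] at h
    have := hrou R hRn
    rw [h, norm_neg] at this
    exact lt_irrefl _ this
  have hD0 : D ((R : ℂ) ^ 2) ≠ 0 := fun h => hG0 (by simp [hGdef, h])
  obtain ⟨ZF, hZF⟩ := exists_finset_zeros hF.differentiable_lift hF0 (R ^ 2)
  obtain ⟨ZG, hZG⟩ := exists_finset_zeros hG.differentiable_lift hG0 (R ^ 2)
  set n₀ := ∑ a ∈ ZF, analyticOrderNatAt F a with hn₀def
  -- `F` and `G` have equally many zeros in the disc, and one of those of `G` comes from the factor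
  -- `z`. Hence `D` has `n₀ - 1` of them, exactly enough for the indices `1, …, n₀ - 1`.
  have hcount : n₀ = (∑ a ∈ ZG, analyticOrderNatAt D a) + 1 := by
    rw [hn₀def, sum_analyticOrderNatAt_eq_of_norm_sub_lt hF.differentiable_lift
      hG.differentiable_lift (c := 0) (R := R ^ 2) (by positivity) (fun z hz => ?_) ZF ZG hZF hZG]
    · rw [Finset.sum_congr rfl fun a _ =>
        (analyticOrderNatAt_id_mul hD hD0 a : analyticOrderNatAt G a = _)]
      rw [Finset.sum_add_distrib, Finset.sum_ite_eq' ZG 0, if_pos]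
      rw [hZG]
      exact ⟨mem_ball_self (by positivity), zero_mul _⟩
    -- The circle of radius `R ^ 2` is pulled back to `|z| = R` by the principal root, where `F`
    -- dominates `Q`.
    · rw [mem_sphere_zero_iff_norm] at hz
      have h4 : ‖z ^ (1 / 2 : ℂ)‖ = R := by
        rw [← sqrt_sq z, norm_pow] at hz
        exact (pow_left_inj₀ (norm_nonneg _) hR0 two_ne_zero).1 hz
      have h5 := hrou _ h4
      have h6 := hGF (z ^ (1 / 2 : ℂ))
      rw [sqrt_sq] at h5 h6
      change ‖F z - G z‖ < _
      rw [h6]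
      simpa using h5
  have hn₀ : ∀ n, ‖z₀ n‖ < R ↔ n < n₀ := fun n => hz₀.norm_lt_iff hF.differentiable_lift hF0 hlF hZF n
  obtain ⟨b, hb, hbinj, hbsurj, hbn⟩ := hz₀.exists_base hlF hn₀
  obtain ⟨v, hvZ, hv⟩ := exists_fiber_card ZG (analyticOrderNatAt D) (Finset.Ico 1 n₀)
    (by rw [Nat.card_Ico]; omega)
  have hex : ∀ n, ∃ z, n₀ ≤ n → z ∈ ball (b n : ℂ) (1 / 10) ∧ G (z ^ 2) = 0 := fun n => by
    by_cases hn : n₀ ≤ n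
    · obtain ⟨z, hz, hz0⟩ := hlG.exists_zero _ (hb n hn).1 (by linarith [(hb n hn).2.1])
      exact ⟨z, fun _ => ⟨hz, hz0⟩⟩
    · exact ⟨0, fun h => absurd h hn⟩
  choose ζ hζ using hex
  let z : ℕ → ℂ := fun n => if n < n₀ then v n ^ (1 / 2 : ℂ) else ζ n
  have hzlt : ∀ n, n < n₀ → z n ^ 2 = v n := fun n hn => by simp only [z, hn, if_true, sqrt_sq]
  have hzge : ∀ n, n₀ ≤ n → z n = ζ n := fun n hn => by simp [z, not_lt.2 hn]
  have hreζ : ∀ n, n₀ ≤ n → R < (ζ n).re := fun n hn => by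
    linarith [(re_gt_of_mem_ball (hζ n hn).1).1, (hb n hn).2.1]
  have hGD : ∀ {lam : ℂ}, G lam = 0 → lam ∉ ball (0 : ℂ) (R ^ 2) → D lam = 0 := by
    intro lam h hlam
    rcases mul_eq_zero.1 h with h | h
    · exact absurd (h ▸ mem_ball_self (by positivity)) hlam
    · exact h
  refine ⟨z, fun n => n * (z n - z₀ n), ?_, fun n hn => ?_, fun lam => ?_⟩
  · rw [← summable_nat_add_iff n₀]
    set L := K * Real.exp 4
    have hbase : Summable fun n => ‖Q ((b (n + n₀) : ℝ) : ℂ)‖ ^ 2 := by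
      have := hsum.comp_injective (i := fun n => (⟨b (n + n₀), (hb _ (by omega)).1⟩ : base))
        (fun n m h => by
          have := hbinj (n + n₀) (m + n₀) (by omega) (by omega) (by simpa using h)
          omega)
      exact this
    have hinv : Summable fun n : ℕ => (1 / ((n + n₀ : ℕ) : ℝ)) ^ 2 := by
      have := (summable_nat_add_iff n₀).2 (Real.summable_one_div_nat_pow.2 (one_lt_two))
      simpa only [one_div, inv_pow] using this
    have hK : 0 ≤ L := mul_nonneg hQ.nonneg (Real.exp_pos _).le
    refine summable_norm_sq_of_le (A := 2 * (n₀ + 2)) (B := 2 * (n₀ + 2) * (L * (2 * Md * (n₀ + 2))))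
      hbase hinv fun j => ?_
    set n := j + n₀
    have hn : n₀ ≤ n := by omega
    have hn1 : (0 : ℝ) < n := by
      have : 0 < n := by omega
      exact_mod_cast this
    obtain ⟨hb1, hb2, hb3⟩ := hb n hn
    obtain ⟨hζ1, hζ2⟩ := hζ n hn
    have hbpos : 0 < b n := by linarith
    have hbn' := hbn n hn
    have hζc := ball_subset_closedBall hζ1
    -- `F` vanishes at `z₀ n ^ 2`, and `G = F + Q` vanishes at `ζ n ^ 2`, so the increment of `F` is
    -- `-Q (ζ n)` and the expansion estimate for `F` applies.
    have e1 : b n / 2 * ‖ζ n - z₀ n‖ ≤ ‖Q (ζ n)‖ := by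
      refine (hlF.le_norm_sub _ hb1 (by linarith) _ hζc _ (ball_subset_closedBall hb3)).trans ?_
      rw [hz₀.apply_eq_zero, sub_zero]
      rw [hGF, add_eq_zero_iff_eq_neg] at hζ2
      rw [hζ2, norm_neg]
    -- At a point of `base` the leading term vanishes, so the value of `G` there is `Pd (b n)`,
    -- which is bounded on the real line.
    have e2 : b n / 2 * ‖ζ n - b n‖ ≤ Md := by
      refine (hlG.le_norm_sub _ hb1 (by linarith) _ hζc _ (mem_closedBall_self (by norm_num))).trans ?_
      rw [hζ2, zero_sub, norm_neg, hG.apply_sq, trigFactor_base hb1, mul_zero, zero_add]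
      simpa using hG.norm_le (b n)
    have e3 : ‖Q (ζ n) - Q (b n)‖ ≤ L * ‖ζ n - b n‖ := by
      refine (convex_closedBall (b n : ℂ) (1 / 10)).norm_image_sub_le_of_norm_hasDerivWithin_le
        (f' := deriv Q) (fun w _ => (hQ.differentiable w).hasDerivAt.hasDerivWithinAt)
        (fun w hw => hQ.norm_deriv_le ?_) (mem_closedBall_self (by norm_num)) hζc
      have := abs_im_le_norm (w - b n)
      rw [mem_closedBall, dist_eq_norm] at hw
      simp only [sub_im, ofReal_im, sub_zero] at this
      linarith
    have e4 : ‖Q (ζ n)‖ ≤ ‖Q (b n)‖ + L * ‖ζ n - b n‖ := by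
      have := norm_sub_norm_le (Q (ζ n)) (Q (b n))
      linarith
    have e5 : ‖ζ n - b n‖ ≤ 2 * Md * (n₀ + 2) * (1 / (n : ℝ)) := by
      rw [mul_one_div, le_div_iff₀ hn1]
      have hc : (0 : ℝ) ≤ n₀ + 2 := by positivity
      calc ‖ζ n - b n‖ * n ≤ ‖ζ n - b n‖ * ((n₀ + 2) * b n) := by gcongr
        _ = 2 * (n₀ + 2) * (b n / 2 * ‖ζ n - b n‖) := by ring
        _ ≤ 2 * (n₀ + 2) * Md := by gcongr
        _ = _ := by ring
    change ‖(n : ℂ) * (z n - z₀ n)‖ ≤ _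
    rw [hzge n hn, norm_mul, Complex.norm_natCast]
    -- The outcome is a multiple of `|Q (b n)|` plus a multiple of `1 / n`. Both are
    -- square-summable, the first because the `b n` are distinct points of `base`.
    calc (n : ℝ) * ‖ζ n - z₀ n‖ ≤ ((n₀ + 2) * b n) * ‖ζ n - z₀ n‖ := by gcongr
      _ = 2 * (n₀ + 2) * (b n / 2 * ‖ζ n - z₀ n‖) := by ring
      _ ≤ 2 * (n₀ + 2) * (‖Q (b n)‖ + L * (2 * Md * (n₀ + 2) * (1 / (n : ℝ)))) := by
        gcongr
        exact e1.trans (e4.trans (by gcongr))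
      _ = _ := by ring
  · have : (n : ℂ) ≠ 0 := by
      have : n ≠ 0 := by omega
      exact_mod_cast this
    field_simp
    ring
  · by_cases hlam : lam ∈ ball (0 : ℂ) (R ^ 2)
    · have h1 : {n | 1 ≤ n ∧ z n ^ 2 = lam} = {n | n ∈ Finset.Ico 1 n₀ ∧ v n = lam} := by
        ext n
        simp only [mem_ofPred_eq, Finset.mem_Ico, and_assoc]
        refine and_congr_right fun hn => ⟨fun h => ?_, fun h => ?_⟩
        · have hn' : n < n₀ := by
            by_contra! hn'
            rw [← h, hzge n hn', sq_mem_ball_iff hR0] at hlam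
            linarith [hreζ n hn', re_le_norm (ζ n)]
          exact ⟨hn', by rw [← h, hzlt n hn']⟩
        · rw [hzlt n h.1, h.2]
      rw [h1]
      by_cases hGl : G lam = 0
      · rw [hv lam ((hZG lam).2 ⟨hlam, hGl⟩), natCast_analyticOrderNatAt_of_entire hD hD0]
      · have hDl : D lam ≠ 0 := fun h => hGl (by simp [hGdef, h])
        rw [(hD.analyticAt lam).analyticOrderAt_eq_zero.2 hDl, Set.encard_eq_zero]
        refine Set.eq_empty_of_forall_notMem fun j hj => hGl ?_
        rw [← hj.2]
        exact ((hZG _).1 (hvZ j hj.1)).2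
    · have hge : ∀ n, 1 ≤ n → z n ^ 2 = lam → n₀ ≤ n := fun n hn h => by
        by_contra! hn'
        rw [← h, hzlt n hn'] at hlam
        exact hlam ((hZG _).1 (hvZ n (by simp; omega))).1
      by_cases hDl : D lam = 0
      · have hGl : G lam = 0 := by simp [hGdef, hDl]
        set ρ := lam ^ (1 / 2 : ℂ) with hρ
        have hρ2 : ρ ^ 2 = lam := sqrt_sq lam
        have hρR : R ≤ ‖ρ‖ := by
          rw [← hρ2, sq_mem_ball_iff hR0] at hlam
          exact not_lt.1 hlam
        have hGρ : G (ρ ^ 2) = 0 := by rw [hρ2, hGl]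
        obtain ⟨c, hc, hRc, hρc⟩ := hlG.exists_base ρ (re_sqrt_nonneg lam) hρR hGρ
        have h1 := hlG.order_eq_one c hc (by linarith) ρ hρc hGρ
        have h2 := analyticOrderNatAt_id_mul hD hD0 lam
        have hlam0 : lam ≠ 0 := fun h => hlam (h ▸ mem_ball_self (by positivity))
        rw [if_neg hlam0, add_zero, analyticOrderNatAt] at h2
        change (analyticOrderAt G lam).toNat = _ at h2
        rw [hρ2] at h1
        rw [h1] at h2
        rw [← natCast_analyticOrderNatAt_of_entire hD hD0, ← h2]
        simp only [ENat.toNat_one, Nat.cast_one]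
        obtain ⟨n, hn, hbc⟩ := hbsurj c hc hRc
        rw [Set.encard_eq_one]
        refine ⟨n, Set.eq_singleton_iff_unique_mem.2 ⟨⟨by omega, ?_⟩, fun k hk => ?_⟩⟩
        · rw [hzge n hn, hlG.eq_of_mem_ball hc (by linarith) (hbc ▸ (hζ n hn).1) hρc (hζ n hn).2 hGρ,
            hρ2]
        · have hk' := hge k hk.1 hk.2
          have h3 : ρ = ζ k := eq_of_sq_eq (by rw [hρ2, ← hzge k hk']; exact hk.2.symm)
            (re_sqrt_nonneg lam) (by linarith [hreζ k hk'])
          have h4 := eq_of_mem_ball_base hc (hb k hk').1 hρc (by rw [h3]; exact (hζ k hk').1)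
          exact hbinj k n hk' hn (by rw [hbc, h4])
      · rw [(hD.analyticAt lam).analyticOrderAt_eq_zero.2 hDl, Set.encard_eq_zero]
        refine Set.eq_empty_of_forall_notMem fun n hn => hDl ?_
        have hn' := hge n hn.1 hn.2
        refine hGD ?_ hlam
        rw [← hn.2, hzge n hn']
        exact (hζ n hn').2

/-! ### The fundamental solutions of `-y'' = lam y` -/

/-- The solution of `-y'' = lam y` with `y 0 = 1`, `y' 0 = 0`. -/
def solC (lam : ℂ) (x : ℝ) : ℂ := cosSqrt (lam * x ^ 2)

/-- The solution of `-y'' = lam y` with `y 0 = 0`, `y' 0 = 1`. -/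
def solS (lam : ℂ) (x : ℝ) : ℂ := x * sincSqrt (lam * x ^ 2)

lemma solC_sq (ρ : ℂ) (x : ℝ) : solC (ρ ^ 2) x = cos (ρ * x) := by
  rw [solC, ← mul_pow, cosSqrt_sq]

lemma mul_solS_sq (ρ : ℂ) (x : ℝ) : ρ * solS (ρ ^ 2) x = sin (ρ * x) := by
  rw [solS, ← mul_pow, ← mul_sincSqrt_sq]
  ring

@[simp] lemma solC_zero (lam : ℂ) : solC lam 0 = 1 := by
  have := cosSqrt_sq 0
  simpa [solC] using this

@[simp] lemma solS_zero (lam : ℂ) : solS lam 0 = 0 := by simp [solS]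

lemma solC_sq_add (lam : ℂ) (x : ℝ) : solC lam x ^ 2 + lam * solS lam x ^ 2 = 1 := by
  rw [solC, solS, ← cosSqrt_sq_add (lam * x ^ 2)]
  ring

lemma hasDerivAt_ofReal_sq (lam : ℂ) (x : ℝ) :
    HasDerivAt (fun x : ℝ => lam * (x : ℂ) ^ 2) (lam * (2 * x)) x := by
  have := ((hasDerivAt_pow 2 (x : ℂ)).comp_ofReal).const_mul lam
  simpa using this

lemma hasDerivAt_solC (lam : ℂ) (x : ℝ) : HasDerivAt (solC lam) (-lam * solS lam x) x := by
  have := (hasDerivAt_cosSqrt (lam * x ^ 2)).comp x (hasDerivAt_ofReal_sq lam x)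
  refine this.congr_deriv ?_
  rw [solS]
  ring

lemma hasDerivAt_solS (lam : ℂ) (x : ℝ) : HasDerivAt (solS lam) (solC lam x) x := by
  have h1 := (differentiable_sincSqrt (lam * x ^ 2)).hasDerivAt.comp x (hasDerivAt_ofReal_sq lam x)
  have h2 := (hasDerivAt_id (x : ℂ)).comp_ofReal.mul h1
  refine h2.congr_deriv ?_
  rw [solC, ← sincSqrt_add_deriv]
  simp only [Function.comp_apply, id]
  ring

lemma continuous_solC : Continuous fun p : ℂ × ℝ => solC p.1 p.2 :=
  differentiable_cosSqrt.continuous.comp (by fun_prop)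

lemma continuous_solS : Continuous fun p : ℂ × ℝ => solS p.1 p.2 :=
  Continuous.mul (by fun_prop) (differentiable_sincSqrt.continuous.comp (by fun_prop))

lemma differentiable_solC (x : ℝ) : Differentiable ℂ fun z => solC z x :=
  differentiable_cosSqrt.comp (by fun_prop)

lemma differentiable_solS (x : ℝ) : Differentiable ℂ fun z => solS z x :=
  (differentiable_sincSqrt.comp (by fun_prop)).const_mul _

/-! ### Absolutely continuous complex-valued functions -/

/-- Each increment is dominated by the corresponding increment of the integral of the norm, which
reduces the claim to the real case. -/
lemma absolutelyContinuousOnInterval_integral {f : ℝ → ℂ} {a b : ℝ}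
    (hf : IntervalIntegrable f volume a b) :
    AbsolutelyContinuousOnInterval (fun x => ∫ t in a..x, f t) a b := by
  have h := hf.norm.absolutelyContinuousOnInterval_intervalIntegral (c := a) left_mem_uIcc
  have hsub : ∀ x ∈ uIcc a b, ∀ y ∈ uIcc a b, IntervalIntegrable f volume x y := fun x hx y hy =>
    hf.mono_set (uIcc_subset_uIcc hx hy)
  unfold AbsolutelyContinuousOnInterval at h ⊢
  refine squeeze_zero' (Eventually.of_forall fun E => Finset.sum_nonneg fun i _ => dist_nonneg) ?_ h
  have hmem : ∀ᶠ E in (AbsolutelyContinuousOnInterval.totalLengthFilter ⊓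
      𝓟 (AbsolutelyContinuousOnInterval.disjWithin a b)),
      E ∈ AbsolutelyContinuousOnInterval.disjWithin a b :=
    eventually_inf_principal.2 (Eventually.of_forall fun E h => h)
  filter_upwards [hmem] with E hE
  refine Finset.sum_le_sum fun i hi => ?_
  have hI := hE.1 i hi
  have h1 := hsub a left_mem_uIcc _ hI.1
  have h2 := hsub a left_mem_uIcc _ hI.2
  rw [dist_eq_norm, dist_eq_norm, intervalIntegral.integral_interval_sub_left h1 h2,
    intervalIntegral.integral_interval_sub_left h1.norm h2.norm, Real.norm_eq_abs]
  exact intervalIntegral.norm_integral_le_abs_integral_norm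

lemma absolutelyContinuousOnInterval_of_hasDerivWithinAt {f f' : ℝ → ℂ} {a b : ℝ}
    (hf : ∀ x ∈ uIcc a b, HasDerivWithinAt f (f' x) (uIcc a b) x)
    (hf' : ContinuousOn f' (uIcc a b)) : AbsolutelyContinuousOnInterval f a b := by
  obtain ⟨K, hK⟩ := isCompact_uIcc.exists_bound_of_continuousOn hf'
  have := (convex_uIcc a b).lipschitzOnWith_of_nnnorm_hasDerivWithin_le (C := K.toNNReal) hf
    (fun x hx => by
      rw [← NNReal.coe_le_coe, coe_nnnorm]
      exact (hK x hx).trans (Real.le_coe_toNNReal K))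
  exact this.absolutelyContinuousOnInterval

lemma eq_of_ae_hasDerivAt_zero {f : ℝ → ℂ} {a b : ℝ} (hf : AbsolutelyContinuousOnInterval f a b)
    (h : ∀ᵐ x, x ∈ uIcc a b → HasDerivAt f 0 x) {x : ℝ} (hx : x ∈ uIcc a b) : f x = f a := by
  obtain ⟨c, hc⟩ := hf.const_of_ae_hasDerivAt_zero h
  rw [hc x hx, hc a left_mem_uIcc]

lemma sub_eq_integral_of_ae_hasDerivAt {f f' : ℝ → ℂ} {a b : ℝ}
    (hf : AbsolutelyContinuousOnInterval f a b) (hf' : IntervalIntegrable f' volume a b)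
    (h : ∀ᵐ x, x ∈ uIcc a b → HasDerivAt f (f' x) x) : f b - f a = ∫ t in a..b, f' t := by
  have h1 := eq_of_ae_hasDerivAt_zero (f := fun x => f x - ∫ t in a..x, f' t)
    (hf.sub (absolutelyContinuousOnInterval_integral hf')) (by
      filter_upwards [h, hf'.ae_hasDerivAt_integral] with x h1 h2 hx
      have := (h1 hx).sub (h2 hx a left_mem_uIcc)
      rw [sub_self] at this
      exact this) (right_mem_uIcc (a := a) (b := b))
  simp only [intervalIntegral.integral_same, sub_zero] at h1
  rw [← h1]
  ring

/-- Solutions of `-y'' = lam y` in the Carathéodory sense are classical. -/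
lemma eq_solC_add_solS {y p : ℝ → ℂ} {lam : ℂ}
    (hy : ∀ x ∈ Icc (0 : ℝ) 1, HasDerivWithinAt y (p x) (Icc 0 1) x)
    (hp : AbsolutelyContinuousOnInterval p 0 1)
    (hyp : ∀ᵐ x ∂(volume.restrict (Ioo (0 : ℝ) 1)), HasDerivAt p (-lam * y x) x)
    {x : ℝ} (hx : x ∈ Icc (0 : ℝ) 1) :
    y x = y 0 * solC lam x + p 0 * solS lam x ∧
      p x = -lam * y 0 * solS lam x + p 0 * solC lam x := by
  have h01 : uIcc (0 : ℝ) 1 = Icc 0 1 := uIcc_of_le zero_le_one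
  have hyac : AbsolutelyContinuousOnInterval y 0 1 := by
    refine absolutelyContinuousOnInterval_of_hasDerivWithinAt (f' := p) ?_ hp.continuousOn
    rwa [h01]
  have hC : AbsolutelyContinuousOnInterval (solC lam) 0 1 :=
    absolutelyContinuousOnInterval_of_hasDerivWithinAt
      (fun x _ => (hasDerivAt_solC lam x).hasDerivWithinAt)
      ((continuous_const.mul (continuous_solS.comp (by fun_prop : Continuous fun x : ℝ => (lam, x)))).continuousOn)
  have hS : AbsolutelyContinuousOnInterval (solS lam) 0 1 :=
    absolutelyContinuousOnInterval_of_hasDerivWithinAt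
      (fun x _ => (hasDerivAt_solS lam x).hasDerivWithinAt)
      ((continuous_solC.comp (by fun_prop : Continuous fun x : ℝ => (lam, x))).continuousOn)
  have hae : ∀ᵐ x, x ∈ uIcc (0 : ℝ) 1 → HasDerivAt y (p x) x ∧ HasDerivAt p (-lam * y x) x := by
    rw [ae_restrict_iff' measurableSet_Ioo] at hyp
    have h0 : ∀ᵐ x : ℝ, x ≠ 0 := by simp [ae_iff, measure_singleton]
    have h1 : ∀ᵐ x : ℝ, x ≠ 1 := by simp [ae_iff, measure_singleton]
    filter_upwards [hyp, h0, h1] with x hx hx0 hx1 hxm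
    rw [h01] at hxm
    have hxo : x ∈ Ioo (0 : ℝ) 1 :=
      ⟨lt_of_le_of_ne hxm.1 (Ne.symm hx0), lt_of_le_of_ne hxm.2 hx1⟩
    exact ⟨(hy x hxm).hasDerivAt (Icc_mem_nhds hxo.1 hxo.2), hx hxo⟩
  -- The combinations `y C - p S` and `lam y S + p C` have derivative zero almost everywhere and are
  -- absolutely continuous, hence constant. Solving for `y` and `p` uses `C² + lam S² = 1`.
  have e1 := eq_of_ae_hasDerivAt_zero (f := y • solC lam - p • solS lam)
    ((hyac.smul hC).sub (hp.smul hS)) (by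
      filter_upwards [hae] with t ht htm
      have := ((ht htm).1.mul (hasDerivAt_solC lam t)).sub
        ((ht htm).2.mul (hasDerivAt_solS lam t))
      exact this.congr_deriv (by ring)) (h01 ▸ hx)
  have e2 := eq_of_ae_hasDerivAt_zero (f := (fun t => lam * y t) • solS lam + p • solC lam)
    (((AbsolutelyContinuousOnInterval.const_smul lam hyac).smul hS).add (hp.smul hC)) (by
      filter_upwards [hae] with t ht htm
      have := (((ht htm).1.const_mul lam).mul (hasDerivAt_solS lam t)).add
        ((ht htm).2.mul (hasDerivAt_solC lam t))
      exact this.congr_deriv (by ring)) (h01 ▸ hx)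
  simp only [smul_eq_mul, Pi.sub_apply, Pi.add_apply, Pi.mul_apply, solC_zero, solS_zero, mul_one,
    mul_zero, sub_zero, zero_add] at e1 e2
  have h := solC_sq_add lam x
  constructor
  · linear_combination solC lam x * e1 + solS lam x * e2 - y x * h
  · linear_combination solC lam x * e2 - lam * solS lam x * e1 - p x * h

/-! ### Integrals depending on a parameter -/

section
variable {K : ℂ → ℝ → ℂ} {q : ℝ → ℂ}

lemma exists_bound_of_continuous (hK : Continuous fun p : ℂ × ℝ => K p.1 p.2) (z₀ : ℂ) (r : ℝ)
    (a b : ℝ) : ∃ B, ∀ z ∈ closedBall z₀ r, ∀ t ∈ uIcc a b, ‖K z t‖ ≤ B := by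
  obtain ⟨B, hB⟩ := ((isCompact_closedBall z₀ r).prod (isCompact_uIcc (a := a) (b := b))).exists_bound_of_continuousOn
    hK.continuousOn
  exact ⟨B, fun z hz t ht => hB (z, t) ⟨hz, ht⟩⟩

lemma intervalIntegrable_mul (hK : Continuous fun p : ℂ × ℝ => K p.1 p.2) {a b : ℝ}
    (hq : IntervalIntegrable q volume a b) (z : ℂ) :
    IntervalIntegrable (fun t => K z t * q t) volume a b :=
  hq.continuousOn_mul (hK.comp (by fun_prop : Continuous fun t : ℝ => (z, t))).continuousOn

lemma continuous_integral_mul (hK : Continuous fun p : ℂ × ℝ => K p.1 p.2)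
    (hq : ∀ a b, IntervalIntegrable q volume a b) :
    Continuous fun p : ℂ × ℝ => ∫ t in (0 : ℝ)..p.2, K p.1 t * q t := by
  refine continuous_iff_continuousAt.2 fun ⟨z₀, x₀⟩ => ?_
  obtain ⟨B, hB⟩ := exists_bound_of_continuous hK z₀ 1 (-|x₀| - 1) (|x₀| + 1)
  have hlt : -|x₀| - 1 ≤ |x₀| + 1 := by linarith [abs_nonneg x₀]
  refine intervalIntegral.continuousAt_parametric_primitive_of_dominated
    (F := fun z t => K z t * q t) (fun t => B * ‖q t‖) (-|x₀| - 1) (|x₀| + 1)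
    (fun z => (intervalIntegrable_mul hK (hq _ _) z).def'.aestronglyMeasurable) ?_
    ((hq _ _).norm.const_mul B) ?_ ⟨by linarith [abs_nonneg x₀], by linarith [abs_nonneg x₀]⟩
    ⟨by linarith [neg_abs_le x₀], by linarith [le_abs_self x₀]⟩ (by simp)
  · filter_upwards [closedBall_mem_nhds z₀ one_pos] with z hz
    refine (ae_restrict_iff' measurableSet_uIoc).2 (Eventually.of_forall fun t ht => ?_)
    rw [norm_mul]
    exact mul_le_mul_of_nonneg_right (hB z hz t (uIoc_subset_uIcc ht)) (norm_nonneg _)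
  · refine Eventually.of_forall fun t => ContinuousAt.mul ?_ continuousAt_const
    exact (hK.comp (by fun_prop : Continuous fun z : ℂ => (z, t))).continuousAt

/-- Differentiation under the integral sign; the dominating function comes from Cauchy's estimate on
unit circles, which explains the radius `2` of the ball on which `K` is bounded. -/
lemma differentiable_integral_mul (hK : Continuous fun p : ℂ × ℝ => K p.1 p.2)
    (hd : ∀ t, Differentiable ℂ fun z => K z t) {a b : ℝ} (hq : IntervalIntegrable q volume a b) :
    Differentiable ℂ fun z => ∫ t in a..b, K z t * q t := by
  intro z₀
  obtain ⟨B, hB⟩ := exists_bound_of_continuous hK z₀ 2 a b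
  have hd' : ∀ z ∈ ball z₀ 1, ∀ t ∈ uIcc a b, ‖deriv (fun z => K z t) z‖ ≤ B := by
    intro z hz t ht
    have := Complex.norm_deriv_le_of_forall_mem_sphere_norm_le (c := z) (R := 1) (C := B) one_pos
      ((hd t).diffContOnCl) fun w hw => hB w ?_ t ht
    · simpa using this
    · rw [mem_closedBall]
      have h1 := dist_triangle w z z₀
      rw [mem_sphere] at hw
      rw [mem_ball] at hz
      linarith
  have hmeas : Measurable fun t : ℝ => deriv (fun z => K z t) z₀ := by
    have h1 : Continuous (Function.uncurry fun (t : ℝ) (z : ℂ) => K z t) :=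
      hK.comp (by fun_prop : Continuous fun p : ℝ × ℂ => (p.2, p.1))
    exact (measurable_deriv_with_param h1).comp (by fun_prop : Measurable fun t : ℝ => (t, z₀))
  have := intervalIntegral.hasDerivAt_integral_of_dominated_loc_of_deriv_le
    (F := fun z t => K z t * q t) (F' := fun z t => deriv (fun z => K z t) z * q t) (x₀ := z₀)
    (bound := fun t => B * ‖q t‖) (μ := volume) (a := a) (b := b) (s := ball z₀ 1)
    (ball_mem_nhds z₀ one_pos)
    (Eventually.of_forall fun z => (intervalIntegrable_mul hK hq z).def'.aestronglyMeasurable)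
    (intervalIntegrable_mul hK hq z₀)
    (hmeas.aestronglyMeasurable.mul hq.def'.aestronglyMeasurable)
    (Eventually.of_forall fun t ht z hz => by
      rw [norm_mul]
      exact mul_le_mul_of_nonneg_right (hd' z hz t (uIoc_subset_uIcc ht)) (norm_nonneg _))
    (hq.norm.const_mul B)
    (Eventually.of_forall fun t ht z hz => (hd t z).hasDerivAt.mul_const _)
  exact this.2.differentiableAt
end

/-! ### Laurent-type coefficients as circle integrals -/

/-- For an entire `h`, this is the coefficient of `(z - lam) ^ (n - 1)` in the expansion of `h`
at `lam` if `1 ≤ n`, and `0` if `n = 0`. -/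
def circleCoeff (lam : ℂ) (n : ℕ) (h : ℂ → ℂ) : ℂ :=
  (2 * π * I)⁻¹ * ∮ z in C(lam, 1), ((z - lam) ^ n)⁻¹ * h z

section circleCoeff
variable {lam : ℂ} {n : ℕ} {h g : ℂ → ℂ}

lemma sub_ne_zero_of_mem_sphere {z : ℂ} (hz : z ∈ sphere lam 1) : z - lam ≠ 0 := by
  rw [mem_sphere_iff_norm] at hz
  rw [← norm_pos_iff, hz]
  exact one_pos

lemma circleIntegrable_circleCoeff (hh : Continuous h) :
    CircleIntegrable (fun z => ((z - lam) ^ n)⁻¹ * h z) lam 1 :=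
  ContinuousOn.circleIntegrable zero_le_one (ContinuousOn.mul (ContinuousOn.inv₀ (by fun_prop)
    fun z hz => pow_ne_zero _ (sub_ne_zero_of_mem_sphere hz)) hh.continuousOn)

lemma circleCoeff_add (hh : Continuous h) (hg : Continuous g) :
    circleCoeff lam n (fun z => h z + g z) = circleCoeff lam n h + circleCoeff lam n g := by
  simp only [circleCoeff, mul_add]
  rw [circleIntegral.integral_add (circleIntegrable_circleCoeff hh)
    (circleIntegrable_circleCoeff hg), mul_add]

lemma circleCoeff_const_mul (c : ℂ) :
    circleCoeff lam n (fun z => c * h z) = c * circleCoeff lam n h := by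
  simp only [circleCoeff, mul_left_comm _ c]
  rw [circleIntegral.integral_const_mul]
  ring

lemma circleCoeff_sub (hh : Continuous h) (hg : Continuous g) :
    circleCoeff lam n (fun z => h z - g z) = circleCoeff lam n h - circleCoeff lam n g := by
  have := circleCoeff_add (lam := lam) (n := n) hh (hg.const_smul (-1 : ℂ))
  simp only [Pi.smul_apply, smul_eq_mul] at this
  have h2 : circleCoeff lam n ((-1 : ℂ) • g) = -circleCoeff lam n g := by
    have := circleCoeff_const_mul (lam := lam) (n := n) (h := g) (-1)
    rw [neg_one_mul] at this
    exact this
  rw [h2] at this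
  simpa [sub_eq_add_neg] using this

/-- Write `z = lam + (z - lam)`. This lowering of the index is what turns the parameter `z` in the
differential equation into the chain relation `(L - lam) uⁿ⁺¹ = uⁿ`. -/
lemma circleCoeff_id_mul (hh : Continuous h) :
    circleCoeff lam (n + 1) (fun z => z * h z) =
      lam * circleCoeff lam (n + 1) h + circleCoeff lam n h := by
  have h1 : circleCoeff lam (n + 1) (fun z => z * h z) = (2 * π * I)⁻¹ *
      ∮ z in C(lam, 1), (lam * (((z - lam) ^ (n + 1))⁻¹ * h z) + ((z - lam) ^ n)⁻¹ * h z) := by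
    rw [circleCoeff]
    congr 1
    refine circleIntegral.integral_congr zero_le_one fun z hz => ?_
    have := sub_ne_zero_of_mem_sphere hz
    field_simp
    ring
  have hc : CircleIntegrable (fun z => lam * (((z - lam) ^ (n + 1))⁻¹ * h z)) lam 1 :=
    (circleIntegrable_circleCoeff hh).const_smul (a := lam)
  rw [h1, circleIntegral.integral_add hc (circleIntegrable_circleCoeff hh),
    circleIntegral.integral_const_mul, circleCoeff, circleCoeff]
  ring

/-- The pole cancels, so the integrand is entire and Cauchy's theorem applies. -/
lemma circleCoeff_pow_mul_of_le (hg : Differentiable ℂ g) {m : ℕ} (hnm : n ≤ m) :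
    circleCoeff lam n (fun z => (z - lam) ^ m * g z) = 0 := by
  have h1 : (∮ z in C(lam, 1), ((z - lam) ^ n)⁻¹ * ((z - lam) ^ m * g z)) =
      ∮ z in C(lam, 1), (z - lam) ^ (m - n) * g z := by
    refine circleIntegral.integral_congr zero_le_one fun z hz => ?_
    have h0 := sub_ne_zero_of_mem_sphere hz
    have : (z - lam) ^ m = (z - lam) ^ n * (z - lam) ^ (m - n) := by
      rw [← pow_add, Nat.add_sub_cancel' hnm]
    rw [this]
    field_simp
  rw [circleCoeff, h1, DiffContOnCl.circleIntegral_eq_zero zero_le_one, mul_zero]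
  exact (Differentiable.mul (by fun_prop) hg).diffContOnCl

lemma circleCoeff_zero (hh : Differentiable ℂ h) : circleCoeff lam 0 h = 0 := by
  simpa only [pow_zero, one_mul] using circleCoeff_pow_mul_of_le (lam := lam) (n := 0) (m := 0) hh le_rfl

lemma circleCoeff_pow_mul_self (hg : Differentiable ℂ g) (m : ℕ) :
    circleCoeff lam (m + 1) (fun z => (z - lam) ^ m * g z) = g lam := by
  have h1 : (∮ z in C(lam, 1), ((z - lam) ^ (m + 1))⁻¹ * ((z - lam) ^ m * g z)) =
      ∮ z in C(lam, 1), (z - lam)⁻¹ • g z := by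
    refine circleIntegral.integral_congr zero_le_one fun z hz => ?_
    have h0 := sub_ne_zero_of_mem_sphere hz
    simp only [smul_eq_mul]
    field_simp
    ring
  have h2 := hg.diffContOnCl.two_pi_i_inv_smul_circleIntegral_sub_inv_smul
    (mem_ball_self (zero_lt_one' ℝ) : lam ∈ ball lam 1)
  rw [circleCoeff, h1]
  exact h2

lemma circleCoeff_one (hh : Differentiable ℂ h) : circleCoeff lam 1 h = h lam := by
  simpa only [pow_zero, one_mul, zero_add] using circleCoeff_pow_mul_self (lam := lam) hh 0

variable {K : ℂ → ℝ → ℂ} {q : ℝ → ℂ}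

/-- The weight that turns `circleCoeff` into an integral over an interval. -/
def circleWeight (n : ℕ) (θ : ℝ) : ℂ :=
  (2 * π * I)⁻¹ * (circleMap 0 1 θ * I * ((circleMap 0 1 θ) ^ n)⁻¹)

lemma continuous_circleWeight : Continuous (circleWeight n) := by
  refine continuous_const.mul (Continuous.mul (by fun_prop) (Continuous.inv₀ (by fun_prop) ?_))
  intro θ
  exact pow_ne_zero _ (circleMap_ne_center one_ne_zero)

lemma circleCoeff_eq_integral :
    circleCoeff lam n h = ∫ θ in (0 : ℝ)..2 * π, circleWeight n θ * h (circleMap lam 1 θ) := by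
  rw [circleCoeff, circleIntegral, ← intervalIntegral.integral_const_mul]
  refine intervalIntegral.integral_congr fun θ _ => ?_
  simp only [deriv_circleMap, circleWeight, smul_eq_mul, circleMap_sub_center]
  ring

lemma continuous_circleCoeff (hK : Continuous fun p : ℂ × ℝ => K p.1 p.2) :
    Continuous fun x => circleCoeff lam n fun z => K z x := by
  simp only [circleCoeff_eq_integral]
  refine intervalIntegral.continuous_parametric_intervalIntegral_of_continuous' ?_ 0 (2 * π)
  refine Continuous.mul (continuous_circleWeight.comp continuous_snd) ?_
  exact hK.comp (((continuous_circleMap lam 1).comp continuous_snd).prodMk continuous_fst)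

/-- Fubini's theorem, with a continuous kernel bounded on a compact rectangle and an integrable `q`.
-/
lemma circleCoeff_integral (hK : Continuous fun p : ℂ × ℝ => K p.1 p.2) {a b : ℝ}
    (hq : IntervalIntegrable q volume a b) :
    circleCoeff lam n (fun z => ∫ t in a..b, K z t * q t) =
      ∫ t in a..b, circleCoeff lam n (fun z => K z t) * q t := by
  simp only [circleCoeff_eq_integral, ← intervalIntegral.integral_mul_const,
    ← intervalIntegral.integral_const_mul]
  rw [intervalIntegral_intervalIntegral_swap]
  · refine intervalIntegral.integral_congr fun t _ => ?_
    refine intervalIntegral.integral_congr fun θ _ => ?_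
    ring
  · have hc : Continuous fun p : ℝ × ℝ => circleWeight n p.1 * K (circleMap lam 1 p.1) p.2 :=
      (continuous_circleWeight.comp continuous_fst).mul
        (hK.comp (((continuous_circleMap lam 1).comp continuous_fst).prodMk continuous_snd))
    obtain ⟨B, hB⟩ := ((isCompact_uIcc (a := (0 : ℝ)) (b := 2 * π)).prod
      (isCompact_uIcc (a := a) (b := b))).exists_bound_of_continuousOn hc.continuousOn
    have hq' : IntegrableOn (fun p : ℝ × ℝ => q p.2) (uIoc 0 (2 * π) ×ˢ uIoc a b) := by
      rw [IntegrableOn, Measure.volume_eq_prod, ← Measure.prod_restrict]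
      have : IsFiniteMeasure (volume.restrict (uIoc 0 (2 * π))) := by
        rw [uIoc_of_le (by positivity)]
        infer_instance
      exact hq.def'.comp_snd _
    have h1 : IntegrableOn (fun p : ℝ × ℝ => circleWeight n p.1 * K (circleMap lam 1 p.1) p.2 * q p.2)
        (uIoc 0 (2 * π) ×ˢ uIoc a b) := by
      refine Integrable.bdd_mul (c := B) hq' hc.aestronglyMeasurable ?_
      refine (ae_restrict_iff' (measurableSet_uIoc.prod measurableSet_uIoc)).2
        (Eventually.of_forall fun p hp => hB p ⟨uIoc_subset_uIcc hp.1, uIoc_subset_uIcc hp.2⟩)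
    refine h1.congr_fun (fun p _ => ?_) (measurableSet_uIoc.prod measurableSet_uIoc)
    simp only [Function.uncurry]
    ring

end circleCoeff

/-! ### An entire family of solutions of the differential equations -/

section edge
variable (q : ℝ → ℂ) (a b : ℂ → ℂ)

/-- The integral of `C S q` over `[0, x]`. -/
def intCS (z : ℂ) (x : ℝ) : ℂ := ∫ t in (0 : ℝ)..x, solC z t * solS z t * q t

/-- The integral of `S ^ 2 q` over `[0, x]`. -/
def intSS (z : ℂ) (x : ℝ) : ℂ := ∫ t in (0 : ℝ)..x, solS z t ^ 2 * q t

/-- The solution `y` of `-y'' + q S = z y` with `y 0 = a z` and `y' 0 = b z`. -/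
def edgeU (z : ℂ) (x : ℝ) : ℂ :=
  solS z x * (b z + intCS q z x) + solC z x * (a z - intSS q z x)

/-- The derivative of `edgeU`. -/
def edgeP (z : ℂ) (x : ℝ) : ℂ :=
  solC z x * (b z + intCS q z x) - z * solS z x * (a z - intSS q z x)

variable {q a b}

lemma continuous_intCS (hq : ∀ a b, IntervalIntegrable q volume a b) :
    Continuous fun p : ℂ × ℝ => intCS q p.1 p.2 :=
  continuous_integral_mul (K := fun z t => solC z t * solS z t)
    (continuous_solC.mul continuous_solS) hq

lemma continuous_intSS (hq : ∀ a b, IntervalIntegrable q volume a b) :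
    Continuous fun p : ℂ × ℝ => intSS q p.1 p.2 :=
  continuous_integral_mul (K := fun z t => solS z t ^ 2) (continuous_solS.pow 2) hq

lemma differentiable_intCS (hq : ∀ a b, IntervalIntegrable q volume a b) (x : ℝ) :
    Differentiable ℂ fun z => intCS q z x :=
  differentiable_integral_mul (K := fun z t => solC z t * solS z t)
    (continuous_solC.mul continuous_solS)
    (fun t => (differentiable_solC t).mul (differentiable_solS t)) (hq 0 x)

lemma differentiable_intSS (hq : ∀ a b, IntervalIntegrable q volume a b) (x : ℝ) :
    Differentiable ℂ fun z => intSS q z x :=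
  differentiable_integral_mul (K := fun z t => solS z t ^ 2) (continuous_solS.pow 2)
    (fun t => (differentiable_solS t).pow 2) (hq 0 x)

lemma continuous_edgeU (hq : ∀ a b, IntervalIntegrable q volume a b) (ha : Continuous a)
    (hb : Continuous b) : Continuous fun p : ℂ × ℝ => edgeU q a b p.1 p.2 :=
  (continuous_solS.mul ((hb.comp continuous_fst).add (continuous_intCS hq))).add
    (continuous_solC.mul ((ha.comp continuous_fst).sub (continuous_intSS hq)))

lemma continuous_edgeP (hq : ∀ a b, IntervalIntegrable q volume a b) (ha : Continuous a)
    (hb : Continuous b) : Continuous fun p : ℂ × ℝ => edgeP q a b p.1 p.2 :=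
  (continuous_solC.mul ((hb.comp continuous_fst).add (continuous_intCS hq))).sub
    ((continuous_fst.mul continuous_solS).mul
      ((ha.comp continuous_fst).sub (continuous_intSS hq)))

lemma differentiable_edgeU (hq : ∀ a b, IntervalIntegrable q volume a b) (ha : Differentiable ℂ a)
    (hb : Differentiable ℂ b) (x : ℝ) : Differentiable ℂ fun z => edgeU q a b z x :=
  ((differentiable_solS x).mul (hb.add (differentiable_intCS hq x))).add
    ((differentiable_solC x).mul (ha.sub (differentiable_intSS hq x)))

lemma differentiable_edgeP (hq : ∀ a b, IntervalIntegrable q volume a b) (ha : Differentiable ℂ a)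
    (hb : Differentiable ℂ b) (x : ℝ) : Differentiable ℂ fun z => edgeP q a b z x :=
  ((differentiable_solC x).mul (hb.add (differentiable_intCS hq x))).sub
    ((differentiable_id.mul (differentiable_solS x)).mul (ha.sub (differentiable_intSS hq x)))

@[simp] lemma edgeU_zero (z : ℂ) : edgeU q a b z 0 = a z := by simp [edgeU, intSS]

@[simp] lemma edgeP_zero (z : ℂ) : edgeP q a b z 0 = b z := by simp [edgeP, intCS]

lemma continuous_solC_right (z : ℂ) : Continuous (solC z) :=
  continuous_iff_continuousAt.2 fun x => (hasDerivAt_solC z x).continuousAt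

lemma continuous_solS_right (z : ℂ) : Continuous (solS z) :=
  continuous_iff_continuousAt.2 fun x => (hasDerivAt_solS z x).continuousAt

lemma absolutelyContinuousOnInterval_solC (z : ℂ) (x y : ℝ) :
    AbsolutelyContinuousOnInterval (solC z) x y :=
  absolutelyContinuousOnInterval_of_hasDerivWithinAt
    (fun x _ => (hasDerivAt_solC z x).hasDerivWithinAt)
    (continuous_const.mul (continuous_solS_right z)).continuousOn

lemma absolutelyContinuousOnInterval_solS (z : ℂ) (x y : ℝ) :
    AbsolutelyContinuousOnInterval (solS z) x y :=
  absolutelyContinuousOnInterval_of_hasDerivWithinAt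
    (fun x _ => (hasDerivAt_solS z x).hasDerivWithinAt) (continuous_solC_right z).continuousOn

lemma absolutelyContinuousOnInterval_const (c : ℂ) (x y : ℝ) :
    AbsolutelyContinuousOnInterval (fun _ : ℝ => c) x y :=
  absolutelyContinuousOnInterval_of_hasDerivWithinAt
    (fun x _ => (hasDerivAt_const x c).hasDerivWithinAt) continuousOn_const

/-- Variation of constants: the contributions of the two inner integrals to the derivative cancel.
The integral form is preferred because `q` is merely integrable, so the exceptional null set of a
pointwise equation could depend on `z`; integrals commute with `circleCoeff`. -/
lemma edgeU_eq_integral (hq : ∀ a b, IntervalIntegrable q volume a b) (ha : Continuous a)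
    (hb : Continuous b) (z : ℂ) (x : ℝ) :
    edgeU q a b z x = a z + ∫ t in (0 : ℝ)..x, edgeP q a b z t := by
  have hCS := intervalIntegrable_mul (K := fun z t => solC z t * solS z t)
    (continuous_solC.mul continuous_solS) (hq 0 x) z
  have hSS := intervalIntegrable_mul (K := fun z t => solS z t ^ 2) (continuous_solS.pow 2) (hq 0 x) z
  have hac1 : AbsolutelyContinuousOnInterval (fun x => b z + intCS q z x) 0 x :=
    (absolutelyContinuousOnInterval_const (b z) 0 x).add (absolutelyContinuousOnInterval_integral hCS)
  have hac2 : AbsolutelyContinuousOnInterval (fun x => a z - intSS q z x) 0 x :=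
    (absolutelyContinuousOnInterval_const (a z) 0 x).sub (absolutelyContinuousOnInterval_integral hSS)
  have h := sub_eq_integral_of_ae_hasDerivAt (f := fun x => edgeU q a b z x)
    (f' := fun x => edgeP q a b z x)
    (((absolutelyContinuousOnInterval_solS z 0 x).smul hac1).add
      ((absolutelyContinuousOnInterval_solC z 0 x).smul hac2))
    (((continuous_edgeP hq ha hb).comp (by fun_prop : Continuous fun x : ℝ => (z, x))).intervalIntegrable 0 x)
    (by
      filter_upwards [hCS.ae_hasDerivAt_integral, hSS.ae_hasDerivAt_integral] with t h1 h2 ht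
      have e1 := (h1 ht 0 left_mem_uIcc).const_add (b z)
      have e2 := (h2 ht 0 left_mem_uIcc).const_sub (a z)
      refine (((hasDerivAt_solS z t).mul e1).add ((hasDerivAt_solC z t).mul e2)).congr_deriv ?_
      rw [edgeP, intCS, intSS]
      ring)
  rw [← h, edgeU_zero]
  ring

lemma edgeP_eq_integral (hq : ∀ a b, IntervalIntegrable q volume a b) (ha : Continuous a)
    (hb : Continuous b) (z : ℂ) (x : ℝ) :
    edgeP q a b z x = b z + ∫ t in (0 : ℝ)..x, (solS z t * q t - z * edgeU q a b z t) := by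
  have hCS := intervalIntegrable_mul (K := fun z t => solC z t * solS z t)
    (continuous_solC.mul continuous_solS) (hq 0 x) z
  have hSS := intervalIntegrable_mul (K := fun z t => solS z t ^ 2) (continuous_solS.pow 2) (hq 0 x) z
  have hac1 : AbsolutelyContinuousOnInterval (fun x => b z + intCS q z x) 0 x :=
    (absolutelyContinuousOnInterval_const (b z) 0 x).add (absolutelyContinuousOnInterval_integral hCS)
  have hac2 : AbsolutelyContinuousOnInterval (fun x => a z - intSS q z x) 0 x :=
    (absolutelyContinuousOnInterval_const (a z) 0 x).sub (absolutelyContinuousOnInterval_integral hSS)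
  have h := sub_eq_integral_of_ae_hasDerivAt (f := fun x => edgeP q a b z x)
    (f' := fun x => solS z x * q x - z * edgeU q a b z x)
    (((absolutelyContinuousOnInterval_solC z 0 x).smul hac1).sub
      (((absolutelyContinuousOnInterval_solS z 0 x).const_smul z).smul hac2))
    ((intervalIntegrable_mul continuous_solS (hq 0 x) z).sub ((continuous_const.mul
      ((continuous_edgeU hq ha hb).comp (by fun_prop : Continuous fun x : ℝ => (z, x)))).intervalIntegrable 0 x))
    (by
      filter_upwards [hCS.ae_hasDerivAt_integral, hSS.ae_hasDerivAt_integral] with t h1 h2 ht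
      have e1 := (h1 ht 0 left_mem_uIcc).const_add (b z)
      have e2 := (h2 ht 0 left_mem_uIcc).const_sub (a z)
      refine (((hasDerivAt_solC z t).mul e1).sub
        (((hasDerivAt_solS z t).const_mul z).mul e2)).congr_deriv ?_
      rw [edgeU, intCS, intSS]
      -- Here the inner integrals contribute `(C² + z S²) S q = S q`, the forcing term.
      linear_combination (q t * solS z t) * solC_sq_add z t)
  rw [← h, edgeP_zero]
  ring

end edge

/-! ### Solutions of the differential equations on the graph -/

/-- The functions `u j` with derivatives `p j` solve the differential equations on the edges,
regardless of matching and boundary conditions. -/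
structure IsEdgeSol (q₂ q₃ : ℝ → ℂ) (lam : ℂ) (u p f : Fin 3 → ℝ → ℂ) : Prop where
  hasDeriv : ∀ j, ∀ x ∈ Icc (0 : ℝ) 1, HasDerivWithinAt (u j) (p j x) (Icc 0 1) x
  ac : ∀ j, AbsolutelyContinuousOnInterval (p j) 0 1
  ode : ∀ j, ∀ᵐ x ∂(volume.restrict (Ioo (0 : ℝ) 1)), ∃ w : ℂ, HasDerivAt (p j) w x ∧
    -w + potential q₂ q₃ j x * u 0 x - lam * u j x = f j x

lemma solves_one_iff {q₂ q₃ : ℝ → ℂ} {lam : ℂ} {u f : Fin 3 → ℝ → ℂ} :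
    Solves q₂ q₃ 1 lam u f ↔ ∃ p, IsEdgeSol q₂ q₃ lam u p f ∧
      (u 0 1 = u 1 0 ∧ u 0 1 = u 2 0 ∧ p 0 1 = p 1 0 + p 2 0) ∧ u 0 0 = 0 ∧ u 1 1 = 0 ∧ p 2 1 = 0 := by
  constructor
  · rintro ⟨p, h1, h2, h3, h4, h5, h6, -⟩
    exact ⟨p, ⟨h1, h2, h3⟩, h4, h5, h6 rfl⟩
  · rintro ⟨p, ⟨h1, h2, h3⟩, h4, h5, h6⟩
    exact ⟨p, h1, h2, h3, h4, h5, fun _ => h6, fun h => by norm_num at h⟩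

section
variable {q₂ q₃ : ℝ → ℂ} {lam : ℂ} {u p f u' p' f' : Fin 3 → ℝ → ℂ}

lemma IsEdgeSol.add (h : IsEdgeSol q₂ q₃ lam u p f) (h' : IsEdgeSol q₂ q₃ lam u' p' f') :
    IsEdgeSol q₂ q₃ lam (u + u') (p + p') (f + f') := by
  refine ⟨fun j x hx => (h.hasDeriv j x hx).add (h'.hasDeriv j x hx), fun j => (h.ac j).add (h'.ac j),
    fun j => ?_⟩
  filter_upwards [h.ode j, h'.ode j] with x ⟨w, hw, e⟩ ⟨w', hw', e'⟩
  refine ⟨w + w', hw.add hw', ?_⟩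
  simp only [Pi.add_apply]
  linear_combination e + e'

lemma IsEdgeSol.smul (h : IsEdgeSol q₂ q₃ lam u p f) (c : ℂ) :
    IsEdgeSol q₂ q₃ lam (c • u) (c • p) (c • f) := by
  refine ⟨fun j x hx => (h.hasDeriv j x hx).const_mul c, fun j => (h.ac j).const_smul c,
    fun j => ?_⟩
  filter_upwards [h.ode j] with x ⟨w, hw, e⟩
  refine ⟨c * w, hw.const_mul c, ?_⟩
  simp only [Pi.smul_apply, smul_eq_mul]
  linear_combination c * e

lemma IsEdgeSol.sub (h : IsEdgeSol q₂ q₃ lam u p f) (h' : IsEdgeSol q₂ q₃ lam u' p' f') :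
    IsEdgeSol q₂ q₃ lam (u - u') (p - p') (f - f') := by
  have := h.add (h'.smul (-1))
  simpa only [neg_smul, one_smul, ← sub_eq_add_neg] using this

lemma isEdgeSol_zero : IsEdgeSol q₂ q₃ lam 0 0 0 := by
  refine ⟨fun j x _ => hasDerivWithinAt_const _ _ _, fun j => absolutelyContinuousOnInterval_const 0 0 1,
    fun j => Eventually.of_forall fun x => ⟨0, hasDerivAt_const _ _, by simp⟩⟩

lemma IsEdgeSol.sum {U P F : ℕ → Fin 3 → ℝ → ℂ} (h : ∀ i, IsEdgeSol q₂ q₃ lam (U i) (P i) (F i))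
    (c : ℕ → ℂ) (m : ℕ) : IsEdgeSol q₂ q₃ lam (∑ i ∈ Finset.range m, c i • U i)
      (∑ i ∈ Finset.range m, c i • P i) (∑ i ∈ Finset.range m, c i • F i) := by
  induction m with
  | zero => simpa using isEdgeSol_zero
  | succ m ih =>
    simp only [Finset.sum_range_succ]
    exact ih.add ((h m).smul (c m))

lemma IsEdgeSol.congr (h : IsEdgeSol q₂ q₃ lam u p f)
    (hf : ∀ j, ∀ x ∈ Icc (0 : ℝ) 1, f j x = f' j x) : IsEdgeSol q₂ q₃ lam u p f' := by
  refine ⟨h.hasDeriv, h.ac, fun j => ?_⟩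
  filter_upwards [h.ode j, ae_restrict_mem measurableSet_Ioo] with x ⟨w, hw, e⟩ hx
  exact ⟨w, hw, e.trans (hf j x (Ioo_subset_Icc_self hx))⟩

/-- A solution of the homogeneous equations that vanishes with its derivative at the beginning of
the first edge and is continuous at the vertex. -/
lemma IsEdgeSol.eq_of_zero_data (h : IsEdgeSol q₂ q₃ lam u p 0) (h0 : u 0 0 = 0) (hp0 : p 0 0 = 0)
    (h1 : u 0 1 = u 1 0) (h2 : u 0 1 = u 2 0) (h3 : p 0 1 = p 1 0 + p 2 0) :
    ∀ x ∈ Icc (0 : ℝ) 1, u 0 x = 0 ∧ u 1 x = -p 2 0 * solS lam x ∧ u 2 x = p 2 0 * solS lam x ∧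
      p 2 x = p 2 0 * solC lam x := by
  have e0 : ∀ x ∈ Icc (0 : ℝ) 1, u 0 x = 0 ∧ p 0 x = 0 := fun x hx => by
    have := eq_solC_add_solS (h.hasDeriv 0) (h.ac 0) (by
      filter_upwards [h.ode 0] with x ⟨w, hw, e⟩
      refine hw.congr_deriv ?_
      simp only [potential, Matrix.cons_val_zero, Pi.zero_apply] at e
      linear_combination -e) hx
    rw [h0, hp0] at this
    simpa using this
  have hj : ∀ j, ∀ᵐ x ∂(volume.restrict (Ioo (0 : ℝ) 1)), HasDerivAt (p j) (-lam * u j x) x := by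
    intro j
    filter_upwards [h.ode j, ae_restrict_mem measurableSet_Ioo] with x ⟨w, hw, e⟩ hx
    refine hw.congr_deriv ?_
    rw [(e0 x (Ioo_subset_Icc_self hx)).1] at e
    simp only [Pi.zero_apply] at e
    linear_combination -e
  have h01 : (1 : ℝ) ∈ Icc (0 : ℝ) 1 := ⟨zero_le_one, le_rfl⟩
  rw [(e0 1 h01).1] at h1 h2
  rw [(e0 1 h01).2] at h3
  intro x hx
  have e1 := eq_solC_add_solS (h.hasDeriv 1) (h.ac 1) (hj 1) hx
  have e2 := eq_solC_add_solS (h.hasDeriv 2) (h.ac 2) (hj 2) hx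
  rw [← h1] at e1
  rw [← h2] at e2
  refine ⟨(e0 x hx).1, ?_, ?_, ?_⟩
  · rw [e1.1]
    linear_combination -(solS lam x) * h3
  · rw [e2.1]; ring
  · rw [e2.2]; ring
end

/-! ### The characteristic function -/

section char
variable (q₂ q₃ : ℝ → ℂ)

/-- The value at the end of the second edge of the solution with free parameter on the third edge
equal to zero. -/
def charAlpha (z : ℂ) : ℂ := edgeU q₂ (fun z => solS z 1) (fun z => solC z 1) z 1

/-- The derivative at the end of the third edge of the solution with zero free parameter. -/
def charBeta (z : ℂ) : ℂ := edgeP q₃ (fun z => solS z 1) (fun _ => 0) z 1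

/-- The characteristic function of the problem with `k = 1`. -/
def charDelta (z : ℂ) : ℂ := solC z 1 * charAlpha q₂ z + solS z 1 * charBeta q₃ z

/-- The derivative at the beginning of the third edge of the members of the entire family of
solutions `familyU`. -/
def familyB (z : ℂ) : ℂ := z * solS z 1 * charAlpha q₂ z - solC z 1 * charBeta q₃ z

/-- An entire family of solutions that satisfy the matching conditions and the boundary conditions
up to multiples of the characteristic function. -/
def familyU : Fin 3 → ℂ → ℝ → ℂ :=
  ![solS, edgeU q₂ (fun z => solS z 1) (fun z => solC z 1 - familyB q₂ q₃ z),
    edgeU q₃ (fun z => solS z 1) (familyB q₂ q₃)]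

/-- The derivatives of the members of `familyU`. -/
def familyP : Fin 3 → ℂ → ℝ → ℂ :=
  ![solC, edgeP q₂ (fun z => solS z 1) (fun z => solC z 1 - familyB q₂ q₃ z),
    edgeP q₃ (fun z => solS z 1) (familyB q₂ q₃)]

variable {q₂ q₃}

lemma differentiable_charAlpha (h₂ : ∀ a b, IntervalIntegrable q₂ volume a b) :
    Differentiable ℂ (charAlpha q₂) :=
  differentiable_edgeU h₂ (differentiable_solS 1) (differentiable_solC 1) 1

lemma differentiable_charBeta (h₃ : ∀ a b, IntervalIntegrable q₃ volume a b) :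
    Differentiable ℂ (charBeta q₃) :=
  differentiable_edgeP h₃ (differentiable_solS 1) (differentiable_const 0) 1

lemma differentiable_charDelta (h₂ : ∀ a b, IntervalIntegrable q₂ volume a b)
    (h₃ : ∀ a b, IntervalIntegrable q₃ volume a b) : Differentiable ℂ (charDelta q₂ q₃) :=
  ((differentiable_solC 1).mul (differentiable_charAlpha h₂)).add
    ((differentiable_solS 1).mul (differentiable_charBeta h₃))

lemma differentiable_familyB (h₂ : ∀ a b, IntervalIntegrable q₂ volume a b)
    (h₃ : ∀ a b, IntervalIntegrable q₃ volume a b) : Differentiable ℂ (familyB q₂ q₃) :=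
  ((differentiable_id.mul (differentiable_solS 1)).mul (differentiable_charAlpha h₂)).sub
    ((differentiable_solC 1).mul (differentiable_charBeta h₃))

lemma forall_fin_three {p : Fin 3 → Prop} (h0 : p 0) (h1 : p 1) (h2 : p 2) : ∀ j, p j := by
  intro j
  fin_cases j
  exacts [h0, h1, h2]

lemma familyU_one : familyU q₂ q₃ 1 =
    edgeU q₂ (fun z => solS z 1) (fun z => solC z 1 - familyB q₂ q₃ z) := rfl

lemma familyU_two : familyU q₂ q₃ 2 = edgeU q₃ (fun z => solS z 1) (familyB q₂ q₃) := rfl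

lemma familyP_one : familyP q₂ q₃ 1 =
    edgeP q₂ (fun z => solS z 1) (fun z => solC z 1 - familyB q₂ q₃ z) := rfl

lemma familyP_two : familyP q₂ q₃ 2 = edgeP q₃ (fun z => solS z 1) (familyB q₂ q₃) := rfl

lemma continuous_familyU (h₂ : ∀ a b, IntervalIntegrable q₂ volume a b)
    (h₃ : ∀ a b, IntervalIntegrable q₃ volume a b) :
    ∀ j, Continuous fun p : ℂ × ℝ => familyU q₂ q₃ j p.1 p.2 :=
  have hB := (differentiable_familyB h₂ h₃).continuous
  forall_fin_three continuous_solS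
    (continuous_edgeU h₂ (differentiable_solS 1).continuous
      ((differentiable_solC 1).continuous.sub hB))
    (continuous_edgeU h₃ (differentiable_solS 1).continuous hB)

lemma continuous_familyP (h₂ : ∀ a b, IntervalIntegrable q₂ volume a b)
    (h₃ : ∀ a b, IntervalIntegrable q₃ volume a b) :
    ∀ j, Continuous fun p : ℂ × ℝ => familyP q₂ q₃ j p.1 p.2 :=
  have hB := (differentiable_familyB h₂ h₃).continuous
  forall_fin_three continuous_solC
    (continuous_edgeP h₂ (differentiable_solS 1).continuous
      ((differentiable_solC 1).continuous.sub hB))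
    (continuous_edgeP h₃ (differentiable_solS 1).continuous hB)

lemma differentiable_familyU (h₂ : ∀ a b, IntervalIntegrable q₂ volume a b)
    (h₃ : ∀ a b, IntervalIntegrable q₃ volume a b) (x : ℝ) :
    ∀ j, Differentiable ℂ fun z => familyU q₂ q₃ j z x :=
  have hB := differentiable_familyB h₂ h₃
  forall_fin_three (differentiable_solS x)
    (differentiable_edgeU h₂ (differentiable_solS 1) ((differentiable_solC 1).sub hB) x)
    (differentiable_edgeU h₃ (differentiable_solS 1) hB x)

lemma differentiable_familyP (h₂ : ∀ a b, IntervalIntegrable q₂ volume a b)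
    (h₃ : ∀ a b, IntervalIntegrable q₃ volume a b) (x : ℝ) :
    ∀ j, Differentiable ℂ fun z => familyP q₂ q₃ j z x :=
  have hB := differentiable_familyB h₂ h₃
  forall_fin_three (differentiable_solC x)
    (differentiable_edgeP h₂ (differentiable_solS 1) ((differentiable_solC 1).sub hB) x)
    (differentiable_edgeP h₃ (differentiable_solS 1) hB x)

lemma intervalIntegrable_potential (h₂ : ∀ a b, IntervalIntegrable q₂ volume a b)
    (h₃ : ∀ a b, IntervalIntegrable q₃ volume a b) :
    ∀ j a b, IntervalIntegrable (potential q₂ q₃ j) volume a b :=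
  forall_fin_three (fun a b => (continuous_zero (X := ℝ) (M := ℂ)).intervalIntegrable a b) h₂ h₃

lemma familyU_eq_integral (h₂ : ∀ a b, IntervalIntegrable q₂ volume a b)
    (h₃ : ∀ a b, IntervalIntegrable q₃ volume a b) (z : ℂ) (x : ℝ) :
    ∀ j, familyU q₂ q₃ j z x =
      familyU q₂ q₃ j z 0 + ∫ t in (0 : ℝ)..x, familyP q₂ q₃ j z t := by
  have hB := (differentiable_familyB h₂ h₃).continuous
  have hS := (differentiable_solS 1).continuous
  have hC := (differentiable_solC 1).continuous
  refine forall_fin_three ?_ ?_ ?_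
  · change solS z x = solS z 0 + ∫ t in (0 : ℝ)..x, solC z t
    rw [intervalIntegral.integral_eq_sub_of_hasDerivAt (fun t _ => hasDerivAt_solS z t)
      ((continuous_solC_right z).intervalIntegrable 0 x)]
    ring
  · rw [familyU_one, familyP_one, edgeU_zero]
    exact edgeU_eq_integral h₂ hS (hC.sub hB) z x
  · rw [familyU_two, familyP_two, edgeU_zero]
    exact edgeU_eq_integral h₃ hS hB z x

lemma familyP_eq_integral (h₂ : ∀ a b, IntervalIntegrable q₂ volume a b)
    (h₃ : ∀ a b, IntervalIntegrable q₃ volume a b) (z : ℂ) (x : ℝ) :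
    ∀ j, familyP q₂ q₃ j z x = familyP q₂ q₃ j z 0 +
      ((∫ t in (0 : ℝ)..x, familyU q₂ q₃ 0 z t * potential q₂ q₃ j t) -
        z * ∫ t in (0 : ℝ)..x, familyU q₂ q₃ j z t) := by
  have hB := (differentiable_familyB h₂ h₃).continuous
  have hS := (differentiable_solS 1).continuous
  have hC := (differentiable_solC 1).continuous
  have hU : ∀ j, IntervalIntegrable (fun t => z * familyU q₂ q₃ j z t) volume 0 x := fun j =>
    (continuous_const.mul ((continuous_familyU h₂ h₃ j).comp
      (by fun_prop : Continuous fun x : ℝ => (z, x)))).intervalIntegrable 0 x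
  have hq : ∀ j, IntervalIntegrable (fun t => familyU q₂ q₃ 0 z t * potential q₂ q₃ j t) volume 0 x :=
    fun j => intervalIntegrable_mul (K := familyU q₂ q₃ 0) (continuous_familyU h₂ h₃ 0)
      (intervalIntegrable_potential h₂ h₃ j 0 x) z
  intro j
  rw [← intervalIntegral.integral_const_mul, ← intervalIntegral.integral_sub (hq j) (hU j)]
  revert j
  refine forall_fin_three ?_ ?_ ?_
  · change solC z x = solC z 0 + ∫ t in (0 : ℝ)..x, (solS z t * 0 - z * solS z t)
    have h : ∀ t ∈ uIcc 0 x, HasDerivAt (solC z) (solS z t * 0 - z * solS z t) t := fun t _ =>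
      (hasDerivAt_solC z t).congr_deriv (by ring)
    rw [intervalIntegral.integral_eq_sub_of_hasDerivAt h]
    · ring
    · exact (((continuous_solS_right z).mul continuous_const).sub
        (continuous_const.mul (continuous_solS_right z))).intervalIntegrable 0 x
  · rw [familyU_one, familyP_one, edgeP_zero]
    exact edgeP_eq_integral h₂ hS (hC.sub hB) z x
  · rw [familyU_two, familyP_two, edgeP_zero]
    exact edgeP_eq_integral h₃ hS hB z x

/-- If the third edge starts with derivative `B`, the end values are `α - B S` and `β + B C`, with
`α = charAlpha q₂ z` and `β = charBeta q₃ z`. The choice `B = z S α - C β` makes them the multiples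
`C Δ` and `z S Δ` of `Δ = C α + S β`, because `C² + z S² = 1`. -/
lemma familyU_one_one (z : ℂ) : familyU q₂ q₃ 1 z 1 = solC z 1 * charDelta q₂ q₃ z := by
  have h1 : familyU q₂ q₃ 1 z 1 = charAlpha q₂ z - familyB q₂ q₃ z * solS z 1 := by
    rw [familyU_one, charAlpha, edgeU, edgeU]
    ring
  rw [h1, familyB, charDelta]
  linear_combination -(charAlpha q₂ z) * solC_sq_add z 1

lemma familyP_two_one (z : ℂ) : familyP q₂ q₃ 2 z 1 = z * solS z 1 * charDelta q₂ q₃ z := by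
  have h1 : familyP q₂ q₃ 2 z 1 = charBeta q₃ z + familyB q₂ q₃ z * solC z 1 := by
    rw [familyP_two, charBeta, edgeP, edgeP]
    ring
  rw [h1, familyB, charDelta]
  linear_combination -(charBeta q₃ z) * solC_sq_add z 1

/-! ### The chain of associated functions -/

variable (q₂ q₃) (lam : ℂ)

/-- The coefficients of `familyU`; `chainU 0` vanishes and `chainU 1, chainU 2, …` form a chain. -/
def chainU (n : ℕ) (j : Fin 3) (x : ℝ) : ℂ := circleCoeff lam n fun z => familyU q₂ q₃ j z x

/-- The derivatives of `chainU`. -/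
def chainP (n : ℕ) (j : Fin 3) (x : ℝ) : ℂ := circleCoeff lam n fun z => familyP q₂ q₃ j z x

variable {q₂ q₃}

lemma chainU_zero (h₂ : ∀ a b, IntervalIntegrable q₂ volume a b)
    (h₃ : ∀ a b, IntervalIntegrable q₃ volume a b) : chainU q₂ q₃ lam 0 = 0 := by
  funext j x
  exact circleCoeff_zero (differentiable_familyU h₂ h₃ x j)

lemma continuous_chainU (h₂ : ∀ a b, IntervalIntegrable q₂ volume a b)
    (h₃ : ∀ a b, IntervalIntegrable q₃ volume a b) (n : ℕ) (j : Fin 3) :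
    Continuous (chainU q₂ q₃ lam n j) :=
  continuous_circleCoeff (K := familyU q₂ q₃ j) (continuous_familyU h₂ h₃ j)

lemma continuous_chainP (h₂ : ∀ a b, IntervalIntegrable q₂ volume a b)
    (h₃ : ∀ a b, IntervalIntegrable q₃ volume a b) (n : ℕ) (j : Fin 3) :
    Continuous (chainP q₂ q₃ lam n j) :=
  continuous_circleCoeff (K := familyP q₂ q₃ j) (continuous_familyP h₂ h₃ j)

lemma continuous_integral_familyU (h₂ : ∀ a b, IntervalIntegrable q₂ volume a b)
    (h₃ : ∀ a b, IntervalIntegrable q₃ volume a b) (j : Fin 3) {w : ℝ → ℂ}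
    (hw : ∀ a b, IntervalIntegrable w volume a b) (x : ℝ) :
    Continuous fun z => ∫ t in (0 : ℝ)..x, familyU q₂ q₃ j z t * w t :=
  (continuous_integral_mul (K := familyU q₂ q₃ j) (continuous_familyU h₂ h₃ j) hw).comp
    (by fun_prop : Continuous fun z : ℂ => (z, x))

lemma intervalIntegrable_one (a b : ℝ) : IntervalIntegrable (fun _ : ℝ => (1 : ℂ)) volume a b :=
  continuous_const.intervalIntegrable a b

lemma chainU_eq_integral (h₂ : ∀ a b, IntervalIntegrable q₂ volume a b)
    (h₃ : ∀ a b, IntervalIntegrable q₃ volume a b) (n : ℕ) (j : Fin 3) (x : ℝ) :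
    chainU q₂ q₃ lam n j x = chainU q₂ q₃ lam n j 0 + ∫ t in (0 : ℝ)..x, chainP q₂ q₃ lam n j t := by
  have h1 := circleCoeff_integral (lam := lam) (n := n) (K := familyP q₂ q₃ j)
    (continuous_familyP h₂ h₃ j) (intervalIntegrable_one 0 x)
  have hc := (continuous_integral_mul (K := familyP q₂ q₃ j) (continuous_familyP h₂ h₃ j)
    intervalIntegrable_one).comp (by fun_prop : Continuous fun z : ℂ => (z, x))
  simp only [mul_one, Function.comp_def] at h1 hc
  rw [chainU, funext fun z => familyU_eq_integral h₂ h₃ z x j,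
    circleCoeff_add (differentiable_familyU h₂ h₃ 0 j).continuous hc, h1]
  rfl

/-- Taking coefficients in the integrated equation, the factor `z` produces `lam` times the current
function plus the preceding one, by `circleCoeff_id_mul`. -/
lemma chainP_eq_integral (h₂ : ∀ a b, IntervalIntegrable q₂ volume a b)
    (h₃ : ∀ a b, IntervalIntegrable q₃ volume a b) (n : ℕ) (j : Fin 3) (x : ℝ) :
    chainP q₂ q₃ lam (n + 1) j x = chainP q₂ q₃ lam (n + 1) j 0 + ∫ t in (0 : ℝ)..x,
      (potential q₂ q₃ j t * chainU q₂ q₃ lam (n + 1) 0 t - lam * chainU q₂ q₃ lam (n + 1) j t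
        - chainU q₂ q₃ lam n j t) := by
  have hpot := intervalIntegrable_potential h₂ h₃ j
  have h1 := fun k => circleCoeff_integral (lam := lam) (n := k) (K := familyU q₂ q₃ j)
    (continuous_familyU h₂ h₃ j) (intervalIntegrable_one 0 x)
  have h2 := circleCoeff_integral (lam := lam) (n := n + 1) (K := familyU q₂ q₃ 0)
    (continuous_familyU h₂ h₃ 0) (hpot 0 x)
  have hc1 := continuous_integral_familyU h₂ h₃ j intervalIntegrable_one x
  have hc2 := continuous_integral_familyU h₂ h₃ 0 hpot x
  simp only [mul_one] at h1 hc1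
  have hc3 : Continuous fun z => z * ∫ t in (0 : ℝ)..x, familyU q₂ q₃ j z t :=
    continuous_id.mul hc1
  have hc4 : Continuous fun z => (∫ t in (0 : ℝ)..x, familyU q₂ q₃ 0 z t * potential q₂ q₃ j t) -
      z * ∫ t in (0 : ℝ)..x, familyU q₂ q₃ j z t := hc2.sub hc3
  have hi : ∀ k, IntervalIntegrable (chainU q₂ q₃ lam k j) volume 0 x := fun k =>
    (continuous_chainU lam h₂ h₃ k j).intervalIntegrable 0 x
  have hi2 : IntervalIntegrable (fun t => potential q₂ q₃ j t * chainU q₂ q₃ lam (n + 1) 0 t)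
      volume 0 x := (hpot 0 x).mul_continuousOn (continuous_chainU lam h₂ h₃ (n + 1) 0).continuousOn
  rw [intervalIntegral.integral_sub (hi2.sub ((hi (n + 1)).const_mul lam)) (hi n),
    intervalIntegral.integral_sub hi2 ((hi (n + 1)).const_mul lam),
    intervalIntegral.integral_const_mul]
  rw [chainP, funext fun z => familyP_eq_integral h₂ h₃ z x j,
    circleCoeff_add (differentiable_familyP h₂ h₃ 0 j).continuous
      hc4, circleCoeff_sub hc2 hc3, circleCoeff_id_mul hc1, h1, h1, h2]
  simp only [mul_comm (potential q₂ q₃ j _)]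
  simp only [chainU, chainP]
  ring

lemma hasDerivAt_chainU (h₂ : ∀ a b, IntervalIntegrable q₂ volume a b)
    (h₃ : ∀ a b, IntervalIntegrable q₃ volume a b) (n : ℕ) (j : Fin 3) (x : ℝ) :
    HasDerivAt (chainU q₂ q₃ lam n j) (chainP q₂ q₃ lam n j x) x := by
  rw [funext fun x => chainU_eq_integral lam h₂ h₃ n j x]
  have hc := continuous_chainP lam h₂ h₃ n j
  exact (intervalIntegral.integral_hasDerivAt_right (hc.intervalIntegrable 0 x)
    hc.stronglyMeasurable.stronglyMeasurableAtFilter hc.continuousAt).const_add _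

lemma hasDerivAt_chainP_zero (h₂ : ∀ a b, IntervalIntegrable q₂ volume a b)
    (h₃ : ∀ a b, IntervalIntegrable q₃ volume a b) (n : ℕ) (x : ℝ) :
    HasDerivAt (chainP q₂ q₃ lam (n + 1) 0)
      (-lam * chainU q₂ q₃ lam (n + 1) 0 x - chainU q₂ q₃ lam n 0 x) x := by
  rw [funext fun x => chainP_eq_integral lam h₂ h₃ n 0 x]
  have h1 : (fun t => potential q₂ q₃ 0 t * chainU q₂ q₃ lam (n + 1) 0 t -
      lam * chainU q₂ q₃ lam (n + 1) 0 t - chainU q₂ q₃ lam n 0 t) =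
      fun t => -lam * chainU q₂ q₃ lam (n + 1) 0 t - chainU q₂ q₃ lam n 0 t := by
    funext t
    simp only [potential, Matrix.cons_val_zero, Pi.zero_apply]
    ring
  rw [h1]
  have hc : Continuous fun t => -lam * chainU q₂ q₃ lam (n + 1) 0 t - chainU q₂ q₃ lam n 0 t :=
    (continuous_const.mul (continuous_chainU lam h₂ h₃ (n + 1) 0)).sub
      (continuous_chainU lam h₂ h₃ n 0)
  exact (intervalIntegral.integral_hasDerivAt_right (hc.intervalIntegrable 0 x)
    hc.stronglyMeasurable.stronglyMeasurableAtFilter hc.continuousAt).const_add _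

lemma isEdgeSol_chain (h₂ : ∀ a b, IntervalIntegrable q₂ volume a b)
    (h₃ : ∀ a b, IntervalIntegrable q₃ volume a b) (n : ℕ) :
    IsEdgeSol q₂ q₃ lam (chainU q₂ q₃ lam (n + 1)) (chainP q₂ q₃ lam (n + 1))
      (chainU q₂ q₃ lam n) := by
  have hi : ∀ j, IntervalIntegrable (fun t => potential q₂ q₃ j t * chainU q₂ q₃ lam (n + 1) 0 t -
      lam * chainU q₂ q₃ lam (n + 1) j t - chainU q₂ q₃ lam n j t) volume 0 1 := fun j =>
    ((((intervalIntegrable_potential h₂ h₃ j 0 1)).mul_continuousOn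
      (continuous_chainU lam h₂ h₃ (n + 1) 0).continuousOn).sub
      ((continuous_const.mul (continuous_chainU lam h₂ h₃ (n + 1) j)).intervalIntegrable 0 1)).sub
      ((continuous_chainU lam h₂ h₃ n j).intervalIntegrable 0 1)
  refine ⟨fun j x _ => (hasDerivAt_chainU lam h₂ h₃ (n + 1) j x).hasDerivWithinAt, fun j => ?_,
    fun j => ?_⟩
  · rw [funext fun x => chainP_eq_integral lam h₂ h₃ n j x]
    exact (absolutelyContinuousOnInterval_const _ 0 1).add
      (absolutelyContinuousOnInterval_integral (hi j))
  · rw [ae_restrict_iff' measurableSet_Ioo]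
    filter_upwards [(hi j).ae_hasDerivAt_integral] with x hx hxm
    have hxm' : x ∈ uIcc (0 : ℝ) 1 := by
      rw [uIcc_of_le zero_le_one]
      exact Ioo_subset_Icc_self hxm
    refine ⟨potential q₂ q₃ j x * chainU q₂ q₃ lam (n + 1) 0 x -
      lam * chainU q₂ q₃ lam (n + 1) j x - chainU q₂ q₃ lam n j x, ?_, ?_⟩
    · rw [funext fun x => chainP_eq_integral lam h₂ h₃ n j x]
      exact (hx hxm' 0 left_mem_uIcc).const_add _
    · ring

end char

/-! ### Root subspaces -/

section root
variable {q₂ q₃ : ℝ → ℂ} {lam : ℂ}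

lemma chainU_zero_zero (n : ℕ) : chainU q₂ q₃ lam n 0 0 = 0 := by
  have h : (fun z => familyU q₂ q₃ 0 z 0) = fun z : ℂ => (0 : ℂ) * (0 : ℂ → ℂ) z :=
    funext fun z => by rw [zero_mul]; exact solS_zero z
  rw [chainU, h, circleCoeff_const_mul, zero_mul]

lemma chainU_matching (h₂ : ∀ a b, IntervalIntegrable q₂ volume a b)
    (h₃ : ∀ a b, IntervalIntegrable q₃ volume a b) (n : ℕ) :
    chainU q₂ q₃ lam n 0 1 = chainU q₂ q₃ lam n 1 0 ∧
      chainU q₂ q₃ lam n 0 1 = chainU q₂ q₃ lam n 2 0 ∧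
      chainP q₂ q₃ lam n 0 1 = chainP q₂ q₃ lam n 1 0 + chainP q₂ q₃ lam n 2 0 := by
  refine ⟨?_, ?_, ?_⟩
  · rw [chainU, chainU, familyU_one]
    simp only [edgeU_zero]
    rfl
  · rw [chainU, chainU, familyU_two]
    simp only [edgeU_zero]
    rfl
  · rw [chainP, chainP, chainP, ← circleCoeff_add (differentiable_familyP h₂ h₃ 0 1).continuous
      (differentiable_familyP h₂ h₃ 0 2).continuous, familyP_one, familyP_two]
    simp only [edgeP_zero, sub_add_cancel]
    rfl

lemma chain_end_of_le {m n : ℕ} {g : ℂ → ℂ} (hg : Differentiable ℂ g)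
    (hΔ : ∀ z, charDelta q₂ q₃ z = (z - lam) ^ m * g z) (hn : n ≤ m) :
    chainU q₂ q₃ lam n 1 1 = 0 ∧ chainP q₂ q₃ lam n 2 1 = 0 := by
  constructor
  · have : (fun z => familyU q₂ q₃ 1 z 1) = fun z => (z - lam) ^ m * (solC z 1 * g z) :=
      funext fun z => by rw [familyU_one_one, hΔ]; ring
    rw [chainU, this]
    exact circleCoeff_pow_mul_of_le ((differentiable_solC 1).mul hg) hn
  · have : (fun z => familyP q₂ q₃ 2 z 1) = fun z => (z - lam) ^ m * (z * solS z 1 * g z) :=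
      funext fun z => by rw [familyP_two_one, hΔ]; ring
    rw [chainP, this]
    exact circleCoeff_pow_mul_of_le ((differentiable_id.mul (differentiable_solS 1)).mul hg) hn

/-- At this index the end conditions fail for the first time when `g lam ≠ 0`: `solC lam 1` and `lam
* solS lam 1` cannot both vanish. This obstruction stops the chain at length `m`. -/
lemma chain_end_succ {m : ℕ} {g : ℂ → ℂ} (hg : Differentiable ℂ g)
    (hΔ : ∀ z, charDelta q₂ q₃ z = (z - lam) ^ m * g z) :
    chainU q₂ q₃ lam (m + 1) 1 1 = solC lam 1 * g lam ∧
      chainP q₂ q₃ lam (m + 1) 2 1 = lam * solS lam 1 * g lam := by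
  constructor
  · have : (fun z => familyU q₂ q₃ 1 z 1) = fun z => (z - lam) ^ m * (solC z 1 * g z) :=
      funext fun z => by rw [familyU_one_one, hΔ]; ring
    rw [chainU, this]
    exact circleCoeff_pow_mul_self ((differentiable_solC 1).mul hg) m
  · have : (fun z => familyP q₂ q₃ 2 z 1) = fun z => (z - lam) ^ m * (z * solS z 1 * g z) :=
      funext fun z => by rw [familyP_two_one, hΔ]; ring
    rw [chainP, this]
    exact circleCoeff_pow_mul_self ((differentiable_id.mul (differentiable_solS 1)).mul hg) m

lemma isRootFunction_chain (h₂ : ∀ a b, IntervalIntegrable q₂ volume a b)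
    (h₃ : ∀ a b, IntervalIntegrable q₃ volume a b) {m : ℕ} {g : ℂ → ℂ} (hg : Differentiable ℂ g)
    (hΔ : ∀ z, charDelta q₂ q₃ z = (z - lam) ^ m * g z) {n : ℕ} (hn : n ≤ m) :
    IsRootFunction q₂ q₃ 1 lam n (chainU q₂ q₃ lam n) := by
  induction n with
  | zero =>
    intro j x _
    rw [chainU_zero lam h₂ h₃]
    rfl
  | succ n ih =>
    refine ⟨chainU q₂ q₃ lam n, ih (by omega), solves_one_iff.2 ⟨chainP q₂ q₃ lam (n + 1),
      isEdgeSol_chain lam h₂ h₃ n, chainU_matching h₂ h₃ _, chainU_zero_zero _,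
      chain_end_of_le hg hΔ hn⟩⟩

/-- A solution of the inhomogeneous problem whose right-hand side is a combination of the chain is
again a combination of the chain. -/
lemma exists_eq_sum_chain_of_solves (h₂ : ∀ a b, IntervalIntegrable q₂ volume a b)
    (h₃ : ∀ a b, IntervalIntegrable q₃ volume a b) {m : ℕ} {g : ℂ → ℂ} (hg : Differentiable ℂ g)
    (hg0 : g lam ≠ 0) (hΔ : ∀ z, charDelta q₂ q₃ z = (z - lam) ^ m * g z)
    {u f : Fin 3 → ℝ → ℂ} (hu : Solves q₂ q₃ 1 lam u f) {c : ℕ → ℂ}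
    (hf : ∀ j, ∀ x ∈ Icc (0 : ℝ) 1,
      f j x = ∑ i ∈ Finset.range m, c i * chainU q₂ q₃ lam (i + 1) j x) :
    ∃ c' : ℕ → ℂ, ∀ j, ∀ x ∈ Icc (0 : ℝ) 1,
      u j x = ∑ i ∈ Finset.range m, c' i * chainU q₂ q₃ lam (i + 1) j x := by
  obtain ⟨p, hsol, ⟨hm1, hm2, hm3⟩, hu0, hu1, hp2⟩ := solves_one_iff.1 hu
  set a : ℂ := p 0 0 - ∑ i ∈ Finset.range m, c i * chainP q₂ q₃ lam (i + 2) 0 0 with ha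
  -- Raising the indices of the combination `f` by one inverts `L - lam` on the edges. The
  -- additional multiple `a` of the first chain function, which solves the homogeneous equations
  -- with initial slope `1`, adjusts the initial slope to that of `u`.
  let c' : ℕ → ℂ := fun i => if i = 0 then a else c (i - 1)
  have hc' : ∀ F : ℕ → ℂ, ∑ i ∈ Finset.range (m + 1), c' i * F i =
      ∑ i ∈ Finset.range m, c i * F (i + 1) + a * F 0 := fun F => by
    rw [Finset.sum_range_succ']
    simp [c']
  set V : Fin 3 → ℝ → ℂ := ∑ i ∈ Finset.range (m + 1), c' i • chainU q₂ q₃ lam (i + 1) with hV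
  set r : Fin 3 → ℝ → ℂ := ∑ i ∈ Finset.range (m + 1), c' i • chainP q₂ q₃ lam (i + 1) with hr
  have hVx : ∀ j x, V j x = ∑ i ∈ Finset.range (m + 1), c' i * chainU q₂ q₃ lam (i + 1) j x := by
    intro j x
    simp [hV, Finset.sum_apply]
  have hrx : ∀ j x, r j x = ∑ i ∈ Finset.range (m + 1), c' i * chainP q₂ q₃ lam (i + 1) j x := by
    intro j x
    simp [hr, Finset.sum_apply]
  have hVsol : IsEdgeSol q₂ q₃ lam V r f := by
    refine (IsEdgeSol.sum (fun i => isEdgeSol_chain lam h₂ h₃ i) c' (m + 1)).congr fun j x hx => ?_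
    rw [hf j x hx]
    simp only [Finset.sum_apply, Pi.smul_apply, smul_eq_mul]
    rw [hc' fun i => chainU q₂ q₃ lam i j x, chainU_zero lam h₂ h₃]
    simp
  have hD : IsEdgeSol q₂ q₃ lam (u - V) (p - r) 0 := by
    have := hsol.sub hVsol
    rwa [sub_self] at this
  have hVm1 : V 0 1 = V 1 0 := by
    rw [hVx, hVx]
    exact Finset.sum_congr rfl fun i _ => by rw [(chainU_matching h₂ h₃ (i + 1)).1]
  have hVm2 : V 0 1 = V 2 0 := by
    rw [hVx, hVx]
    exact Finset.sum_congr rfl fun i _ => by rw [(chainU_matching h₂ h₃ (i + 1)).2.1]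
  have hVm3 : r 0 1 = r 1 0 + r 2 0 := by
    rw [hrx, hrx, hrx, ← Finset.sum_add_distrib]
    exact Finset.sum_congr rfl fun i _ => by rw [(chainU_matching h₂ h₃ (i + 1)).2.2]; ring
  have hV0 : V 0 0 = 0 := by
    rw [hVx]
    exact Finset.sum_eq_zero fun i _ => by rw [chainU_zero_zero, mul_zero]
  have hP1 : chainP q₂ q₃ lam 1 0 0 = 1 := by
    rw [chainP, circleCoeff_one (differentiable_familyP h₂ h₃ 0 0)]
    exact solC_zero lam
  have hr0 : r 0 0 = p 0 0 := by
    rw [hrx, hc' fun i => chainP q₂ q₃ lam (i + 1) 0 0, zero_add, hP1, ha]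
    ring
  -- The difference `u - V` solves the homogeneous equations with zero initial data on the first
  -- edge, so all that can remain is an opposite pair of sine solutions of amplitude `e` on the
  -- other two edges.
  have key := hD.eq_of_zero_data (by simp [hu0, hV0]) (by simp [hr0]) (by simp [hm1, hVm1])
    (by simp only [Pi.sub_apply]; rw [hm2, hVm2])
    (by simp only [Pi.sub_apply]; rw [hm3, hVm3]; ring)
  have h01 : (1 : ℝ) ∈ Icc (0 : ℝ) 1 := ⟨zero_le_one, le_rfl⟩
  obtain ⟨-, k1, -, k2⟩ := key 1 h01
  set e := (p - r) 2 0
  have hV11 : V 1 1 = c' m * (solC lam 1 * g lam) := by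
    rw [hVx, Finset.sum_range_succ, (chain_end_succ hg hΔ).1, Finset.sum_eq_zero, zero_add]
    intro i hi
    rw [(chain_end_of_le hg hΔ (Nat.succ_le_of_lt (Finset.mem_range.1 hi))).1, mul_zero]
  have hr21 : r 2 1 = c' m * (lam * solS lam 1 * g lam) := by
    rw [hrx, Finset.sum_range_succ, (chain_end_succ hg hΔ).2, Finset.sum_eq_zero, zero_add]
    intro i hi
    rw [(chain_end_of_le hg hΔ (Nat.succ_le_of_lt (Finset.mem_range.1 hi))).2, mul_zero]
  simp only [Pi.sub_apply] at k1 k2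
  rw [hu1, hV11] at k1
  rw [hp2, hr21] at k2
  have hid := solC_sq_add lam 1
  -- The end conditions read `c' m * C * g = e * S` and `c' m * lam * S * g = -e * C`. Since `C² +
  -- lam S² = 1`, this system forces `c' m * g lam = 0` and then `e = 0`, so the term beyond the
  -- chain disappears.
  have hcm : c' m = 0 := by
    have : c' m * g lam = 0 := by
      linear_combination (-(c' m * g lam)) * hid - solC lam 1 * k1 - solS lam 1 * k2
    exact (mul_eq_zero.1 this).resolve_right hg0
  have he : e = 0 := by
    rw [hcm] at k1 k2
    linear_combination (-e) * hid - lam * solS lam 1 * (-k1) - solC lam 1 * k2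
  refine ⟨c', fun j x hx => ?_⟩
  have hVx' := hVx j x
  rw [Finset.sum_range_succ, hcm, zero_mul, add_zero] at hVx'
  rw [← hVx']
  obtain ⟨d0, d1, d2, -⟩ := key x hx
  rw [he] at d1 d2
  simp only [Pi.sub_apply, neg_zero, zero_mul, sub_eq_zero] at d0 d1 d2
  revert j
  exact fun j _ => forall_fin_three (p := fun j => u j x = V j x) d0 d1 d2 j

lemma exists_eq_sum_chain (h₂ : ∀ a b, IntervalIntegrable q₂ volume a b)
    (h₃ : ∀ a b, IntervalIntegrable q₃ volume a b) {m : ℕ} {g : ℂ → ℂ} (hg : Differentiable ℂ g)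
    (hg0 : g lam ≠ 0) (hΔ : ∀ z, charDelta q₂ q₃ z = (z - lam) ^ m * g z) {n : ℕ}
    {u : Fin 3 → ℝ → ℂ} (hu : IsRootFunction q₂ q₃ 1 lam n u) :
    ∃ c : ℕ → ℂ, ∀ j, ∀ x ∈ Icc (0 : ℝ) 1,
      u j x = ∑ i ∈ Finset.range m, c i * chainU q₂ q₃ lam (i + 1) j x := by
  induction n generalizing u with
  | zero => exact ⟨0, fun j x hx => by simpa using hu j x hx⟩
  | succ n ih =>
    obtain ⟨f, hf, hs⟩ := hu
    obtain ⟨c, hc⟩ := ih hf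
    exact exists_eq_sum_chain_of_solves h₂ h₃ hg hg0 hΔ hs hc

/-- The first edge alone suffices. Applying `-d²/dx² - lam` to a vanishing combination lowers all
indices, so by induction every coefficient but `c 0` vanishes. The remaining term is `c 0 * solS
lam`, and at an interior point such as `1/2` this function and its derivative are not both zero. -/
lemma coeff_eq_zero_of_sum_chain (h₂ : ∀ a b, IntervalIntegrable q₂ volume a b)
    (h₃ : ∀ a b, IntervalIntegrable q₃ volume a b) (m : ℕ) (c : ℕ → ℂ)
    (h : ∀ x ∈ Ioo (0 : ℝ) 1, ∑ i ∈ Finset.range m, c i * chainU q₂ q₃ lam (i + 1) 0 x = 0) :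
    ∀ i < m, c i = 0 := by
  have hP : ∀ (m : ℕ) (c : ℕ → ℂ),
      (∀ x ∈ Ioo (0 : ℝ) 1, ∑ i ∈ Finset.range m, c i * chainU q₂ q₃ lam (i + 1) 0 x = 0) →
      ∀ x ∈ Ioo (0 : ℝ) 1, ∑ i ∈ Finset.range m, c i * chainP q₂ q₃ lam (i + 1) 0 x = 0 := by
    intro m c h x hx
    have hd : HasDerivAt (fun x => ∑ i ∈ Finset.range m, c i * chainU q₂ q₃ lam (i + 1) 0 x)
        (∑ i ∈ Finset.range m, c i * chainP q₂ q₃ lam (i + 1) 0 x) x :=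
      HasDerivAt.fun_sum fun i _ => (hasDerivAt_chainU lam h₂ h₃ (i + 1) 0 x).const_mul (c i)
    have h0 : (fun x => ∑ i ∈ Finset.range m, c i * chainU q₂ q₃ lam (i + 1) 0 x) =ᶠ[𝓝 x]
        fun _ => 0 := by
      filter_upwards [Ioo_mem_nhds hx.1 hx.2] with y hy using h y hy
    exact hd.unique ((hasDerivAt_const x (0 : ℂ)).congr_of_eventuallyEq h0)
  induction m generalizing c with
  | zero => intro i hi; omega
  | succ m ih =>
    have hshift : ∀ x ∈ Ioo (0 : ℝ) 1,
        ∑ i ∈ Finset.range m, c (i + 1) * chainU q₂ q₃ lam (i + 1) 0 x = 0 := by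
      intro x hx
      have hd : HasDerivAt (fun x => ∑ i ∈ Finset.range (m + 1), c i * chainP q₂ q₃ lam (i + 1) 0 x)
          (∑ i ∈ Finset.range (m + 1), c i * (-lam * chainU q₂ q₃ lam (i + 1) 0 x -
            chainU q₂ q₃ lam i 0 x)) x :=
        HasDerivAt.fun_sum fun i _ => (hasDerivAt_chainP_zero lam h₂ h₃ i x).const_mul (c i)
      have h0 : (fun x => ∑ i ∈ Finset.range (m + 1), c i * chainP q₂ q₃ lam (i + 1) 0 x) =ᶠ[𝓝 x]
          fun _ => 0 := by
        filter_upwards [Ioo_mem_nhds hx.1 hx.2] with y hy using hP _ c h y hy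
      have h1 := hd.unique ((hasDerivAt_const x (0 : ℂ)).congr_of_eventuallyEq h0)
      have h2 : ∑ i ∈ Finset.range (m + 1), c i * (-lam * chainU q₂ q₃ lam (i + 1) 0 x -
            chainU q₂ q₃ lam i 0 x) =
          -lam * (∑ i ∈ Finset.range (m + 1), c i * chainU q₂ q₃ lam (i + 1) 0 x) -
          ∑ i ∈ Finset.range (m + 1), c i * chainU q₂ q₃ lam i 0 x := by
        rw [Finset.mul_sum, ← Finset.sum_sub_distrib]
        exact Finset.sum_congr rfl fun i _ => by ring
      rw [h2, h x hx, Finset.sum_range_succ', chainU_zero lam h₂ h₃] at h1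
      simpa using h1
    have hc := ih (fun i => c (i + 1)) hshift
    have hhalf : (1 / 2 : ℝ) ∈ Ioo (0 : ℝ) 1 := by constructor <;> norm_num
    have e1 := h _ hhalf
    have e2 := hP _ c h _ hhalf
    rw [Finset.sum_range_succ', Finset.sum_eq_zero (fun i hi => by
      rw [hc i (Finset.mem_range.1 hi), zero_mul]), zero_add, zero_add, chainU,
      circleCoeff_one (differentiable_familyU h₂ h₃ _ 0)] at e1
    rw [Finset.sum_range_succ', Finset.sum_eq_zero (fun i hi => by
      rw [hc i (Finset.mem_range.1 hi), zero_mul]), zero_add, zero_add, chainP,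
      circleCoeff_one (differentiable_familyP h₂ h₃ _ 0)] at e2
    change c 0 * solS lam (1 / 2) = 0 at e1
    change c 0 * solC lam (1 / 2) = 0 at e2
    have hc0 : c 0 = 0 := by
      linear_combination (-(c 0)) * solC_sq_add lam (1 / 2) + solC lam (1 / 2) * e2 +
        lam * solS lam (1 / 2) * e1
    intro i hi
    rcases i with _ | i
    · exact hc0
    · exact hc i (by omega)

/-- The chain functions with indices `1, …, m` are a basis of the root subspace. -/
lemma multiplicity_eq_of_factor (h₂ : ∀ a b, IntervalIntegrable q₂ volume a b)
    (h₃ : ∀ a b, IntervalIntegrable q₃ volume a b) {m : ℕ} {g : ℂ → ℂ} (hg : Differentiable ℂ g)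
    (hg0 : g lam ≠ 0) (hΔ : ∀ z, charDelta q₂ q₃ z = (z - lam) ^ m * g z) :
    multiplicity q₂ q₃ 1 lam = m := by
  let v : Fin m → (Fin 3 → Icc (0 : ℝ) 1 → ℂ) := fun i j x => chainU q₂ q₃ lam (i + 1) j x
  have hspan : rootSubspace q₂ q₃ 1 lam = Submodule.span ℂ (range v) := by
    refine le_antisymm (Submodule.span_le.2 ?_) (Submodule.span_mono ?_)
    · rintro y ⟨n, u, hu, rfl⟩
      obtain ⟨c, hc⟩ := exists_eq_sum_chain h₂ h₃ hg hg0 hΔ hu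
      have : (fun (j : Fin 3) (x : Icc (0 : ℝ) 1) => u j x) = ∑ i : Fin m, c i • v i := by
        funext j x
        rw [hc j x x.2, Finset.sum_range]
        simp [v, Finset.sum_apply]
      rw [this]
      exact Submodule.sum_mem _ fun i _ => Submodule.smul_mem _ _ (Submodule.subset_span ⟨i, rfl⟩)
    · rintro _ ⟨i, rfl⟩
      exact ⟨i + 1, _, isRootFunction_chain h₂ h₃ hg hΔ i.2, rfl⟩
  have hli : LinearIndependent ℂ v := by
    rw [Fintype.linearIndependent_iff]
    intro c hc i
    have h1 := coeff_eq_zero_of_sum_chain (lam := lam) h₂ h₃ m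
      (fun i => if h : i < m then c ⟨i, h⟩ else 0) (fun x hx => by
        have h2 := congrFun (congrFun hc 0) ⟨x, Ioo_subset_Icc_self hx⟩
        rw [Finset.sum_range]
        simpa [v, Finset.sum_apply] using h2) i i.2
    simpa using h1
  rw [multiplicity, hspan, rank_span hli]
  rw [Cardinal.mk_range_eq _ hli.injective]
  simp

lemma isEigenvalue_iff_of_factor (h₂ : ∀ a b, IntervalIntegrable q₂ volume a b)
    (h₃ : ∀ a b, IntervalIntegrable q₃ volume a b) {m : ℕ} {g : ℂ → ℂ} (hg : Differentiable ℂ g)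
    (hg0 : g lam ≠ 0) (hΔ : ∀ z, charDelta q₂ q₃ z = (z - lam) ^ m * g z) :
    IsEigenvalue q₂ q₃ 1 lam ↔ m ≠ 0 := by
  constructor
  · rintro ⟨u, ⟨j, x, hx, hne⟩, hs⟩ rfl
    obtain ⟨c, hc⟩ := exists_eq_sum_chain h₂ h₃ hg hg0 hΔ (n := 1) (u := u)
      ⟨0, fun j x _ => rfl, hs⟩
    exact hne (by simpa using hc j x hx)
  · intro hm
    obtain ⟨f, hf, hs⟩ := isRootFunction_chain h₂ h₃ hg hΔ (n := 1) (by omega)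
    have hs' : Solves q₂ q₃ 1 lam (chainU q₂ q₃ lam 1) 0 := by
      obtain ⟨p, h1, h2⟩ := solves_one_iff.1 hs
      exact solves_one_iff.2 ⟨p, h1.congr hf, h2⟩
    refine ⟨_, ?_, hs'⟩
    by_contra! h
    have := coeff_eq_zero_of_sum_chain (lam := lam) h₂ h₃ 1 (fun _ => 1) (fun x hx => by
      simpa using h 0 x (Ioo_subset_Icc_self hx)) 0 one_pos
    exact one_ne_zero this

theorem multiplicity_eq_analyticOrderAt (h₂ : ∀ a b, IntervalIntegrable q₂ volume a b)
    (h₃ : ∀ a b, IntervalIntegrable q₃ volume a b) {w : ℂ} (hw : charDelta q₂ q₃ w ≠ 0) :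
    multiplicity q₂ q₃ 1 lam = analyticOrderAt (charDelta q₂ q₃) lam := by
  have hd := differentiable_charDelta h₂ h₃
  have hm := (natCast_analyticOrderNatAt_of_entire hd hw lam)
  obtain ⟨g, hg, hg0, hΔ⟩ := exists_eq_sub_pow_mul hd hm.symm
  rw [multiplicity_eq_of_factor h₂ h₃ hg hg0 hΔ, hm]

theorem isEigenvalue_iff (h₂ : ∀ a b, IntervalIntegrable q₂ volume a b)
    (h₃ : ∀ a b, IntervalIntegrable q₃ volume a b) {w : ℂ} (hw : charDelta q₂ q₃ w ≠ 0) :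
    IsEigenvalue q₂ q₃ 1 lam ↔ charDelta q₂ q₃ lam = 0 := by
  have hd := differentiable_charDelta h₂ h₃
  obtain ⟨g, hg, hg0, hΔ⟩ := exists_eq_sub_pow_mul hd
    (natCast_analyticOrderNatAt_of_entire hd hw lam).symm
  rw [isEigenvalue_iff_of_factor h₂ h₃ hg hg0 hΔ, analyticOrderNatAt_ne_zero_iff hd hw]

end root

/-! ### The remainder of the characteristic function -/

section Remainder
variable {q q₂ q₃ : ℝ → ℂ}

/-- The part of the characteristic function at `z ^ 2` that is square-summable along `base`. -/
def remainder (q₂ q₃ : ℝ → ℂ) (z : ℂ) : ℂ :=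
  (cos z * ∫ t in (0 : ℝ)..1, cos (z * (2 * t - 1)) * q₂ t) / 2 +
    (sin z * ∫ t in (0 : ℝ)..1, sin (z * (2 * t - 1)) * q₃ t) / 2

/-- The perturbing term in `modelS ω₂ ω₃ 1`. -/
def modelPerturbation (ω₂ ω₃ z : ℂ) : ℂ := -((ω₂ + ω₃) / 4 * cos (2 * z)) - (ω₂ - ω₃) / 4

lemma modelS_one (ω₂ ω₃ z : ℂ) :
    modelS ω₂ ω₃ 1 z = z * trigFactor z + modelPerturbation ω₂ ω₃ z := by
  rw [modelS, trigFactor_eq, modelPerturbation]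
  ring

lemma isPerturbation_model (ω₂ ω₃ : ℂ) :
    IsPerturbation (modelPerturbation ω₂ ω₃) (‖(ω₂ + ω₃) / 4‖ + ‖(ω₂ - ω₃) / 4‖) where
  differentiable := by
    unfold modelPerturbation
    fun_prop
  norm_le z := by
    have h1 : ‖cos (2 * z)‖ ≤ Real.exp (2 * |z.im|) := by
      have := norm_cos_le (2 * z)
      rwa [show (2 * z).im = 2 * z.im by simp, abs_mul, abs_two] at this
    have h2 : 1 ≤ Real.exp (2 * |z.im|) := Real.one_le_exp (by positivity)
    calc ‖modelPerturbation ω₂ ω₃ z‖ ≤ ‖(ω₂ + ω₃) / 4 * cos (2 * z)‖ + ‖(ω₂ - ω₃) / 4‖ := by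
          refine (norm_sub_le _ _).trans ?_
          rw [norm_neg]
      _ ≤ ‖(ω₂ + ω₃) / 4‖ * Real.exp (2 * |z.im|) + ‖(ω₂ - ω₃) / 4‖ * Real.exp (2 * |z.im|) := by
          rw [norm_mul]
          gcongr
          exact le_mul_of_one_le_right (norm_nonneg _) h2
      _ = _ := by ring

lemma isLift_modelF (ω₂ ω₃ : ℂ) : IsLift (modelF ω₂ ω₃ 1) (modelPerturbation ω₂ ω₃)
    (‖(ω₂ + ω₃) / 4‖ + ‖(ω₂ - ω₃) / 4‖) where
  toIsPerturbation := isPerturbation_model ω₂ ω₃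
  differentiable_lift := by
    refine differentiable_comp_sqrt (f := modelS ω₂ ω₃ 1) ?_ fun w => ?_
    · unfold modelS
      fun_prop
    · simp only [modelS, mul_neg, cos_neg, sin_neg]
      ring
  apply_sq z := by
    rw [← modelS_one]
    refine apply_sqrt_of_even (f := modelS ω₂ ω₃ 1) (fun w => ?_) rfl
    simp only [modelS, mul_neg, cos_neg, sin_neg]
    ring

lemma mul_intCS_sq (ρ : ℂ) :
    ρ * intCS q (ρ ^ 2) 1 = ∫ t in (0 : ℝ)..1, cos (ρ * t) * sin (ρ * t) * q t := by
  rw [intCS, ← intervalIntegral.integral_const_mul]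
  refine intervalIntegral.integral_congr fun t _ => ?_
  simp only [solC_sq, ← mul_solS_sq]
  ring

lemma sq_mul_intSS_sq (ρ : ℂ) :
    ρ ^ 2 * intSS q (ρ ^ 2) 1 = ∫ t in (0 : ℝ)..1, sin (ρ * t) ^ 2 * q t := by
  rw [intSS, ← intervalIntegral.integral_const_mul]
  refine intervalIntegral.integral_congr fun t _ => ?_
  simp only [← mul_solS_sq]
  ring

/-- Expand `cos (2 z t - z)` and use `cos (2 z t) = 1 - 2 sin² (z t)`. The constant `1` produces the
mean of `q`, which goes into the model function, and the kernel with argument `z (2 t - 1)` is the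
oscillating rest. -/
lemma integral_cos_kernel (hq : IntervalIntegrable q volume 0 1) (z : ℂ) :
    ∫ t in (0 : ℝ)..1, cos (z * (2 * t - 1)) * q t =
      cos z * (∫ t in (0 : ℝ)..1, q t) +
        (2 * sin z * (∫ t in (0 : ℝ)..1, cos (z * t) * sin (z * t) * q t) -
          2 * cos z * ∫ t in (0 : ℝ)..1, sin (z * t) ^ 2 * q t) := by
  have i1 := intervalIntegrable_mul
    (K := fun z t => cos (z * t) * sin (z * t)) (by fun_prop) hq z
  have i2 := intervalIntegrable_mul (K := fun z t => sin (z * t) ^ 2) (by fun_prop) hq z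
  rw [← intervalIntegral.integral_const_mul, ← intervalIntegral.integral_const_mul,
    ← intervalIntegral.integral_const_mul,
    ← intervalIntegral.integral_sub (i1.const_mul _) (i2.const_mul _),
    ← intervalIntegral.integral_add (hq.const_mul _) ((i1.const_mul _).sub (i2.const_mul _))]
  refine intervalIntegral.integral_congr fun t _ => ?_
  have : z * (2 * (t : ℂ) - 1) = 2 * (z * t) - z := by ring
  simp only [this, cos_sub, cos_two_mul', sin_two_mul]
  linear_combination cos z * q t * sin_sq_add_cos_sq (z * t)

lemma integral_sin_kernel (hq : IntervalIntegrable q volume 0 1) (z : ℂ) :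
    ∫ t in (0 : ℝ)..1, sin (z * (2 * t - 1)) * q t =
      -sin z * (∫ t in (0 : ℝ)..1, q t) +
        (2 * cos z * (∫ t in (0 : ℝ)..1, cos (z * t) * sin (z * t) * q t) +
          2 * sin z * ∫ t in (0 : ℝ)..1, sin (z * t) ^ 2 * q t) := by
  have i1 := intervalIntegrable_mul
    (K := fun z t => cos (z * t) * sin (z * t)) (by fun_prop) hq z
  have i2 := intervalIntegrable_mul (K := fun z t => sin (z * t) ^ 2) (by fun_prop) hq z
  rw [← intervalIntegral.integral_const_mul, ← intervalIntegral.integral_const_mul,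
    ← intervalIntegral.integral_const_mul,
    ← intervalIntegral.integral_add (i1.const_mul _) (i2.const_mul _),
    ← intervalIntegral.integral_add (hq.const_mul _) ((i1.const_mul _).add (i2.const_mul _))]
  refine intervalIntegral.integral_congr fun t _ => ?_
  have : z * (2 * (t : ℂ) - 1) = 2 * (z * t) - z := by ring
  simp only [this, sin_sub, cos_two_mul', sin_two_mul]
  linear_combination -sin z * q t * sin_sq_add_cos_sq (z * t)

/-- The factor `z ^ 2` clears the denominators of `sin z / z`. By the two kernel identities the
means of the potentials leave `sin² z ω₃ / 2 - cos² z ω₂ / 2`, which is `modelPerturbation`. -/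
lemma sq_mul_charDelta_sq (h₂ : IntervalIntegrable q₂ volume 0 1)
    (h₃ : IntervalIntegrable q₃ volume 0 1) (z : ℂ) :
    z ^ 2 * charDelta q₂ q₃ (z ^ 2) = z * trigFactor z +
      (modelPerturbation (∫ t in (0 : ℝ)..1, q₂ t) (∫ t in (0 : ℝ)..1, q₃ t) z +
        remainder q₂ q₃ z) := by
  have hC : solC (z ^ 2) 1 = cos z := by simpa using solC_sq z 1
  have hS : z * solS (z ^ 2) 1 = sin z := by simpa using mul_solS_sq z 1
  rw [trigFactor_eq, modelPerturbation, remainder, integral_cos_kernel h₂, integral_sin_kernel h₃,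
    ← mul_intCS_sq, ← mul_intCS_sq, ← sq_mul_intSS_sq, ← sq_mul_intSS_sq, charDelta, charAlpha,
    charBeta, edgeU, edgeP, hC, cos_two_mul', ← hS]
  have h := sin_sq_add_cos_sq z
  rw [← hS] at h
  generalize solS (z ^ 2) 1 = S at *
  generalize cos z = c at *
  generalize (∫ t in (0 : ℝ)..1, q₂ t) = w₂
  generalize (∫ t in (0 : ℝ)..1, q₃ t) = w₃
  linear_combination (z ^ 2 * S / 2 - (w₂ - w₃) / 4) * h

lemma differentiable_remainder (h₂ : IntervalIntegrable q₂ volume 0 1)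
    (h₃ : IntervalIntegrable q₃ volume 0 1) : Differentiable ℂ (remainder q₂ q₃) := by
  have d2 := differentiable_integral_mul (K := fun z t => cos (z * (2 * t - 1)))
    (by fun_prop) (fun t => by fun_prop) h₂
  have d3 := differentiable_integral_mul (K := fun z t => sin (z * (2 * t - 1)))
    (by fun_prop) (fun t => by fun_prop) h₃
  exact ((differentiable_cos.mul d2).div_const 2).add ((differentiable_sin.mul d3).div_const 2)

/-- Since `|2 t - 1| ≤ 1`, the integral grows no faster than `exp |Im z|`; the sine or cosine in
front of it then gives the admissible bound `exp (2 |Im z|)`. -/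
lemma norm_integral_kernel_le {K : ℂ → ℂ} (hK : ∀ z, ‖K z‖ ≤ Real.exp |z.im|)
    (hq : IntervalIntegrable q volume 0 1) (z : ℂ) :
    ‖∫ t in (0 : ℝ)..1, K (z * (2 * t - 1)) * q t‖ ≤
      Real.exp |z.im| * ∫ t in (0 : ℝ)..1, ‖q t‖ := by
  rw [← intervalIntegral.integral_const_mul]
  refine intervalIntegral.norm_integral_le_of_norm_le zero_le_one
    (Eventually.of_forall fun t ht => ?_) (hq.norm.const_mul _)
  rw [norm_mul]
  refine mul_le_mul_of_nonneg_right ((hK _).trans (Real.exp_le_exp.2 ?_)) (norm_nonneg _)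
  have : (z * (2 * (t : ℂ) - 1)).im = z.im * (2 * t - 1) := by simp
  rw [this, abs_mul]
  exact mul_le_of_le_one_right (abs_nonneg _) (abs_le.2 ⟨by linarith [ht.1], by linarith [ht.2]⟩)

lemma isPerturbation_remainder (h₂ : IntervalIntegrable q₂ volume 0 1)
    (h₃ : IntervalIntegrable q₃ volume 0 1) : IsPerturbation (remainder q₂ q₃)
      ((∫ t in (0 : ℝ)..1, ‖q₂ t‖) / 2 + (∫ t in (0 : ℝ)..1, ‖q₃ t‖) / 2) where
  differentiable := differentiable_remainder h₂ h₃
  norm_le z := by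
    have h : Real.exp (2 * |z.im|) = Real.exp |z.im| * Real.exp |z.im| := by
      rw [← Real.exp_add, two_mul]
    have e2 := mul_le_mul (norm_cos_le z) (norm_integral_kernel_le norm_cos_le h₂ z)
      (norm_nonneg _) (Real.exp_nonneg _)
    have e3 := mul_le_mul (norm_sin_le z) (norm_integral_kernel_le norm_sin_le h₃ z)
      (norm_nonneg _) (Real.exp_nonneg _)
    refine (norm_add_le _ _).trans ?_
    rw [norm_div, norm_div, norm_mul, norm_mul, h, RCLike.norm_two]
    linarith

lemma isLift_charDelta (h₂ : ∀ a b, IntervalIntegrable q₂ volume a b)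
    (h₃ : ∀ a b, IntervalIntegrable q₃ volume a b) : ∃ M,
    IsLift (fun z => z * charDelta q₂ q₃ z)
      (fun z => modelPerturbation (∫ t in (0 : ℝ)..1, q₂ t) (∫ t in (0 : ℝ)..1, q₃ t) z +
        remainder q₂ q₃ z) M := by
  have hP := isPerturbation_model (∫ t in (0 : ℝ)..1, q₂ t) (∫ t in (0 : ℝ)..1, q₃ t)
  have hQ := isPerturbation_remainder (h₂ 0 1) (h₃ 0 1)
  refine ⟨_, { differentiable := hP.differentiable.add hQ.differentiable
               norm_le := fun z => ((norm_add_le _ _).trans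
                 (add_le_add (hP.norm_le z) (hQ.norm_le z))).trans_eq (add_mul _ _ _).symm
               differentiable_lift := differentiable_id.mul (differentiable_charDelta h₂ h₃)
               apply_sq := fun z => sq_mul_charDelta_sq (h₂ 0 1) (h₃ 0 1) z }⟩

end Remainder

/-! ### Square-summability along `base` -/

/-- At `n π + γ` the frequency is `2 π n + 2 γ`. The integral is thus the Fourier coefficient of
index `-n` of `exp (2 i γ t) q(t)`, a function with the same modulus as `q`, and Parseval's identity
applies. -/
lemma summable_sq_norm_fourierIntegral {q : ℝ → ℂ}
    (hq : MemLp q 2 (volume.restrict (Ioo (0 : ℝ) 1))) (γ : ℝ) :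
    Summable fun n : ℤ =>
      ‖∫ t in (0 : ℝ)..1, cexp (2 * ((n * π + γ : ℝ) : ℂ) * t * I) * q t‖ ^ 2 := by
  have hm : MemLp (fun t : ℝ => cexp (2 * γ * t * I) * q t) 2 (volume.restrict (Ioc (0 : ℝ) 1)) := by
    rw [← Measure.restrict_congr_set (Ioo_ae_eq_Ioc (a := (0 : ℝ)) (b := 1))]
    refine hq.of_le (Continuous.aestronglyMeasurable (by fun_prop) |>.mul hq.1)
      (Eventually.of_forall fun t => ?_)
    have : 2 * (γ : ℂ) * t * I = ((2 * γ * t : ℝ) : ℂ) * I := by push_cast; ring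
    rw [norm_mul, this, norm_exp_ofReal_mul_I, one_mul]
  have h := (hasSum_sq_fourierCoeffOn zero_lt_one hm).summable
  have h2 := (Equiv.neg ℤ).summable_iff.2 h
  refine h2.congr fun n => ?_
  simp only [Function.comp_apply, Equiv.neg_apply]
  rw [fourierCoeffOn_eq_integral]
  congr 2
  rw [sub_zero, div_one, one_smul]
  refine intervalIntegral.integral_congr fun t _ => ?_
  simp only [neg_neg, fourier_coe_apply, smul_eq_mul, ← mul_assoc, ← Complex.exp_add]
  congr 2
  push_cast
  ring

/-- The indicator of `base` is at most the sum of the indicators of its three progressions, with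
shifts `0`, `baseAngle` and `-baseAngle`. -/
lemma summable_base {f : ℝ → ℝ} (hf : ∀ b, 0 ≤ f b)
    (h : ∀ γ : ℝ, Summable fun n : ℤ => f (n * π + γ)) : Summable fun b : base => f b := by
  have h' : ∀ γ : ℝ, Summable ((range fun n : ℤ => (n * π + γ : ℝ)).indicator f) := fun γ => by
    have hi : Function.Injective fun n : ℤ => (n * π + γ : ℝ) := fun m n hmn => by
      have := mul_right_cancel₀ Real.pi_ne_zero (add_right_cancel hmn)
      exact_mod_cast this
    rw [← summable_subtype_iff_indicator, ← (Equiv.ofInjective _ hi).summable_iff]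
    exact h γ
  have h0 : ∀ γ b, 0 ≤ (range fun n : ℤ => (n * π + γ : ℝ)).indicator f b := fun γ b =>
    indicator_nonneg (fun b _ => hf b) b
  refine summable_subtype_iff_indicator.2 (Summable.of_nonneg_of_le
    (fun b => indicator_nonneg (fun b _ => hf b) b) (fun b => ?_)
    ((h' 0).add ((h' baseAngle).add (h' (-baseAngle)))))
  by_cases hb : b ∈ base
  · rw [indicator_of_mem hb]
    obtain ⟨n, hn | hn | hn⟩ := hb
    · have : b ∈ range fun n : ℤ => (n * π + 0 : ℝ) := ⟨n, by simp [hn]⟩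
      rw [indicator_of_mem this]
      linarith [h0 baseAngle b, h0 (-baseAngle) b]
    · have : b ∈ range fun n : ℤ => (n * π + baseAngle : ℝ) := ⟨n, by simp [hn]⟩
      rw [indicator_of_mem this]
      linarith [h0 0 b, h0 (-baseAngle) b]
    · have : b ∈ range fun n : ℤ => (n * π + -baseAngle : ℝ) := ⟨n, by simp [hn]; ring⟩
      rw [indicator_of_mem this]
      linarith [h0 0 b, h0 baseAngle b]
  · rw [indicator_of_notMem hb]
    linarith [h0 0 b, h0 baseAngle b, h0 (-baseAngle) b]

/-- The squared modulus of the Fourier transform of `q` on `(0, 1)` at `2 * b`. -/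
def fourierSq (q : ℝ → ℂ) (b : ℝ) : ℝ :=
  ‖∫ t in (0 : ℝ)..1, cexp (2 * (b : ℂ) * t * I) * q t‖ ^ 2

lemma summable_fourierSq {q : ℝ → ℂ} (hq : MemLp q 2 (volume.restrict (Ioo (0 : ℝ) 1))) :
    Summable fun b : base => fourierSq q b :=
  summable_base (fun _ => sq_nonneg _) (summable_sq_norm_fourierIntegral hq)

lemma summable_fourierSq_neg {q : ℝ → ℂ} (hq : MemLp q 2 (volume.restrict (Ioo (0 : ℝ) 1))) :
    Summable fun b : base => fourierSq q (-b) := by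
  refine summable_base (f := fun b => fourierSq q (-b)) (fun _ => sq_nonneg _) fun γ => ?_
  refine ((Equiv.neg ℤ).summable_iff.2 (summable_sq_norm_fourierIntegral hq (-γ))).congr fun n => ?_
  simp only [Function.comp_apply, Equiv.neg_apply, fourierSq]
  congr 4 with t
  push_cast
  ring_nf

lemma norm_combination_sq_le {a b c d : ℂ} (ha : ‖a‖ = 1 / 2) (hb : ‖b‖ = 1 / 2) :
    ‖a * c + b * d‖ ^ 2 ≤ (‖c‖ ^ 2 + ‖d‖ ^ 2) / 2 := by
  have h : ‖a * c + b * d‖ ≤ (‖c‖ + ‖d‖) / 2 := by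
    refine (norm_add_le _ _).trans ?_
    rw [norm_mul, norm_mul, ha, hb]
    linarith
  nlinarith [sq_nonneg (‖c‖ - ‖d‖), mul_self_le_mul_self (norm_nonneg (a * c + b * d)) h]

lemma norm_sq_integral_combination_le {q : ℝ → ℂ} (hq : IntervalIntegrable q volume 0 1) (b : ℝ)
    {K : ℂ → ℂ} {μ ν : ℂ} (hK : ∀ z, K z = μ * cexp (z * I) + ν * cexp (-z * I))
    (hμ : ‖μ‖ = 1 / 2) (hν : ‖ν‖ = 1 / 2) :
    ‖∫ t in (0 : ℝ)..1, K (b * (2 * t - 1)) * q t‖ ^ 2 ≤ (fourierSq q b + fourierSq q (-b)) / 2 := by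
  have h : ∫ t in (0 : ℝ)..1, K (b * (2 * t - 1)) * q t =
      (μ * cexp ((-b : ℝ) * I)) * (∫ t in (0 : ℝ)..1, cexp (2 * (b : ℂ) * t * I) * q t) +
      (ν * cexp (b * I)) * ∫ t in (0 : ℝ)..1, cexp (2 * ((-b : ℝ) : ℂ) * t * I) * q t := by
    have i := fun b : ℝ => intervalIntegrable_mul (K := fun z t => cexp (2 * z * t * I))
      (by fun_prop) hq b
    rw [← intervalIntegral.integral_const_mul, ← intervalIntegral.integral_const_mul,
      ← intervalIntegral.integral_add ((i _).const_mul _) ((i _).const_mul _)]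
    refine intervalIntegral.integral_congr fun t _ => ?_
    have e1 : cexp ((b : ℂ) * (2 * t - 1) * I) =
        cexp ((-b : ℝ) * I) * cexp (2 * (b : ℂ) * t * I) := by
      rw [← Complex.exp_add]
      congr 1
      push_cast
      ring
    have e2 : cexp (-((b : ℂ) * (2 * t - 1)) * I) =
        cexp (b * I) * cexp (2 * ((-b : ℝ) : ℂ) * t * I) := by
      rw [← Complex.exp_add]
      congr 1
      push_cast
      ring
    simp only [hK, e1, e2]
    ring
  rw [h]
  refine norm_combination_sq_le ?_ ?_
  · rw [norm_mul, norm_exp_ofReal_mul_I, mul_one, hμ]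
  · rw [norm_mul, norm_exp_ofReal_mul_I, mul_one, hν]

lemma cos_eq_combination (z : ℂ) : cos z = 1 / 2 * cexp (z * I) + 1 / 2 * cexp (-z * I) := by
  rw [cos]
  ring

lemma sin_eq_combination (z : ℂ) : sin z = -(I / 2) * cexp (z * I) + I / 2 * cexp (-z * I) := by
  rw [sin]
  ring

/-- On the real axis the outer sine and cosine are bounded by one, and each inner kernel splits into
two exponentials of frequencies `2 b` and `-2 b` with unimodular prefactors. -/
lemma summable_remainder {q₂ q₃ : ℝ → ℂ} (h₂ : IntervalIntegrable q₂ volume 0 1)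
    (h₃ : IntervalIntegrable q₃ volume 0 1)
    (hq₂ : MemLp q₂ 2 (volume.restrict (Ioo (0 : ℝ) 1)))
    (hq₃ : MemLp q₃ 2 (volume.restrict (Ioo (0 : ℝ) 1))) :
    Summable fun b : base => ‖remainder q₂ q₃ ((b : ℝ) : ℂ)‖ ^ 2 := by
  refine Summable.of_nonneg_of_le (fun _ => sq_nonneg _) (fun b => ?_)
    (((summable_fourierSq hq₂).add (summable_fourierSq_neg hq₂)).add
      ((summable_fourierSq hq₃).add (summable_fourierSq_neg hq₃)))
  have e2 := norm_sq_integral_combination_le h₂ b cos_eq_combination (by simp) (by simp)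
  have e3 := norm_sq_integral_combination_le h₃ b sin_eq_combination (by simp) (by simp)
  have hc : ‖cos ((b : ℝ) : ℂ)‖ ≤ 1 := by simpa using norm_cos_le ((b : ℝ) : ℂ)
  have hs : ‖sin ((b : ℝ) : ℂ)‖ ≤ 1 := by simpa using norm_sin_le ((b : ℝ) : ℂ)
  have h : ‖remainder q₂ q₃ ((b : ℝ) : ℂ)‖ ≤
      (‖∫ t in (0 : ℝ)..1, cos (((b : ℝ) : ℂ) * (2 * t - 1)) * q₂ t‖ +
        ‖∫ t in (0 : ℝ)..1, sin (((b : ℝ) : ℂ) * (2 * t - 1)) * q₃ t‖) / 2 := by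
    refine (norm_add_le _ _).trans ?_
    rw [norm_div, norm_div, norm_mul, norm_mul, RCLike.norm_two, add_div]
    gcongr
    · exact mul_le_of_le_one_left (norm_nonneg _) hc
    · exact mul_le_of_le_one_left (norm_nonneg _) hs
  generalize ‖∫ t in (0 : ℝ)..1, cos (((b : ℝ) : ℂ) * (2 * t - 1)) * q₂ t‖ = x at *
  generalize ‖∫ t in (0 : ℝ)..1, sin (((b : ℝ) : ℂ) * (2 * t - 1)) * q₃ t‖ = y at *
  have h' := mul_self_le_mul_self (norm_nonneg _) h
  have p2 : 0 ≤ fourierSq q₂ b + fourierSq q₂ (-b) := add_nonneg (sq_nonneg _) (sq_nonneg _)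
  have p3 : 0 ≤ fourierSq q₃ b + fourierSq q₃ (-b) := add_nonneg (sq_nonneg _) (sq_nonneg _)
  nlinarith [sq_nonneg (x - y)]

/-! ### Spectral asymptotics -/

/-- The set `spec` with the multiplicities `mult` is infinite and is asymptotically close to the
zeros of `F`, in the sense of square-summable remainders. -/
def HasSpectralAsymptotics (spec : Set ℂ) (mult : ℂ → ℕ∞) (F : ℂ → ℂ) : Prop :=
  spec.Infinite ∧ (∃ z₀, IsZeroSequence F z₀) ∧ ∀ z₀, IsZeroSequence F z₀ →
    ∃ z κ : ℕ → ℂ, Summable (fun n => ‖κ n‖ ^ 2) ∧ (∀ n : ℕ, 1 ≤ n → z n = z₀ n + κ n / n) ∧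
      spec = {lam | ∃ n : ℕ, 1 ≤ n ∧ lam = z n ^ 2} ∧
      ∀ lam : ℂ, {n : ℕ | 1 ≤ n ∧ z n ^ 2 = lam}.encard = mult lam

lemma isPerturbation_zero : IsPerturbation 0 0 where
  differentiable := differentiable_const 0
  norm_le z := by simp

lemma IsLift.exists_ne_zero {F P : ℂ → ℂ} {M : ℝ} (h : IsLift F P M) : ∃ w, F w ≠ 0 := by
  obtain ⟨R, hR⟩ := h.exists_norm_lt isPerturbation_zero
  obtain ⟨N, hN⟩ := exists_nat_radius R
  have h0 : 0 ≤ N * π + π / 2 := by positivity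
  have := hR N hN ((N * π + π / 2 : ℝ) : ℂ) (by rw [norm_real, Real.norm_of_nonneg h0])
  exact ⟨_, norm_pos_iff.1 ((norm_nonneg _).trans_lt this)⟩

lemma exists_charDelta_ne_zero {q₂ q₃ : ℝ → ℂ} (h₂ : ∀ a b, IntervalIntegrable q₂ volume a b)
    (h₃ : ∀ a b, IntervalIntegrable q₃ volume a b) : ∃ w, charDelta q₂ q₃ w ≠ 0 := by
  obtain ⟨M, hM⟩ := isLift_charDelta h₂ h₃
  obtain ⟨w, hw⟩ := hM.exists_ne_zero
  exact ⟨w, right_ne_zero_of_mul hw⟩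

lemma IsLift.exists_isZeroSequence {F P : ℂ → ℂ} {M : ℝ} (h : IsLift F P M) :
    ∃ z₀, IsZeroSequence F z₀ := by
  obtain ⟨R, hR⟩ := h.exists_isLocalized
  obtain ⟨N, hN⟩ := exists_nat_radius R
  obtain ⟨w, hw⟩ := h.exists_ne_zero
  exact StarGraphDelay.exists_isZeroSequence h.differentiable_lift hw (hR N hN)

/-- Finitely many finite fibres cannot exhaust the indices. -/
lemma infinite_of_fibers {z : ℕ → ℂ} {s : Set ℂ}
    (hs : s = {lam | ∃ n : ℕ, 1 ≤ n ∧ lam = z n ^ 2})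
    (hz : ∀ lam, {n : ℕ | 1 ≤ n ∧ z n ^ 2 = lam}.encard ≠ ⊤) : s.Infinite := by
  intro hfin
  refine (Ici_infinite 1 : (Ici (1 : ℕ)).Infinite) ((hfin.biUnion fun lam _ =>
    encard_ne_top_iff.1 (hz lam)).subset fun n hn => ?_)
  simp only [mem_iUnion]
  refine ⟨z n ^ 2, ?_, hn, rfl⟩
  rw [hs]
  exact ⟨n, hn, rfl⟩

lemma hasSpectralAsymptotics_of_intervalIntegrable {q₂ q₃ : ℝ → ℂ}
    (h₂ : ∀ a b, IntervalIntegrable q₂ volume a b) (h₃ : ∀ a b, IntervalIntegrable q₃ volume a b)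
    (hq₂ : MemLp q₂ 2 (volume.restrict (Ioo (0 : ℝ) 1)))
    (hq₃ : MemLp q₃ 2 (volume.restrict (Ioo (0 : ℝ) 1))) :
    HasSpectralAsymptotics (spectrumSet q₂ q₃ 1) (multiplicity q₂ q₃ 1)
      (modelF (∫ t in (0 : ℝ)..1, q₂ t) (∫ t in (0 : ℝ)..1, q₃ t) 1) := by
  have hF := isLift_modelF (∫ t in (0 : ℝ)..1, q₂ t) (∫ t in (0 : ℝ)..1, q₃ t)
  obtain ⟨M, hG⟩ := isLift_charDelta h₂ h₃
  obtain ⟨w, hw⟩ := exists_charDelta_ne_zero h₂ h₃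
  have hD := differentiable_charDelta h₂ h₃
  have key : ∀ z₀, IsZeroSequence
      (modelF (∫ t in (0 : ℝ)..1, q₂ t) (∫ t in (0 : ℝ)..1, q₃ t) 1) z₀ →
      ∃ z κ : ℕ → ℂ, Summable (fun n => ‖κ n‖ ^ 2) ∧ (∀ n : ℕ, 1 ≤ n → z n = z₀ n + κ n / n) ∧
      spectrumSet q₂ q₃ 1 = {lam | ∃ n : ℕ, 1 ≤ n ∧ lam = z n ^ 2} ∧
      ∀ lam : ℂ, {n : ℕ | 1 ≤ n ∧ z n ^ 2 = lam}.encard = multiplicity q₂ q₃ 1 lam := by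
    intro z₀ hz₀
    obtain ⟨z, κ, hκ, hz, hcount⟩ := exists_perturbed_sequence hF hD hG
      (isPerturbation_remainder (h₂ 0 1) (h₃ 0 1)) (fun _ => rfl)
      (summable_remainder (h₂ 0 1) (h₃ 0 1) hq₂ hq₃) hz₀
    refine ⟨z, κ, hκ, hz, ?_, fun lam => ?_⟩
    · ext lam
      have h1 := isEigenvalue_iff (lam := lam) h₂ h₃ hw
      have h2 : analyticOrderAt (charDelta q₂ q₃) lam ≠ 0 ↔ charDelta q₂ q₃ lam = 0 :=
        (hD.analyticAt lam).analyticOrderAt_ne_zero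
      rw [← hcount, encard_ne_zero] at h2
      refine h1.trans (h2.symm.trans ⟨?_, ?_⟩)
      · rintro ⟨n, hn, hn'⟩
        exact ⟨n, hn, hn'.symm⟩
      · rintro ⟨n, hn, hn'⟩
        exact ⟨n, hn, hn'.symm⟩
    · rw [hcount, multiplicity_eq_analyticOrderAt h₂ h₃ hw]
  obtain ⟨z₀, hz₀⟩ := hF.exists_isZeroSequence
  refine ⟨?_, ⟨z₀, hz₀⟩, key⟩
  obtain ⟨z, κ, -, -, hs, hm⟩ := key z₀ hz₀
  refine infinite_of_fibers hs fun lam => ?_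
  rw [hm, multiplicity_eq_analyticOrderAt h₂ h₃ hw]
  exact analyticOrderAt_ne_top_of_entire hD hw lam

/-! ### Symmetries of the eigenvalue problem -/

section Transfer
variable {q₂ q₃ r₂ r₃ : ℝ → ℂ} {k l : ℕ} {σ : Equiv.Perm (Fin 3)}

lemma isRootFunction_comp_perm {lam : ℂ}
    (h : ∀ u f, Solves q₂ q₃ k lam u f ↔ Solves r₂ r₃ l lam (u ∘ σ) (f ∘ σ)) (n : ℕ) :
    ∀ u, IsRootFunction q₂ q₃ k lam n u ↔ IsRootFunction r₂ r₃ l lam n (u ∘ σ) := by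
  induction n with
  | zero =>
    intro u
    exact (σ.forall_congr_right (q := fun j => ∀ x ∈ Icc (0 : ℝ) 1, u j x = 0)).symm
  | succ n ih =>
    intro u
    constructor
    · rintro ⟨f, hf, hu⟩
      exact ⟨f ∘ σ, (ih f).1 hf, (h u f).1 hu⟩
    · rintro ⟨f, hf, hu⟩
      have e : f = (f ∘ σ.symm) ∘ σ := by
        rw [Function.comp_assoc, Equiv.symm_comp_self, Function.comp_id]
      rw [e] at hf hu
      exact ⟨f ∘ σ.symm, (ih _).2 hf, (h _ _).2 hu⟩

/-- Permuting the edges is a linear isomorphism of the function space that carries one root subspace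
onto the other. -/
lemma multiplicity_comp_perm {lam : ℂ}
    (h : ∀ u f, Solves q₂ q₃ k lam u f ↔ Solves r₂ r₃ l lam (u ∘ σ) (f ∘ σ)) :
    multiplicity q₂ q₃ k lam = multiplicity r₂ r₃ l lam := by
  have hmap : (rootSubspace q₂ q₃ k lam).map
      (LinearEquiv.funCongrLeft ℂ (Icc (0 : ℝ) 1 → ℂ) σ).toLinearMap = rootSubspace r₂ r₃ l lam := by
    rw [rootSubspace, rootSubspace, Submodule.map_span]
    congr 1
    ext y
    constructor
    · rintro ⟨_, ⟨n, u, hu, rfl⟩, rfl⟩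
      exact ⟨n, u ∘ σ, (isRootFunction_comp_perm h n u).1 hu, rfl⟩
    · rintro ⟨n, u, hu, rfl⟩
      have e : u = (u ∘ σ.symm) ∘ σ := by
        rw [Function.comp_assoc, Equiv.symm_comp_self, Function.comp_id]
      refine ⟨_, ⟨n, u ∘ σ.symm, (isRootFunction_comp_perm h n _).2 (e ▸ hu), rfl⟩, ?_⟩
      ext j x
      simp [LinearEquiv.funCongrLeft_apply, LinearMap.funLeft_apply]
  rw [multiplicity, multiplicity, ← hmap]
  exact congrArg _ ((LinearEquiv.funCongrLeft ℂ (Icc (0 : ℝ) 1 → ℂ) σ).submoduleMap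
    (rootSubspace q₂ q₃ k lam)).rank_eq

lemma spectrumSet_comp_perm
    (h : ∀ lam u f, Solves q₂ q₃ k lam u f ↔ Solves r₂ r₃ l lam (u ∘ σ) (f ∘ σ)) :
    spectrumSet q₂ q₃ k = spectrumSet r₂ r₃ l := by
  ext lam
  constructor
  · rintro ⟨u, ⟨j, x, hx, hu⟩, hs⟩
    exact ⟨u ∘ σ, ⟨σ.symm j, x, hx, by simpa using hu⟩, (h lam u 0).1 hs⟩
  · rintro ⟨u, ⟨j, x, hx, hu⟩, hs⟩
    have e : u = (u ∘ σ.symm) ∘ σ := by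
      rw [Function.comp_assoc, Equiv.symm_comp_self, Function.comp_id]
    rw [e] at hs
    exact ⟨u ∘ σ.symm, ⟨σ j, x, hx, by simpa using hu⟩, (h lam _ 0).2 hs⟩

end Transfer

lemma Solves.congr_potential {q₂ q₃ r₂ r₃ : ℝ → ℂ} {k : ℕ} {lam : ℂ} {u f : Fin 3 → ℝ → ℂ}
    (h₂ : EqOn q₂ r₂ (Ioo 0 1)) (h₃ : EqOn q₃ r₃ (Ioo 0 1)) (h : Solves q₂ q₃ k lam u f) :
    Solves r₂ r₃ k lam u f := by
  obtain ⟨p, hu, hp, he, hrest⟩ := h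
  refine ⟨p, hu, hp, fun j => ?_, hrest⟩
  filter_upwards [he j, ae_restrict_mem measurableSet_Ioo] with x hx hx'
  have : potential q₂ q₃ j x = potential r₂ r₃ j x := by
    fin_cases j
    · rfl
    · exact h₂ hx'
    · exact h₃ hx'
  rwa [this] at hx

lemma Solves.swap {q₂ q₃ : ℝ → ℂ} {k l : ℕ} {lam : ℂ} {u f : Fin 3 → ℝ → ℂ}
    (hkl : k = 2 ∧ l = 1 ∨ k = 1 ∧ l = 2) (h : Solves q₂ q₃ k lam u f) :
    Solves q₃ q₂ l lam (u ∘ Equiv.swap 1 2) (f ∘ Equiv.swap 1 2) := by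
  have s0 : (Equiv.swap 1 2 : Equiv.Perm (Fin 3)) 0 = 0 := by decide
  have s1 : (Equiv.swap 1 2 : Equiv.Perm (Fin 3)) 1 = 2 := by decide
  have s2 : (Equiv.swap 1 2 : Equiv.Perm (Fin 3)) 2 = 1 := by decide
  have hpot : ∀ j, potential q₃ q₂ j = potential q₂ q₃ (Equiv.swap 1 2 j) := by
    intro j
    fin_cases j <;> rfl
  obtain ⟨p, hu, hp, he, ⟨m1, m2, m3⟩, h0, hk1, hk2⟩ := h
  refine ⟨p ∘ Equiv.swap 1 2, fun j => hu _, fun j => hp _, fun j => ?_, ?_, ?_, ?_, ?_⟩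
  · have := he (Equiv.swap 1 2 j)
    simpa only [Function.comp_apply, hpot, s0] using this
  · simp only [Function.comp_apply, s0, s1, s2]
    exact ⟨m2, m1, m3.trans (add_comm _ _)⟩
  · simpa only [Function.comp_apply, s0] using h0
  · intro hl
    simp only [Function.comp_apply, s1, s2]
    exact (hk2 (by omega)).symm
  · intro hl
    simp only [Function.comp_apply, s1, s2]
    exact (hk1 (by omega)).symm

/-- The matching conditions are symmetric in the last two edges, and exchanging these edges
exchanges the two types of end conditions. -/
lemma solves_two_iff {q₂ q₃ : ℝ → ℂ} {lam : ℂ} {u f : Fin 3 → ℝ → ℂ} :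
    Solves q₂ q₃ 2 lam u f ↔
      Solves q₃ q₂ 1 lam (u ∘ Equiv.swap 1 2) (f ∘ Equiv.swap 1 2) := by
  refine ⟨Solves.swap (by simp), fun h => ?_⟩
  have := h.swap (l := 2) (by simp)
  simpa only [Function.comp_assoc, ← Equiv.coe_trans, Equiv.swap_swap, Equiv.coe_refl,
    Function.comp_id] using this

/-- The potentials matter only on `(0, 1)`. Cutting them off outside leaves the problem unchanged
and makes them integrable on every interval, as the preceding analysis assumes. -/
lemma hasSpectralAsymptotics_one {q₂ q₃ : ℝ → ℂ}
    (hq₂ : MemLp q₂ 2 (volume.restrict (Ioo (0 : ℝ) 1)))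
    (hq₃ : MemLp q₃ 2 (volume.restrict (Ioo (0 : ℝ) 1))) :
    HasSpectralAsymptotics (spectrumSet q₂ q₃ 1) (multiplicity q₂ q₃ 1)
      (modelF (∫ t in (0 : ℝ)..1, q₂ t) (∫ t in (0 : ℝ)..1, q₃ t) 1) := by
  have hE : ∀ q : ℝ → ℂ, EqOn ((Ioo 0 1).indicator q) q (Ioo 0 1) := fun q =>
    eqOn_indicator
  have hL : ∀ q : ℝ → ℂ, MemLp q 2 (volume.restrict (Ioo (0 : ℝ) 1)) →
      MemLp ((Ioo 0 1).indicator q) 2 (volume.restrict (Ioo (0 : ℝ) 1)) := fun q hq =>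
    hq.indicator measurableSet_Ioo
  have hI : ∀ q : ℝ → ℂ, MemLp q 2 (volume.restrict (Ioo (0 : ℝ) 1)) →
      ∀ a b, IntervalIntegrable ((Ioo 0 1).indicator q) volume a b := fun q hq a b =>
    ((integrable_indicator_iff measurableSet_Ioo).2 (hq.integrable one_le_two)).intervalIntegrable
  have hint : ∀ q : ℝ → ℂ, ∫ t in (0 : ℝ)..1, (Ioo 0 1).indicator q t = ∫ t in (0 : ℝ)..1, q t := by
    intro q
    rw [intervalIntegral.integral_of_le zero_le_one, intervalIntegral.integral_of_le zero_le_one,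
      integral_Ioc_eq_integral_Ioo, integral_Ioc_eq_integral_Ioo]
    exact setIntegral_congr_fun measurableSet_Ioo (hE q)
  have h := hasSpectralAsymptotics_of_intervalIntegrable (hI q₂ hq₂) (hI q₃ hq₃) (hL q₂ hq₂)
    (hL q₃ hq₃)
  have hS : ∀ lam u f, Solves q₂ q₃ 1 lam u f ↔ Solves ((Ioo 0 1).indicator q₂)
      ((Ioo 0 1).indicator q₃) 1 lam (u ∘ Equiv.refl (Fin 3)) (f ∘ Equiv.refl (Fin 3)) :=
    fun lam u f => ⟨Solves.congr_potential (hE q₂).symm (hE q₃).symm,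
      Solves.congr_potential (hE q₂) (hE q₃)⟩
  have hm : multiplicity q₂ q₃ 1 = multiplicity ((Ioo 0 1).indicator q₂) ((Ioo 0 1).indicator q₃) 1 :=
    funext fun lam => multiplicity_comp_perm (hS lam)
  rwa [hint, hint, ← spectrumSet_comp_perm hS, ← hm] at h

lemma modelF_two (ω₂ ω₃ : ℂ) : modelF ω₂ ω₃ 2 = modelF ω₃ ω₂ 1 := by
  funext lam
  rw [modelF, modelF, modelS, modelS]
  ring

lemma hasSpectralAsymptotics_two {q₂ q₃ : ℝ → ℂ}
    (hq₂ : MemLp q₂ 2 (volume.restrict (Ioo (0 : ℝ) 1)))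
    (hq₃ : MemLp q₃ 2 (volume.restrict (Ioo (0 : ℝ) 1))) :
    HasSpectralAsymptotics (spectrumSet q₂ q₃ 2) (multiplicity q₂ q₃ 2)
      (modelF (∫ t in (0 : ℝ)..1, q₂ t) (∫ t in (0 : ℝ)..1, q₃ t) 2) := by
  have hm : multiplicity q₂ q₃ 2 = multiplicity q₃ q₂ 1 :=
    funext fun lam => multiplicity_comp_perm fun u f => solves_two_iff
  rw [modelF_two, spectrumSet_comp_perm (q₂ := q₂) fun lam u f => solves_two_iff, hm]
  exact hasSpectralAsymptotics_one hq₃ hq₂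

end StarGraphDelay

end

theorem theorem1 (q₂ q₃ : ℝ → ℂ)
    (hq₂ : MemLp q₂ 2 (volume.restrict (Set.Ioo (0 : ℝ) 1)))
    (hq₃ : MemLp q₃ 2 (volume.restrict (Set.Ioo (0 : ℝ) 1)))
    (ω₂ ω₃ : ℂ) (hω₂ : ω₂ = ∫ x in (0 : ℝ)..1, q₂ x) (hω₃ : ω₃ = ∫ x in (0 : ℝ)..1, q₃ x)
    (k : ℕ) (hk : k = 1 ∨ k = 2) :
    (StarGraphDelay.spectrumSet q₂ q₃ k).Infinite ∧
    (∃ z₀ : ℕ → ℂ, StarGraphDelay.IsModelSequence ω₂ ω₃ k z₀) ∧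
    ∀ z₀ : ℕ → ℂ, StarGraphDelay.IsModelSequence ω₂ ω₃ k z₀ →
      ∃ z κ : ℕ → ℂ,
        Summable (fun n => ‖κ n‖ ^ 2) ∧
        (∀ n : ℕ, 1 ≤ n → z n = z₀ n + κ n / n) ∧
        StarGraphDelay.spectrumSet q₂ q₃ k = {lam | ∃ n : ℕ, 1 ≤ n ∧ lam = z n ^ 2} ∧
        ∀ lam : ℂ, {n : ℕ | 1 ≤ n ∧ z n ^ 2 = lam}.encard =
          StarGraphDelay.multiplicity q₂ q₃ k lam := by
  subst hω₂ hω₃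
  obtain rfl | rfl := hk
  -- `IsModelSequence` unfolds to `IsZeroSequence` of `modelF`, so the two statements agree by
  -- definition.
  · exact StarGraphDelay.hasSpectralAsymptotics_one hq₂ hq₃
  · exact StarGraphDelay.hasSpectralAsymptotics_two hq₂ hq₃
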